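/- Let $p\colon E\to C$ be a smooth real vector bundle of finite rank over a smooth manifold $C$, let $M=E$ be its total space, and identify $C$ with the zero section of $M$. Let $\{\cdot,\cdot\}$ be an arbitrary Poisson bracket on $C^\infty(M)$; the zero section need not be coisotropic. Let $A=\Gamma(C,\wedge E)=\bigoplus_j\Gamma(C,\wedge^jE)$, a graded commutative $\mathbb R$-algebra. A $P_\infty$-structure on $A$ is a sequence of $\mathbb R$-multilinear maps $\lambda_n\colon A^{n}\to A$ of degree $2-n$, $n=0,1,2,\dots$, such that for homogeneous arguments: (i) $\lambda_n(\dots,a_i,a_{i+1},\dots)=-(-1)^{|a_i||a_{i+1}|}\lambda_n(\dots,a_{i+1},a_i,\dots)$; (ii) $D\colon a\mapsto\lambda_n(a_1,\dots,a_{n-1},a)$ is a derivation of degree $|D|=2-n+\sum_{i<n}|a_i|$, i.e. $D(ab)=D(a)b+(-1)^{|D||a|}aD(b)$; (iii) for every $n\ge0$ the map $$a_1\otimes\cdots\otimes a_n\mapsto\sum_{q=0}^n\frac{(-1)^{q(n-q)}}{q!(n-q)!}\,\lambda_{n-q+1}\bigl(\lambda_q(a_1,\dots,a_q),a_{q+1},\dots,a_n\bigr)$$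 vanishes on the image of the (Koszul-signed) alternation map $\frac1{n!}\sum_{\sigma\in S_n}\mathrm{sign}(\sigma)\sigma$. A section $u$ of $E^*$ is regarded as a fibre-linear function on $M$, and a section $v$ of $E$ as a vertical vector field on $M$ that is constant along each fibre. For such a $v$ and a bidifferential operation $B$ on $C^\infty(M)$ let $(L_vB)(F,G)=v(B(F,G))-B(vF,G)-B(F,vG)$ be the Lie derivative. Put $\varepsilon_n=(-1)^{(n-1)(n-2)/2}$, and let $\langle a\wedge b,u\otimes w\rangle=\langle a,u\rangle\langle b,w\rangle-\langle b,u\rangle\langle a,w\rangle$. Then there is a unique $P_\infty$-structure $(\lambda_n)_{n\ge0}$ on $\Gamma(C,\wedge E)$ such that for all $v_1,\dots,v_n\in\Gamma(C,E)$, $f,g\in C^\infty(C)$ and $u,w\in\Gamma(C,E^*)$ $$\lambda_n(v_1,\dots,v_{n-2},f,g)=\varepsilon_n\,v_1\cdots v_{n-2}\{p^*f,p^*g\}|_C\qquad(n\ge2),$$ $$\langle\lambda_n(v_1,\dots,v_{n-1},f),u\rangle=\varepsilon_n\,\bigl(L_{v_1}\cdots L_{v_{n-1}}\{\cdot,\cdot\}\bigr)(p^*f,u)|_C\qquad(n\ge1),$$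 $$\langle\lambda_n(v_1,\dots,v_n),u\otimes w\rangle=\varepsilon_n\,\bigl(L_{v_1}\cdots L_{v_n}\{\cdot,\cdot\}\bigr)(u,w)|_C\qquad(n\ge0).$$ (When the functions $\langle v_i,u\rangle$ and $\langle v_i,w\rangle$ are locally constant, for instance for sections with constant coefficients in a local frame, the last two right-hand sides are $\varepsilon_n v_1\cdots v_{n-1}\{p^*f,u\}|_C$ and $\varepsilon_n v_1\cdots v_n\{u,w\}|_C$.) -/

import Mathlib

open Bundle Manifold
open scoped ContDiff

noncomputable section

section ExteriorFacts
variable {R M N : Type*} [CommRing R] [AddCommGroup M] [Module R M] [AddCommGroup N] [Module R N]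

theorem exteriorAlgebra_ι_mul_comm (v : M) {j : ℕ} {b : ExteriorAlgebra R M}
    (hb : b ∈ ⋀[R]^j M) :
    ExteriorAlgebra.ι R v * b = (-1 : R) ^ j • (b * ExteriorAlgebra.ι R v) := by
  induction hb using Submodule.pow_induction_on_left' with
  | algebraMap r => simp [Algebra.commutes]
  | add x y i hx hy ihx ihy => rw [mul_add, add_mul, smul_add, ihx, ihy]
  | mem_mul m hm i x hx ih =>
    obtain ⟨w, rfl⟩ := hm
    have h := ExteriorAlgebra.ι_add_mul_swap (R := R) v w
    have h' : ExteriorAlgebra.ι R v * ExteriorAlgebra.ι R w =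
        - (ExteriorAlgebra.ι R w * ExteriorAlgebra.ι R v) := eq_neg_of_add_eq_zero_left h
    rw [← mul_assoc, h', neg_mul, mul_assoc, ih, mul_smul_comm, pow_succ, mul_neg_one, neg_smul,
      mul_assoc]

theorem exteriorAlgebra_mul_comm {i j : ℕ} {a b : ExteriorAlgebra R M}
    (ha : a ∈ ⋀[R]^i M) (hb : b ∈ ⋀[R]^j M) :
    a * b = (-1 : R) ^ (i * j) • (b * a) := by
  induction ha using Submodule.pow_induction_on_left' with
  | algebraMap r => simp [Algebra.commutes]
  | add x y i hx hy ihx ihy => rw [mul_add, add_mul, smul_add, ihx, ihy]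
  | mem_mul m hm i x hx ih =>
    obtain ⟨w, rfl⟩ := hm
    rw [mul_assoc, ih, mul_smul_comm, ← mul_assoc, exteriorAlgebra_ι_mul_comm w hb,
      smul_mul_assoc, smul_smul, mul_assoc, ← pow_add]
    congr 2; rw [Nat.succ_mul]

theorem exteriorAlgebra_map_mem (f : M →ₗ[R] N) {j : ℕ} {b : ExteriorAlgebra R M}
    (hb : b ∈ ⋀[R]^j M) : ExteriorAlgebra.map f b ∈ ⋀[R]^j N := by
  induction hb using Submodule.pow_induction_on_left' with
  | algebraMap r => rw [AlgHom.commutes]; exact SetLike.algebraMap_mem_graded _ r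
  | add x y i hx hy ihx ihy => rw [map_add]; exact add_mem ihx ihy
  | mem_mul m hm i x hx ih =>
    obtain ⟨w, rfl⟩ := hm
    rw [map_mul, ExteriorAlgebra.map_apply_ι, ExteriorAlgebra.exteriorPower, pow_succ']
    exact Submodule.mul_mem_mul ⟨_, rfl⟩ ih

theorem exteriorAlgebra_map_proj (f : M →ₗ[R] N) (k : ℕ) (b : ExteriorAlgebra R M) :
    ExteriorAlgebra.map f (GradedRing.proj (fun i : ℕ ↦ ⋀[R]^i M) k b) =
      GradedRing.proj (fun i : ℕ ↦ ⋀[R]^i N) k (ExteriorAlgebra.map f b) := by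
  classical
  induction b using DirectSum.Decomposition.inductionOn (fun i : ℕ ↦ ⋀[R]^i M) with
  | zero => simp
  | @homogeneous i m =>
    have hm := exteriorAlgebra_map_mem f m.2
    simp only [GradedRing.proj_apply]
    by_cases h : i = k
    · subst h
      rw [DirectSum.decompose_of_mem_same (fun i : ℕ ↦ ⋀[R]^i M) m.2,
        DirectSum.decompose_of_mem_same (fun i : ℕ ↦ ⋀[R]^i N) hm]
    · rw [DirectSum.decompose_of_mem_ne (fun i : ℕ ↦ ⋀[R]^i M) m.2 h,
        DirectSum.decompose_of_mem_ne (fun i : ℕ ↦ ⋀[R]^i N) hm h, map_zero]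
  | add m m' h h' => simp only [map_add, h, h']

theorem exteriorPower_eq_bot (K : Type*) {V : Type*} [Field K] [AddCommGroup V] [Module K V] [FiniteDimensional K V]
   {k : ℕ} (hk : Module.finrank K V < k) : ⋀[K]^k V = ⊥ := by
  rw [← Submodule.finrank_eq_zero, exteriorPower.finrank_eq, Nat.choose_eq_zero_of_lt hk]
end ExteriorFacts

section Poisson

/-- A Poisson bracket on a commutative `𝕜`-algebra. -/
structure PoissonBracket (𝕜 R : Type*) [CommRing 𝕜] [CommRing R] [Algebra 𝕜 R] where
  bracket : R →ₗ[𝕜] R →ₗ[𝕜] R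
  skew : ∀ f g, bracket f g = -bracket g f
  leibniz : ∀ f g h, bracket f (g * h) = bracket f g * h + g * bracket f h
  jacobi : ∀ f g h, bracket f (bracket g h) + bracket g (bracket h f) + bracket h (bracket f g) = 0

end Poisson

section PInfty

/-- The Koszul sign of the rearrangement `a₀, …, aₙ₋₁ ↦ a_{σ 0}, …, a_{σ (n-1)}` of homogeneous
elements of degrees `d`: one factor `(-1) ^ (|a| * |b|)` for each pair that changes order. -/
def koszulSign {n : ℕ} (d : Fin n → ℤ) (σ : Equiv.Perm (Fin n)) : ℤˣ :=
  ∏ p : Fin n × Fin n with p.1 < p.2 ∧ σ p.2 < σ p.1, (d (σ p.1) * d (σ p.2)).negOnePow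

/-- Graded commutativity: `a b = (-1) ^ (|a| |b|) b a` for homogeneous `a`, `b`. -/
class IsGradedComm {𝕜 A : Type*} [Field 𝕜] [Ring A] [Algebra 𝕜 A] (𝒜 : ℤ → Submodule 𝕜 A)
    [GradedAlgebra 𝒜] : Prop where
  mul_comm : ∀ (i j : ℤ) (a b : A), a ∈ 𝒜 i → b ∈ 𝒜 j → a * b = (i * j).negOnePow • (b * a)

/-- The expression
`∑_{q=0}^n (-1)^{q(n-q)} / (q! (n-q)!) λ_{n-q+1}(λ_q(a_1,…,a_q), a_{q+1},…,a_n)`. -/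
def jacobiTerm {𝕜 A : Type*} [Field 𝕜] [Ring A] [Algebra 𝕜 A]
    (br : ∀ n : ℕ, MultilinearMap 𝕜 (fun _ : Fin n ↦ A) A) (n : ℕ) (a : Fin n → A) : A :=
  ∑ q : Fin (n + 1),
    ((-1 : 𝕜) ^ ((q : ℕ) * (n - q)) / ((Nat.factorial q : 𝕜) * (Nat.factorial (n - q) : 𝕜))) •
      br (n - q + 1)
        (Fin.cons (α := fun _ ↦ A) (br q fun i : Fin q ↦ a ⟨i, by omega⟩)
          fun j : Fin (n - q) ↦ a ⟨q + j, by omega⟩)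

/-- A (not necessarily flat) `P_∞`-structure on a graded commutative algebra `A = ⨁ 𝒜 j` over a
field of characteristic zero: multilinear maps `br n = λ_n` of degree `2 - n` which are graded
skew-symmetric, are derivations in the last argument, and satisfy the generalized Jacobi
identities, that is, the map `jacobiTerm` vanishes on graded alternations. -/
structure PInftyStructure {𝕜 A : Type*} [Field 𝕜] [CharZero 𝕜] [Ring A] [Algebra 𝕜 A]
    (𝒜 : ℤ → Submodule 𝕜 A) [GradedAlgebra 𝒜] [IsGradedComm 𝒜] where
  br : ∀ n : ℕ, MultilinearMap 𝕜 (fun _ : Fin n ↦ A) A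
  degree : ∀ (n : ℕ) (d : Fin n → ℤ) (a : Fin n → A), (∀ i, a i ∈ 𝒜 (d i)) →
    br n a ∈ 𝒜 (2 - n + ∑ i, d i)
  skew : ∀ (n : ℕ) (d : Fin (n + 1) → ℤ) (a : Fin (n + 1) → A), (∀ i, a i ∈ 𝒜 (d i)) →
    ∀ i : Fin n, br (n + 1) a =
      -((d i.castSucc * d i.succ).negOnePow •
        br (n + 1) (a ∘ Equiv.swap i.castSucc i.succ))
  leibniz : ∀ (n : ℕ) (d : Fin n → ℤ) (a : Fin n → A), (∀ i, a i ∈ 𝒜 (d i)) →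
    ∀ (e : ℤ) (b c : A), b ∈ 𝒜 e →
      br (n + 1) (Fin.snoc (α := fun _ ↦ A) a (b * c)) =
        br (n + 1) (Fin.snoc (α := fun _ ↦ A) a b) * c +
          (e * (2 - (n + 1) + ∑ i, d i)).negOnePow •
            (b * br (n + 1) (Fin.snoc (α := fun _ ↦ A) a c))
  jacobi : ∀ (n : ℕ) (d : Fin n → ℤ) (a : Fin n → A), (∀ i, a i ∈ 𝒜 (d i)) →
    ∑ σ : Equiv.Perm (Fin n), (Equiv.Perm.sign σ * koszulSign d σ) • jacobiTerm br n (a ∘ σ) = 0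

end PInfty

section Geometry

variable {EB : Type*} [NormedAddCommGroup EB] [NormedSpace ℝ EB]
  {HB : Type*} [TopologicalSpace HB] (I : ModelWithCorners ℝ EB HB)
  {C : Type*} [TopologicalSpace C] [ChartedSpace HB C]
  (F : Type*) [NormedAddCommGroup F] [NormedSpace ℝ F] [FiniteDimensional ℝ F]
  (E : C → Type*) [∀ x, AddCommGroup (E x)] [∀ x, Module ℝ (E x)]
  [TopologicalSpace (TotalSpace F E)] [∀ x, TopologicalSpace (E x)]
  [FiberBundle F E] [VectorBundle ℝ F E]

/-- The algebra `Γ(C, ∧E)` of smooth sections of the exterior algebra bundle of `E`: families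
`s x ∈ ∧(E x)` which in each of the preferred local trivializations of `E` become smooth maps to
the finite-dimensional space `∧F` (all their coordinates `ℓ` are smooth). -/
def extSections : Subalgebra ℝ (∀ x, ExteriorAlgebra ℝ (E x)) where
  carrier := {s | ∀ (x₀ : C) (ℓ : ExteriorAlgebra ℝ F →ₗ[ℝ] ℝ),
    ContMDiffOn I 𝓘(ℝ, ℝ) ∞
      (fun x ↦ ℓ (ExteriorAlgebra.map ((trivializationAt F E x₀).linearMapAt ℝ x) (s x)))
      (trivializationAt F E x₀).baseSet}
  mul_mem' := by
    intro a b ha hb x₀ ℓ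
    let B := (Module.finBasis ℝ F).ExteriorAlgebra
    have key : ∀ u v : ExteriorAlgebra ℝ F, ℓ (u * v) =
        ∑ i, ∑ j, (B.coord i u * B.coord j v) * ℓ (B i * B j) := by
      intro u v
      conv_lhs => rw [← B.sum_repr u, ← B.sum_repr v]
      rw [Finset.sum_mul_sum, map_sum]
      refine Finset.sum_congr rfl fun i _ ↦ ?_
      rw [map_sum]
      refine Finset.sum_congr rfl fun j _ ↦ ?_
      rw [smul_mul_smul_comm, map_smul, smul_eq_mul, Module.Basis.coord_apply,
        Module.Basis.coord_apply]
    refine ContMDiffOn.congr (f := fun x ↦ ∑ i, ∑ j,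
      (B.coord i (ExteriorAlgebra.map ((trivializationAt F E x₀).linearMapAt ℝ x) (a x)) *
        B.coord j (ExteriorAlgebra.map ((trivializationAt F E x₀).linearMapAt ℝ x) (b x))) *
          ℓ (B i * B j)) ?_ fun x _ ↦ ?_
    · exact contMDiffOn_finsetSum fun i _ ↦ contMDiffOn_finsetSum fun j _ ↦
        ((ha x₀ _).mul (hb x₀ _)).mul contMDiffOn_const
    · rw [Pi.mul_apply, map_mul, key]
  add_mem' := by
    intro a b ha hb x₀ ℓ
    simp only [Pi.add_apply, map_add]
    exact (ha x₀ ℓ).add (hb x₀ ℓ)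
  algebraMap_mem' := by
    intro r x₀ ℓ
    simp only [Pi.algebraMap_apply, AlgHom.commutes]
    exact contMDiffOn_const

/-- The degree `j` part `Γ(C, ∧ʲE)` of `Γ(C, ∧E)`; it is zero for `j < 0`. -/
def extSectionsDeg : ℤ → Submodule ℝ (extSections I F E)
  | (k : ℕ) =>
    { carrier := {s | ∀ x, s.1 x ∈ ⋀[ℝ]^k (E x)}
      add_mem' := fun ha hb x ↦ add_mem (ha x) (hb x)
      zero_mem' := fun _ ↦ zero_mem _
      smul_mem' := fun r _ ha x ↦ Submodule.smul_mem _ r (ha x) }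
  | Int.negSucc _ => ⊥

variable {I F E}

theorem mem_extSectionsDeg_natCast {k : ℕ} {s : extSections I F E} :
    s ∈ extSectionsDeg I F E (k : ℤ) ↔ ∀ x, s.1 x ∈ ⋀[ℝ]^k (E x) := Iff.rfl

theorem eq_zero_of_mem_negSucc {k : ℕ} {s : extSections I F E}
    (h : s ∈ extSectionsDeg I F E (Int.negSucc k)) : s = 0 := h

/-- The projection of `Γ(C, ∧E)` onto its part of degree `k`. -/
def extSectionsProj (k : ℕ) : extSections I F E →ₗ[ℝ] extSectionsDeg I F E (k : ℤ) where
  toFun s := ⟨⟨fun x ↦ GradedRing.proj (fun i : ℕ ↦ ⋀[ℝ]^i (E x)) k (s.1 x), by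
    intro x₀ ℓ
    simp only [exteriorAlgebra_map_proj]
    exact s.2 x₀ (ℓ ∘ₗ GradedAlgebra.proj (fun i : ℕ ↦ ⋀[ℝ]^i F) k)⟩, fun x ↦ by
      simp only [GradedRing.proj_apply]; exact SetLike.coe_mem _⟩
  map_add' s t := by ext x; simp
  map_smul' r s := by
    ext x
    exact (GradedAlgebra.proj (fun i : ℕ ↦ ⋀[ℝ]^i (E x)) k).map_smul r (s.1 x)

variable (F) in
theorem finrank_fibre (x : C) : FiniteDimensional ℝ (E x) ∧
    Module.finrank ℝ (E x) = Module.finrank ℝ F := by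
  have e := (trivializationAt F E x).linearEquivAt ℝ x (FiberBundle.mem_baseSet_trivializationAt' x)
  exact ⟨e.symm.finiteDimensional, e.finrank_eq⟩

theorem eq_zero_of_finrank_lt {k : ℕ} (hk : Module.finrank ℝ F < k) {s : extSections I F E}
    (h : s ∈ extSectionsDeg I F E (k : ℤ)) : s = 0 := by
  ext x
  obtain ⟨h1, h2⟩ := finrank_fibre F (E := E) x
  have := h x
  rw [exteriorPower_eq_bot ℝ (by omega)] at this
  exact this

instance : SetLike.GradedMonoid (extSectionsDeg I F E) where
  one_mem x := SetLike.GradedOne.one_mem (A := fun i : ℕ ↦ ⋀[ℝ]^i (E x))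
  mul_mem := by
    rintro (i | i) (j | j) a b ha hb
    · exact fun x ↦ SetLike.GradedMul.mul_mem (A := fun i : ℕ ↦ ⋀[ℝ]^i (E x)) (ha x) (hb x)
    · rw [eq_zero_of_mem_negSucc hb, mul_zero]; exact zero_mem _
    · rw [eq_zero_of_mem_negSucc ha, zero_mul]; exact zero_mem _
    · rw [eq_zero_of_mem_negSucc ha, zero_mul]; exact zero_mem _

instance : DirectSum.Decomposition (extSectionsDeg I F E) :=
  DirectSum.Decomposition.ofLinearMap _
    (∑ k ∈ Finset.range (Module.finrank ℝ F + 1),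
      DirectSum.lof ℝ ℤ (fun i ↦ extSectionsDeg I F E i) (k : ℤ) ∘ₗ extSectionsProj k)
    (by
      classical
      ext s x
      obtain ⟨h1, h2⟩ := finrank_fibre F (E := E) x
      simp only [LinearMap.comp_apply, LinearMap.sum_apply, map_sum, DirectSum.coeLinearMap_lof,
        LinearMap.id_apply]
      have hb : ∀ k ∉ Finset.range (Module.finrank ℝ F + 1),
          ((DirectSum.decompose (fun i : ℕ ↦ ⋀[ℝ]^i (E x)) (s.1 x) k : ⋀[ℝ]^k (E x)) :
            ExteriorAlgebra ℝ (E x)) = 0 := by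
        intro k hk
        have hm := SetLike.coe_mem (DirectSum.decompose (fun i : ℕ ↦ ⋀[ℝ]^i (E x)) (s.1 x) k)
        exact (exteriorPower_eq_bot ℝ (by simp at hk; omega)).le hm
      have hs := DirectSum.sum_support_decompose (fun i : ℕ ↦ ⋀[ℝ]^i (E x)) (s.1 x)
      rw [Finset.sum_subset (s₂ := Finset.range (Module.finrank ℝ F + 1))] at hs
      · simp only [AddSubmonoidClass.coe_finsetSum, Finset.sum_apply]
        exact hs
      · intro k hk
        by_contra hk'
        exact (DFinsupp.mem_support_toFun _ _).1 hk (Subtype.ext (hb k hk'))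
      · intro k _ hk
        by_contra h
        exact hk ((DFinsupp.mem_support_toFun _ _).2 fun h' ↦ h (by rw [h']; rfl)))
    (by
      refine DirectSum.linearMap_ext ℝ fun i ↦ LinearMap.ext fun s ↦ ?_
      simp only [LinearMap.comp_apply, DirectSum.coeLinearMap_lof, LinearMap.sum_apply,
        LinearMap.id_apply]
      rcases i with i | i
      · have hproj : ∀ k : ℕ, k ≠ i → extSectionsProj k s.1 = 0 := by
          intro k hk
          ext x
          exact DirectSum.decompose_of_mem_ne (fun i : ℕ ↦ ⋀[ℝ]^i (E x)) (s.2 x) (Ne.symm hk)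
        have hself : extSectionsProj i s.1 = s := by
          ext x
          exact DirectSum.decompose_of_mem_same (fun i : ℕ ↦ ⋀[ℝ]^i (E x)) (s.2 x)
        by_cases hi : i ∈ Finset.range (Module.finrank ℝ F + 1)
        · rw [Finset.sum_eq_single_of_mem i hi fun k _ hk ↦ by rw [hproj k hk, map_zero], hself]
          rfl
        · have : s = 0 := Subtype.ext (eq_zero_of_finrank_lt (by simp at hi; omega) s.2)
          subst this
          simp
      · have : s = 0 := Subtype.ext (eq_zero_of_mem_negSucc s.2)
        subst this
        simp)

instance : GradedAlgebra (extSectionsDeg I F E) where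

instance : IsGradedComm (extSectionsDeg I F E) where
  mul_comm := by
    rintro (i | i) (j | j) a b ha hb
    · ext x
      have := exteriorAlgebra_mul_comm (ha x) (hb x)
      rw [show (Int.ofNat i * Int.ofNat j) = ((i * j : ℕ) : ℤ) by simp, Units.smul_def, Int.coe_negOnePow_natCast,
        ← Int.cast_smul_eq_zsmul ℝ]
      push_cast
      exact this
    · rw [eq_zero_of_mem_negSucc hb, mul_zero, zero_mul, smul_zero]
    · rw [eq_zero_of_mem_negSucc ha, mul_zero, zero_mul, smul_zero]
    · rw [eq_zero_of_mem_negSucc ha, mul_zero, zero_mul, smul_zero]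

/-- A smooth function on `C`, as an element of `Γ(C, ∧⁰E)`. -/
def fnSection (f : C^∞⟮I, C; ℝ⟯) : extSections I F E :=
  ⟨fun x ↦ algebraMap ℝ _ (f x), by
    intro x₀ ℓ
    simp only [AlgHom.commutes]
    simp only [Algebra.algebraMap_eq_smul_one, map_smul, smul_eq_mul]
    exact f.contMDiff.contMDiffOn.mul contMDiffOn_const⟩

variable [ContMDiffVectorBundle ∞ F E I]

/-- A smooth section of `E`, as an element of `Γ(C, ∧¹E)`. -/
def vecSection (v : Cₛ^∞⟮I; F, E⟯) : extSections I F E :=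
  ⟨fun x ↦ ExteriorAlgebra.ι ℝ (v x), by
    intro x₀ ℓ
    have h := ((trivializationAt F E x₀).contMDiffOn_section_baseSet_iff (IB := I) (n := ∞)).1
      v.contMDiff.contMDiffOn
    have hl : ContDiff ℝ ∞ (LinearMap.toContinuousLinearMap (ℓ ∘ₗ ExteriorAlgebra.ι ℝ)) :=
      ContinuousLinearMap.contDiff _
    refine (hl.contMDiff.comp_contMDiffOn h).congr fun x hx ↦ ?_
    simp [ExteriorAlgebra.map_apply_ι, Trivialization.linearMapAt_apply, hx]⟩

/-- The pull-back `p^* f` of a function on the base to the total space. -/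
def pullback (f : C^∞⟮I, C; ℝ⟯) : C^∞⟮I.prod 𝓘(ℝ, F), TotalSpace F E; ℝ⟯ :=
  ⟨fun e ↦ f e.proj, f.contMDiff.comp (contMDiff_proj E)⟩

theorem contMDiff_addVertical (v : Cₛ^∞⟮I; F, E⟯) :
    ContMDiff (𝓘(ℝ, ℝ).prod (I.prod 𝓘(ℝ, F))) (I.prod 𝓘(ℝ, F)) ∞
      (fun p : ℝ × TotalSpace F E ↦ (⟨p.2.proj, p.2.2 + p.1 • v p.2.proj⟩ : TotalSpace F E)) := by
  intro p₀
  have hp : ContMDiff (𝓘(ℝ, ℝ).prod (I.prod 𝓘(ℝ, F))) I ∞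
      (fun p : ℝ × TotalSpace F E ↦ p.2.proj) := (contMDiff_proj E).comp contMDiff_snd
  rw [contMDiffAt_totalSpace]
  refine ⟨hp p₀, ?_⟩
  have h1 := (contMDiffAt_totalSpace.1 ((contMDiff_snd (I := 𝓘(ℝ, ℝ)) (J := I.prod 𝓘(ℝ, F))
    (M := ℝ) (N := TotalSpace F E) (n := ∞)) p₀)).2
  have h2 := (contMDiffAt_totalSpace.1 ((v.contMDiff.comp hp) p₀)).2
  have h3 : ContMDiffAt (𝓘(ℝ, ℝ).prod (I.prod 𝓘(ℝ, F))) 𝓘(ℝ, ℝ) ∞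
      (fun p : ℝ × TotalSpace F E ↦ p.1) p₀ := contMDiff_fst p₀
  refine (h1.add (h3.smul h2)).congr_of_eventuallyEq ?_
  have hmem : ∀ᶠ p : ℝ × TotalSpace F E in nhds p₀,
      p.2.proj ∈ (trivializationAt F E p₀.2.proj).baseSet :=
    hp.continuous.continuousAt.eventually
      ((trivializationAt F E p₀.2.proj).open_baseSet.mem_nhds
        (FiberBundle.mem_baseSet_trivializationAt' p₀.2.proj))
  filter_upwards [hmem] with p hpm
  have hl := (trivializationAt F E p₀.2.proj).linear ℝ hpm
  simp only [Function.comp_apply]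
  rw [hl.map_add, hl.map_smul]
  rfl

variable [IsManifold I ∞ C]

/-- The derivative `v h` of a function on the total space along the vertical vector field defined
by a section `v` of `E`: at a point `y` of the fibre over `x`, the derivative of
`t ↦ h (y + t v(x))` at `t = 0`. -/
def vertDeriv (v : Cₛ^∞⟮I; F, E⟯) (h : C^∞⟮I.prod 𝓘(ℝ, F), TotalSpace F E; ℝ⟯) :
    C^∞⟮I.prod 𝓘(ℝ, F), TotalSpace F E; ℝ⟯ :=
  ⟨fun e ↦ deriv (fun t : ℝ ↦ h ⟨e.proj, e.2 + t • v e.proj⟩) 0, by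
    have : IsManifold (I.prod 𝓘(ℝ, F)) 1 (TotalSpace F E) := IsManifold.of_le (n := ∞) (by simp)
    intro e₀
    have hG : ContMDiffAt ((I.prod 𝓘(ℝ, F)).prod 𝓘(ℝ, ℝ)) 𝓘(ℝ, ℝ) ∞
        (Function.uncurry fun (e : TotalSpace F E) (t : ℝ) ↦
          h ⟨e.proj, e.2 + t • v e.proj⟩) (e₀, 0) :=
      ((h.contMDiff.comp (contMDiff_addVertical v)).comp
        (contMDiff_snd.prodMk contMDiff_fst)) (e₀, 0)
    have := ContMDiffAt.mfderiv (m := ∞) (fun (e : TotalSpace F E) (t : ℝ) ↦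
          h ⟨e.proj, e.2 + t • v e.proj⟩) (fun _ ↦ (0 : ℝ)) hG contMDiffAt_const (by simp)
    simp only [inTangentCoordinates_model_space, mfderiv_eq_fderiv] at this
    exact this.clm_apply contMDiffAt_const⟩

/-- The Lie derivative of a bidifferential operation `B` on functions of the total space, along
the vertical vector field of `v`: `(L_v B)(f, g) = v (B(f, g)) - B(v f, g) - B(f, v g)`. -/
def lieVert (v : Cₛ^∞⟮I; F, E⟯)
    (B : C^∞⟮I.prod 𝓘(ℝ, F), TotalSpace F E; ℝ⟯ → C^∞⟮I.prod 𝓘(ℝ, F), TotalSpace F E; ℝ⟯ →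
      C^∞⟮I.prod 𝓘(ℝ, F), TotalSpace F E; ℝ⟯) :
    C^∞⟮I.prod 𝓘(ℝ, F), TotalSpace F E; ℝ⟯ → C^∞⟮I.prod 𝓘(ℝ, F), TotalSpace F E; ℝ⟯ →
      C^∞⟮I.prod 𝓘(ℝ, F), TotalSpace F E; ℝ⟯ :=
  fun f g ↦ vertDeriv v (B f g) - B (vertDeriv v f) g - B f (vertDeriv v g)

/-- The iterated derivative `v_1 (v_2 (⋯ (v_n h)))`. -/
def iterVertDeriv {n : ℕ} (v : Fin n → Cₛ^∞⟮I; F, E⟯)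
    (h : C^∞⟮I.prod 𝓘(ℝ, F), TotalSpace F E; ℝ⟯) : C^∞⟮I.prod 𝓘(ℝ, F), TotalSpace F E; ℝ⟯ :=
  (List.ofFn v).foldr vertDeriv h

/-- The iterated Lie derivative `L_{v_1} (L_{v_2} (⋯ (L_{v_n} B)))`. -/
def iterLieVert {n : ℕ} (v : Fin n → Cₛ^∞⟮I; F, E⟯)
    (B : C^∞⟮I.prod 𝓘(ℝ, F), TotalSpace F E; ℝ⟯ → C^∞⟮I.prod 𝓘(ℝ, F), TotalSpace F E; ℝ⟯ →
      C^∞⟮I.prod 𝓘(ℝ, F), TotalSpace F E; ℝ⟯) :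
    C^∞⟮I.prod 𝓘(ℝ, F), TotalSpace F E; ℝ⟯ → C^∞⟮I.prod 𝓘(ℝ, F), TotalSpace F E; ℝ⟯ →
      C^∞⟮I.prod 𝓘(ℝ, F), TotalSpace F E; ℝ⟯ :=
  (List.ofFn v).foldr lieVert B

/-- The point `0 ∈ E x` of the zero section. -/
def zeroPt (F : Type*) {E : C → Type*} [∀ x, AddCommGroup (E x)] (x : C) : TotalSpace F E := ⟨x, 0⟩

section dual
variable [∀ x, IsTopologicalAddGroup (E x)] [∀ x, ContinuousSMul ℝ (E x)]

/-- A section of the dual bundle `E^*`, regarded as a function on the total space of `E` which is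
linear on the fibres. -/
def fibreLinear (u : Cₛ^∞⟮I; F →L[ℝ] ℝ, fun x ↦ E x →L[ℝ] Trivial C ℝ x⟯) :
    C^∞⟮I.prod 𝓘(ℝ, F), TotalSpace F E; ℝ⟯ :=
  ⟨fun e ↦ u e.proj e.2, by
    have h := ContMDiff.clm_bundle_apply (IB := I) (F₁ := F) (F₂ := ℝ) (E₁ := E)
      (E₂ := Trivial C ℝ) (n := ∞) (IM := I.prod 𝓘(ℝ, F)) (b := fun e : TotalSpace F E ↦ e.proj)
      (ϕ := fun e ↦ u e.proj) (v := fun e ↦ e.2)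
      (u.contMDiff.comp (contMDiff_proj E)) contMDiff_id
    intro e
    exact (contMDiffAt_totalSpace.1 (h e)).2⟩

end dual

end Geometry

section Pairing

variable {V : Type*} [AddCommGroup V] [Module ℝ V]

/-- The pairing `⟨ξ, u⟩` of `ξ ∈ ∧¹V` with a covector: `⟨a, u⟩ = u(a)`. -/
def pairOne (ξ : ExteriorAlgebra ℝ V) (u : Module.Dual ℝ V) : ℝ :=
  ExteriorAlgebra.algebraMapInv (CliffordAlgebra.contractLeft u ξ)

/-- The pairing `⟨ξ, u ⊗ w⟩` of `ξ ∈ ∧²V` with a pair of covectors: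
`⟨a ∧ b, u ⊗ w⟩ = u(a) w(b) - u(b) w(a)`. -/
def pairTwo (ξ : ExteriorAlgebra ℝ V) (u w : Module.Dual ℝ V) : ℝ :=
  ExteriorAlgebra.algebraMapInv
    (CliffordAlgebra.contractLeft w (CliffordAlgebra.contractLeft u ξ))

theorem pairOne_ι (a : V) (u : Module.Dual ℝ V) : pairOne (ExteriorAlgebra.ι ℝ a) u = u a := by
  unfold pairOne ExteriorAlgebra.ι
  rw [CliffordAlgebra.contractLeft_ι]
  exact ExteriorAlgebra.algebraMap_leftInverse V _

theorem pairTwo_ι_mul_ι (a b : V) (u w : Module.Dual ℝ V) :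
    pairTwo (ExteriorAlgebra.ι ℝ a * ExteriorAlgebra.ι ℝ b) u w = u a * w b - u b * w a := by
  unfold pairTwo ExteriorAlgebra.ι
  rw [CliffordAlgebra.contractLeft_ι_mul, CliffordAlgebra.contractLeft_ι, map_sub, map_smul,
    CliffordAlgebra.contractLeft_ι, CliffordAlgebra.contractLeft_mul_algebraMap,
    CliffordAlgebra.contractLeft_ι, map_sub, map_smul, map_mul]
  have h : ∀ r : ℝ, ExteriorAlgebra.algebraMapInv (algebraMap ℝ (ExteriorAlgebra ℝ V) r) = r :=
    ExteriorAlgebra.algebraMap_leftInverse V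
  erw [h, h, h]
  simp [mul_comm]

end Pairing

/-- The sign `(-1) ^ ((n-1)(n-2)/2)`: `-1, 1, 1, -1, -1, 1, 1, …` for `n = 0, 1, 2, …`. -/
def pInftySign (n : ℕ) : ℝ := (-1) ^ (n * (n + 1) / 2 + 1)

end

/-! The brackets are Voronov's higher derived brackets. Near a point of the zero section a Poisson
bracket is given by a bivector field `H` on a product chart `EB × F`, and the Jacobi identity says
that the Schouten square `{H, H}` vanishes (`PoissonBracket.exists_bivector`). Elements of `Γ(C,
∧E)` become vertical polyvector fields constant along the fibres. These form an abelian subalgebra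
for the Schouten bracket. It is the image of the projection `P`, which restricts a polyvector field
to the zero section and discards its horizontal part. One sets `λ_n(a₁, …, aₙ) = ± P{…{{H, a₁}, a₂},
…, aₙ}`. Nothing requires `P H = 0`, so `λ_0` may be nonzero and the zero section need not be
coisotropic.

Commutativity of the image of `P` makes the operators "bracket with `a`" commute up to sign, and
this is the skew symmetry (`Darboux.tau_comm`). Bracketing is a derivation (`Darboux.tau_mul`). For
the Jacobi identities let `ξ` be a single odd argument and `D = {·, ξ}`. Then `D` is a derivation of
the Schouten bracket, and expanding `P Dⁿ{H, H}` by the binomial formula and by `P{K, L} = P{K, P L}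
+ P{P K, L}` yields twice the sum of nested brackets (`Darboux.sum_nested_odd`). Arbitrary arguments
are combined into one odd argument `∑ a_k η_k` over an enlarged exterior algebra. Comparing
coefficients of the product of all parameters gives the alternated identity
(`Darboux.sum_perm_nested`).

The prescribed values hold because bracketing with a vertical vector field is minus a Lie derivative
(`Represents.lie`), and bracketing with a function is minus contraction with its differential
(`IsLocalModel.tau_fn`).

Uniqueness is pointwise (`IsPInftyAt.eq`). A skew multiderivation at `x` is determined by its values
on functions and sections of `E`, and for degree reasons it vanishes when more than two arguments
are functions. The remaining values lie in degrees 2, 1, 0, where the pairings with covectors detect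
them. The same uniqueness shows that brackets computed in different charts agree, so the local
constructions glue with no change-of-coordinates formula. -/

open Bundle Manifold
open scoped ContDiff

noncomputable section

set_option linter.unusedSectionVars false

/-! ### The Schouten bracket in Darboux coordinates and its iterated brackets. -/

section

/-- A graded commutative superalgebra with even coordinate derivations `d i` and odd derivations
`c i` dual to the polyvector generators, and a projection `P` onto the functions of the base
variables and the fibre generators. -/
structure Darboux (X Y T : Type*) [Ring T] [Algebra ℝ T] where
  inv : T →ₐ[ℝ] T
  inv_inv : ∀ K, inv (inv K) = K
  d : X ⊕ Y → T →ₗ[ℝ] T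
  d_mul : ∀ i K L, d i (K * L) = d i K * L + K * d i L
  c : X ⊕ Y → T →ₗ[ℝ] T
  c_mul : ∀ i K L, c i (K * L) = c i K * L + inv K * c i L
  d_d : ∀ i j K, d i (d j K) = d j (d i K)
  c_c : ∀ i j K, c i (c j K) = -c j (c i K)
  d_c : ∀ i j K, d i (c j K) = c j (d i K)
  inv_d : ∀ i K, inv (d i K) = d i (inv K)
  inv_c : ∀ i K, inv (c i K) = -c i (inv K)
  even_comm : ∀ K L, inv K = K → K * L = L * K
  odd_comm : ∀ K L, inv K = -K → K * L = inv L * K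
  P : T →ₐ[ℝ] T
  P_P : ∀ K, P (P K) = P K
  inv_P : ∀ K, inv (P K) = P (inv K)
  P_d_inl : ∀ i K, P (d (.inl i) K) = d (.inl i) (P K)
  d_inr_P : ∀ i K, d (.inr i) (P K) = 0
  P_c_inr : ∀ i K, P (c (.inr i) K) = c (.inr i) (P K)
  c_inl_P : ∀ i K, c (.inl i) (P K) = 0

namespace Darboux

variable {X Y T : Type*} [Ring T] [Algebra ℝ T] [Fintype X] [Fintype Y] (S : Darboux X Y T)

/-- The Schouten bracket. -/
def br : T →ₗ[ℝ] T →ₗ[ℝ] T :=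
  LinearMap.mk₂ ℝ (fun K L ↦ ∑ i, (S.inv (S.c i K) * S.d i L - S.d i K * S.c i L))
    (fun K K' L ↦ by
      simp only [map_add, add_mul, ← Finset.sum_add_distrib]
      exact Finset.sum_congr rfl fun i _ ↦ by abel)
    (fun r K L ↦ by
      simp only [map_smul, smul_mul_assoc, Finset.smul_sum, smul_sub])
    (fun K L L' ↦ by
      simp only [map_add, mul_add, ← Finset.sum_add_distrib]
      exact Finset.sum_congr rfl fun i _ ↦ by abel)
    (fun r K L ↦ by
      simp only [map_smul, mul_smul_comm, Finset.smul_sum, smul_sub])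

theorem br_apply (K L : T) :
    S.br K L = ∑ i, (S.inv (S.c i K) * S.d i L - S.d i K * S.c i L) := rfl

/-- The operator `K ↦ {inv K, a}`, linear in `K` and `a`. -/
def tauFlip : T →ₗ[ℝ] T →ₗ[ℝ] T := S.br ∘ₗ S.inv.toLinearMap

/-- Applying `inv` to `K` before bracketing absorbs the sign that depends on the degree of `K`. The
operators for different `a` then commute with a sign that involves the degrees of the arguments
only. -/
def tau (a : T) : Module.End ℝ T := S.tauFlip.flip a

theorem tau_apply (a K : T) : S.tau a K = S.br (S.inv K) a := rfl

/-- Even elements are central and odd ones commute up to `inv`. Together these two rules amount to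
graded commutativity for elements of definite parity. -/
theorem sign_comm {p q : ℤ} {a b : T} (ha : S.inv a = p.negOnePow • a)
    (hb : S.inv b = q.negOnePow • b) : a * b = (p * q).negOnePow • (b * a) := by
  rcases Int.even_or_odd p with hp | hp
  · rw [Int.negOnePow_even _ hp, one_smul] at ha
    rw [Int.negOnePow_even _ (hp.mul_right q), one_smul, S.even_comm _ _ ha]
  · rw [Int.negOnePow_odd _ hp, Units.neg_smul, one_smul] at ha
    rw [S.odd_comm _ _ ha, hb]
    rcases Int.even_or_odd q with hq | hq
    · rw [Int.negOnePow_even _ hq, Int.negOnePow_even _ (hq.mul_left p), one_smul, one_smul]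
    · rw [Int.negOnePow_odd _ hq, Int.negOnePow_odd _ (hp.mul hq)]
      simp

theorem inv_d_homog {p : ℤ} {a : T} (ha : S.inv a = p.negOnePow • a) (i : X ⊕ Y) :
    S.inv (S.d i a) = p.negOnePow • S.d i a := by
  rw [S.inv_d, ha, Units.smul_def, map_zsmul]; rfl

theorem inv_c_homog {p : ℤ} {a : T} (ha : S.inv a = p.negOnePow • a) (i : X ⊕ Y) :
    S.inv (S.c i a) = (p - 1).negOnePow • S.c i a := by
  rw [S.inv_c, ha, Units.smul_def, map_zsmul, Int.negOnePow_sub, Units.smul_def]; simp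

variable {S} in
theorem d_inr_of_P {a : T} (ha : S.P a = a) (y : Y) : S.d (.inr y) a = 0 := by
  rw [← ha, S.d_inr_P]

variable {S} in
theorem c_inl_of_P {a : T} (ha : S.P a = a) (x : X) : S.c (.inl x) a = 0 := by
  rw [← ha, S.c_inl_P]

variable {S} in
-- An element of the image of `P` depends on the base coordinates and the fibre generators only, so
-- half of the terms of the Schouten bracket drop out.
theorem tau_apply_of_P {a : T} (ha : S.P a = a) (K : T) :
    S.tau a K = -(∑ x, S.c (.inl x) K * S.d (.inl x) a)
      - ∑ y, S.inv (S.d (.inr y) K) * S.c (.inr y) a := by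
  rw [tau_apply, br_apply, Fintype.sum_sum_type]
  simp only [d_inr_of_P ha, c_inl_of_P ha, mul_zero, sub_zero, zero_sub, S.inv_c, S.inv_inv,
    S.inv_d, neg_mul, Finset.sum_neg_distrib]
  abel

variable {S} in
-- No derivative from the second bracketing that survives can hit `a`, since it is a `c (.inl _)` or
-- a `d (.inr _)`. Every derivative therefore falls on `K`, in four double sums by type of the two
-- indices.
theorem tau_tau_of_P {a b : T} (ha : S.P a = a) (hb : S.P b = b) (K : T) :
    S.tau b (S.tau a K) =
      (∑ x, ∑ x', S.c (.inl x') (S.c (.inl x) K) * (S.d (.inl x) a * S.d (.inl x') b))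
      - (∑ y, ∑ x', S.inv (S.c (.inl x') (S.d (.inr y) K)) * (S.c (.inr y) a * S.d (.inl x') b))
      + (∑ x, ∑ y', S.inv (S.c (.inl x) (S.d (.inr y') K)) *
          (S.inv (S.d (.inl x) a) * S.c (.inr y') b))
      + (∑ y, ∑ y', S.d (.inr y') (S.d (.inr y) K) * (S.inv (S.c (.inr y) a) * S.c (.inr y') b)) := by
  have h1 : ∀ x x', S.c (.inl x') (S.d (.inl x) a) = 0 := fun x x' ↦ by
    rw [← S.d_c, c_inl_of_P ha, map_zero]
  have h2 : ∀ y x', S.c (.inl x') (S.c (.inr y) a) = 0 := fun x x' ↦ by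
    rw [S.c_c, c_inl_of_P ha, map_zero, neg_zero]
  have h3 : ∀ x y', S.d (.inr y') (S.d (.inl x) a) = 0 := fun x x' ↦ by
    rw [S.d_d, d_inr_of_P ha, map_zero]
  have h4 : ∀ y y', S.d (.inr y') (S.c (.inr y) a) = 0 := fun x x' ↦ by
    rw [S.d_c, d_inr_of_P ha, map_zero]
  have h5 : ∀ i K, S.c i (S.inv K) = - S.inv (S.c i K) := fun i K ↦ by rw [S.inv_c, neg_neg]
  rw [tau_apply_of_P hb, tau_apply_of_P ha]
  simp only [map_sub, map_neg, map_sum, S.c_mul, S.d_mul, h1, h2, h3, h4, mul_zero, add_zero,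
    h5, map_mul, ← S.inv_d, S.inv_inv, sub_mul, neg_mul, Finset.sum_mul, Finset.sum_neg_distrib,
    Finset.sum_sub_distrib, mul_assoc]
  rw [Finset.sum_comm]
  rw [Finset.sum_comm (s := (Finset.univ : Finset X)) (t := (Finset.univ : Finset Y))]
  rw [Finset.sum_comm (s := (Finset.univ : Finset Y)) (t := (Finset.univ : Finset X))
    (f := fun y x ↦ S.inv (S.d (.inr y) (S.c (.inl x) K)) * _)]
  rw [Finset.sum_comm (s := (Finset.univ : Finset Y)) (t := (Finset.univ : Finset Y))]
  simp only [S.d_c]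
  abel

variable {S} in
-- This is commutativity of the abelian subalgebra, seen on the operators; it is the source of the
-- skew symmetry of the brackets. The two mixed sums are exchanged, the `c c` sum is antisymmetric
-- by `c_c`, and the `d d` sum is symmetric by `d_d`.
theorem tau_comm {p q : ℤ} {a b : T} (ha : S.P a = a) (hb : S.P b = b)
    (hpa : S.inv a = p.negOnePow • a) (hqb : S.inv b = q.negOnePow • b) :
    S.tau b * S.tau a = -((p * q).negOnePow • (S.tau a * S.tau b)) := by
  ext K
  simp only [Module.End.mul_apply, LinearMap.neg_apply, LinearMap.smul_apply]
  rw [tau_tau_of_P ha hb, tau_tau_of_P hb ha]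
  have e1 : ∀ x x', S.d (.inl x') b * S.d (.inl x) a =
      (p * q).negOnePow • (S.d (.inl x) a * S.d (.inl x') b) := fun x x' ↦ by
    rw [mul_comm]; exact S.sign_comm (S.inv_d_homog hqb _) (S.inv_d_homog hpa _)
  have e2 : ∀ x y, S.inv (S.d (.inl x) b) * S.c (.inr y) a =
      (p * q).negOnePow • (S.c (.inr y) a * S.d (.inl x) b) := fun x y ↦ by
    rw [S.inv_d_homog hqb, smul_mul_assoc, S.sign_comm (S.inv_d_homog hqb _) (S.inv_c_homog hpa _),
      smul_smul, ← Int.negOnePow_add]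
    congr 2; ring
  have e3 : ∀ x y, S.c (.inr y) b * S.d (.inl x) a =
      (p * q).negOnePow • (S.inv (S.d (.inl x) a) * S.c (.inr y) b) := fun x y ↦ by
    rw [S.inv_d_homog hpa, smul_mul_assoc, S.sign_comm (S.inv_c_homog hqb _) (S.inv_d_homog hpa _),
      smul_smul, ← Int.negOnePow_add]
    congr 1
    rw [Int.negOnePow_eq_iff]
    exact ⟨-p, by ring⟩
  have e4 : ∀ y y', S.inv (S.c (.inr y') b) * S.c (.inr y) a =
      -((p * q).negOnePow • (S.inv (S.c (.inr y) a) * S.c (.inr y') b)) := fun y y' ↦ by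
    rw [S.inv_c_homog hpa, S.inv_c_homog hqb, smul_mul_assoc, smul_mul_assoc,
      S.sign_comm (S.inv_c_homog hqb _) (S.inv_c_homog hpa _),
      smul_smul, smul_smul, ← Int.negOnePow_add, ← Int.negOnePow_add, ← Units.neg_smul]
    congr 1
    rw [← neg_one_mul, ← Int.negOnePow_one, ← Int.negOnePow_add, Int.negOnePow_eq_iff]
    exact ⟨-p, by ring⟩
  simp only [e1, e2, e3, e4, mul_smul_comm, mul_neg, Finset.sum_neg_distrib, ← Finset.smul_sum]
  simp only [smul_add, smul_sub, smul_neg, smul_smul, Int.units_mul_self, one_smul]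
  have r1 : ∑ x, ∑ x', S.c (.inl x') (S.c (.inl x) K) * (S.d (.inl x') a * S.d (.inl x) b) =
      -∑ x, ∑ x', S.c (.inl x') (S.c (.inl x) K) * (S.d (.inl x) a * S.d (.inl x') b) := by
    rw [Finset.sum_comm]
    simp only [← Finset.sum_neg_distrib]
    refine Finset.sum_congr rfl fun x _ ↦ Finset.sum_congr rfl fun x' _ ↦ ?_
    rw [S.c_c, neg_mul]
  have r4 : ∑ y, ∑ y', S.d (.inr y') (S.d (.inr y) K) *
        (S.inv (S.c (.inr y') a) * S.c (.inr y) b) =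
      ∑ y, ∑ y', S.d (.inr y') (S.d (.inr y) K) *
        (S.inv (S.c (.inr y) a) * S.c (.inr y') b) := by
    rw [Finset.sum_comm]
    refine Finset.sum_congr rfl fun x _ ↦ Finset.sum_congr rfl fun x' _ ↦ ?_
    rw [S.d_d]
  rw [r1, r4, Finset.sum_comm (s := (Finset.univ : Finset Y)) (t := (Finset.univ : Finset X)),
    Finset.sum_comm (s := (Finset.univ : Finset Y)) (t := (Finset.univ : Finset X))]
  abel

variable {S} in
/-- Leibniz rule in the argument. -/
theorem tau_mul {p q : ℤ} {a b K : T} (ha : S.P a = a) (hb : S.P b = b)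
    (hpa : S.inv a = p.negOnePow • a) (hqK : S.inv K = q.negOnePow • K) :
    S.tau (a * b) K = S.tau a K * b + (p * (q - 1)).negOnePow • (a * S.tau b K) := by
  rw [tau_apply_of_P ha, tau_apply_of_P hb, tau_apply_of_P (by rw [map_mul, ha, hb])]
  have e1 : ∀ x, a * (S.c (.inl x) K * S.d (.inl x) b) =
      (p * (q - 1)).negOnePow • (S.c (.inl x) K * (a * S.d (.inl x) b)) := fun x ↦ by
    rw [← mul_assoc, S.sign_comm hpa (S.inv_c_homog hqK _), smul_mul_assoc, mul_assoc]
  have e2 : ∀ y, a * (S.inv (S.d (.inr y) K) * S.c (.inr y) b) =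
      (p * (q - 1)).negOnePow •
        (S.inv (S.d (.inr y) K) * (S.inv a * S.c (.inr y) b)) := fun y ↦ by
    have : S.inv (S.inv (S.d (.inr y) K)) = q.negOnePow • S.inv (S.d (.inr y) K) := by
      rw [S.inv_inv, S.inv_d_homog hqK, smul_smul, Int.units_mul_self, one_smul]
    rw [← mul_assoc, S.sign_comm hpa this, smul_mul_assoc, mul_assoc, hpa, smul_mul_assoc,
      mul_smul_comm, smul_smul, ← Int.negOnePow_add]
    congr 2; ring
  simp only [mul_sub, mul_neg, Finset.mul_sum, e1, e2, ← Finset.smul_sum, smul_sub, smul_neg,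
    smul_smul, Int.units_mul_self, one_smul, S.d_mul, S.c_mul, mul_add, Finset.sum_add_distrib,
    sub_mul, neg_mul, Finset.sum_mul, mul_assoc]
  abel

section odd

variable {S} {ξ : T} (hξ : S.inv ξ = -ξ)
include hξ

/-- Bracketing with an odd element is a derivation of the product. -/
theorem br_mul_odd (K L : T) : S.br (K * L) ξ = S.br K ξ * L + K * S.br L ξ := by
  have e1 : ∀ i, S.inv L * S.d i ξ = S.d i ξ * L := fun i ↦
    (S.odd_comm _ _ (by rw [S.inv_d, hξ, map_neg])).symm
  have e2 : ∀ i, L * S.c i ξ = S.c i ξ * L := fun i ↦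
    (S.even_comm _ _ (by rw [S.inv_c, hξ, map_neg, neg_neg])).symm
  simp only [br_apply, Finset.sum_mul, Finset.mul_sum, ← Finset.sum_add_distrib]
  refine Finset.sum_congr rfl fun i _ ↦ ?_
  rw [S.c_mul, S.d_mul, map_add, map_mul, map_mul, S.inv_inv, add_mul, add_mul, mul_assoc, e1,
    mul_assoc (S.d i K), e2]
  noncomm_ring

/-- Coordinate derivations act on the bracket by a Leibniz rule. The terms containing `d i ξ` here,
and `c i ξ` in `br_c_odd`, are the corrections that must cancel in the Jacobi identity. -/
theorem br_d_odd (i : X ⊕ Y) (K : T) :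
    S.br (S.d i K) ξ = S.d i (S.br K ξ) - S.br K (S.d i ξ) := by
  simp only [br_apply, map_sum, ← Finset.sum_sub_distrib]
  refine Finset.sum_congr rfl fun j _ ↦ ?_
  simp only [map_sub, S.d_mul, ← S.inv_d, S.d_c, S.d_d i j]
  abel

theorem br_c_odd (i : X ⊕ Y) (K : T) :
    S.br (S.c i K) ξ = S.c i (S.br K ξ) - S.inv (S.br K (S.c i ξ)) := by
  simp only [br_apply, map_sum, ← Finset.sum_sub_distrib]
  refine Finset.sum_congr rfl fun j _ ↦ ?_
  simp only [map_sub, map_mul, S.c_mul, S.inv_inv, S.d_c, S.inv_d, S.inv_c, hξ, map_neg,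
    S.c_c j i, neg_neg, neg_mul, mul_neg]
  abel

theorem inv_br_odd (K : T) : S.inv (S.br K ξ) = S.br (S.inv K) ξ := by
  simp only [br_apply, map_sum]
  refine Finset.sum_congr rfl fun j _ ↦ ?_
  simp only [map_sub, map_mul, S.inv_inv, S.inv_d, S.inv_c, hξ, map_neg, mul_neg, neg_neg, neg_mul]

/-- Jacobi identity for an odd element. -/
theorem br_br_odd (K L : T) :
    S.br (S.br K L) ξ = S.br (S.br K ξ) L + S.br K (S.br L ξ) := by
  -- By the Leibniz rules these are exactly the terms in which `ξ` is differentiated twice. Each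
  -- splits into two halves; after exchanging the summation indices in one half they cancel, because
  -- second derivatives of `ξ` commute or anticommute.
  have corr : ∑ j, (-(S.br K (S.c j ξ) * S.d j L) - S.inv (S.c j K) * S.br L (S.d j ξ) +
      S.br K (S.d j ξ) * S.c j L + S.d j K * S.inv (S.br L (S.c j ξ))) = 0 := by
    have hsplit : ∀ j, (-(S.br K (S.c j ξ) * S.d j L) - S.inv (S.c j K) * S.br L (S.d j ξ) +
        S.br K (S.d j ξ) * S.c j L + S.d j K * S.inv (S.br L (S.c j ξ))) =
        (∑ i, (-(S.inv (S.c i K) * S.d i (S.c j ξ) * S.d j L) +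
          S.d i K * S.c i (S.c j ξ) * S.d j L + S.inv (S.c i K) * S.d i (S.d j ξ) * S.c j L -
          S.d i K * S.c i (S.d j ξ) * S.c j L)) +
        ∑ i, (-(S.inv (S.c j K) * (S.inv (S.c i L) * S.d i (S.d j ξ))) +
          S.inv (S.c j K) * (S.d i L * S.c i (S.d j ξ)) +
          S.d j K * (S.c i L * S.d i (S.c j ξ)) +
          S.d j K * (S.inv (S.d i L) * S.c i (S.c j ξ))) := by
      intro j
      simp only [br_apply, map_sum, Finset.sum_mul, Finset.mul_sum, ← Finset.sum_add_distrib,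
        ← Finset.sum_neg_distrib, ← Finset.sum_sub_distrib]
      refine Finset.sum_congr rfl fun i _ ↦ ?_
      simp only [map_sub, map_mul, S.inv_inv, S.inv_d, S.inv_c, hξ, map_neg, neg_neg]
      noncomm_ring
    simp only [hsplit, Finset.sum_add_distrib (s := (Finset.univ : Finset (X ⊕ Y)))
      (f := fun j ↦ ∑ i, _)]
    rw [Finset.sum_comm, ← Finset.sum_add_distrib]
    refine Finset.sum_eq_zero fun i _ ↦ ?_
    rw [← Finset.sum_add_distrib]
    refine Finset.sum_eq_zero fun j _ ↦ ?_
    have e1 : S.d i (S.c j ξ) * S.d j L = S.d j L * S.d i (S.c j ξ) :=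
      S.even_comm _ _ (by rw [S.inv_d, S.inv_c, hξ]; simp)
    have e2 : S.c i (S.c j ξ) * S.d j L = S.inv (S.d j L) * S.c i (S.c j ξ) :=
      S.odd_comm _ _ (by rw [S.inv_c, S.inv_c, hξ]; simp)
    have e3 : S.d i (S.d j ξ) * S.c j L = S.inv (S.c j L) * S.d i (S.d j ξ) :=
      S.odd_comm _ _ (by rw [S.inv_d, S.inv_d, hξ]; simp)
    have e4 : S.d j (S.c i ξ) * S.c j L = S.c j L * S.d j (S.c i ξ) :=
      S.even_comm _ _ (by rw [S.inv_d, S.inv_c, hξ]; simp)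
    simp only [mul_assoc]
    rw [← S.d_c j i, ← S.d_c i j, e1, e2, e3, e4, S.c_c j i, S.d_d j i]
    noncomm_ring
  have key : S.br (S.br K L) ξ - (S.br (S.br K ξ) L + S.br K (S.br L ξ)) =
      ∑ j, (-(S.br K (S.c j ξ) * S.d j L) - S.inv (S.c j K) * S.br L (S.d j ξ) +
      S.br K (S.d j ξ) * S.c j L + S.d j K * S.inv (S.br L (S.c j ξ))) := by
    rw [S.br_apply K L, S.br_apply (S.br K ξ) L, S.br_apply K (S.br L ξ), map_sum,
      LinearMap.sum_apply, ← Finset.sum_add_distrib, ← Finset.sum_sub_distrib]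
    refine Finset.sum_congr rfl fun j _ ↦ ?_
    rw [map_sub, LinearMap.sub_apply, br_mul_odd hξ, br_mul_odd hξ, ← inv_br_odd hξ,
      br_d_odd hξ, br_d_odd hξ, br_c_odd hξ, br_c_odd hξ]
    simp only [map_sub, S.inv_inv]
    noncomm_ring
  rw [corr] at key
  exact sub_eq_zero.1 key

end odd

variable {S} in
-- Voronov's condition on the projection: it expresses that the kernel of `P` is closed under the
-- bracket. For an `inl` index `P` commutes with `d` while `c` kills its image, and for an `inr`
-- index the roles are exchanged. So each term of the bracket survives in exactly one of the two
-- summands.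
theorem P_br (K L : T) : S.P (S.br K L) = S.P (S.br K (S.P L)) + S.P (S.br (S.P K) L) := by
  simp only [br_apply, Fintype.sum_sum_type, map_add, map_sum, map_sub, map_mul, ← S.inv_P,
    S.P_d_inl, S.P_c_inr, S.c_inl_P, S.d_inr_P, S.P_P, map_zero, mul_zero, zero_mul,
    Finset.sum_sub_distrib]
  abel

/-- Iterated brackets `{…{G, a₀}, …, aₙ₋₁}` with the sign convention of `tau`. -/
def iter (G : T) : ∀ n : ℕ, MultilinearMap ℝ (fun _ : Fin n ↦ T) T
  | 0 => MultilinearMap.constOfIsEmpty ℝ _ G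
  | n + 1 => MultilinearMap.uncurryRight (M := fun _ : Fin (n + 1) ↦ T)
      (S.tauFlip.compMultilinearMap (iter G n))

theorem iter_zero (G : T) (a : Fin 0 → T) : S.iter G 0 a = G := rfl

theorem iter_succ (G : T) (n : ℕ) (a : Fin (n + 1) → T) :
    S.iter G (n + 1) a = S.tau (a (Fin.last n)) (S.iter G n fun i ↦ a i.castSucc) := rfl

/-- In a nested bracket the inner value occupies the first slot; absorbing it changes only the
starting element. -/
theorem iter_cons (G b : T) : ∀ (n : ℕ) (a : Fin n → T),
    S.iter G (n + 1) (Fin.cons (α := fun _ ↦ T) b a) = S.iter (S.tau b G) n a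
  | 0, a => rfl
  | n + 1, a => by
    change S.tau _ (S.iter G (n + 1) _) = S.tau _ (S.iter (S.tau b G) n _)
    rw [← iter_cons G b n]
    congr 2
    funext i
    refine Fin.cases rfl (fun j ↦ ?_) i
    rfl

end Darboux

/-! ### Koszul signs of permuted products of operators. -/

section Signs

variable {V : Type*} [AddCommGroup V] [Module ℝ V]

/-- The composite `f (n-1) ∘ ⋯ ∘ f 0`. -/
def opIter : ∀ n : ℕ, (Fin n → Module.End ℝ V) → Module.End ℝ V
  | 0, _ => 1
  | n + 1, f => f (Fin.last n) * opIter n fun i ↦ f i.castSucc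

theorem opIter_swap : ∀ (n : ℕ) (d : Fin (n + 1) → ℤ) (f : Fin (n + 1) → Module.End ℝ V),
    (∀ k l, f l * f k = -((d k * d l).negOnePow • (f k * f l))) → ∀ i : Fin n,
    opIter (n + 1) (f ∘ Equiv.swap i.castSucc i.succ) =
      -((d i.castSucc * d i.succ).negOnePow • opIter (n + 1) f)
  | 0, _, _, _, i => i.elim0
  | n + 1, d, f, h, i => by
    induction i using Fin.lastCases with
    | last =>
      simp only [opIter]
      have hfun : (fun i : Fin n ↦ (f ∘ Equiv.swap (Fin.last n).castSucc (Fin.last n).succ)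
          i.castSucc.castSucc) = fun i ↦ f i.castSucc.castSucc := by
        funext i
        rw [Function.comp_apply, Equiv.swap_apply_of_ne_of_ne]
        · simp [Fin.ext_iff, i.2.ne]
        · simp [Fin.ext_iff]; omega
      rw [hfun]
      simp only [Function.comp_apply, Fin.succ_last, Equiv.swap_apply_left, Equiv.swap_apply_right,
        ← mul_assoc]
      rw [h (Fin.last (n + 1)) (Fin.last n).castSucc, neg_mul, smul_mul_assoc, mul_comm (d _)]
    | cast j =>
      have hlast : Equiv.swap j.castSucc.castSucc j.castSucc.succ (Fin.last (n + 1)) =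
          Fin.last (n + 1) := by
        apply Equiv.swap_apply_of_ne_of_ne
        · simp [Fin.ext_iff]; omega
        · simp [Fin.ext_iff]; omega
      have hfun : (fun i : Fin (n + 1) ↦ (f ∘ Equiv.swap j.castSucc.castSucc j.castSucc.succ)
          i.castSucc) = (fun i ↦ f i.castSucc) ∘ Equiv.swap j.castSucc j.succ := by
        funext i
        simp only [Function.comp_apply]
        congr 1
        rw [← Fin.castSucc_succ]
        exact ((Fin.castSucc_injective _).map_swap _ _ _).symm
      have ih := opIter_swap n (fun i ↦ d i.castSucc) (fun i ↦ f i.castSucc)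
        (fun k l ↦ h _ _) j
      rw [opIter, Function.comp_apply, hlast, hfun, ih, opIter, mul_neg, mul_smul_comm,
        Fin.castSucc_succ]
      rfl

/-- An adjacent transposition reverses one ordered pair of positions and permutes the others, so a
single factor of the product changes. It appears, or it was present and its square is one. -/
theorem koszulSign_mul_swap {n : ℕ} (d : Fin (n + 1) → ℤ) (σ : Equiv.Perm (Fin (n + 1)))
    (i : Fin n) :
    koszulSign d (σ * Equiv.swap i.castSucc i.succ) =
      koszulSign d σ * (d (σ i.castSucc) * d (σ i.succ)).negOnePow := by
  set t := Equiv.swap i.castSucc i.succ with ht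
  have hlt : ∀ p q : Fin (n + 1), p < q → (p, q) ≠ (i.castSucc, i.succ) → t p < t q := by
    intro p q hpq hne
    simp only [ne_eq, Prod.mk.injEq, Fin.ext_iff, Fin.val_castSucc, Fin.val_succ, not_and] at hne
    rw [Fin.lt_def] at hpq
    have key : ∀ p : Fin (n + 1), (t p : ℕ) =
        if (p : ℕ) = i then (i : ℕ) + 1 else if (p : ℕ) = i + 1 then (i : ℕ) else p := by
      intro p
      rw [ht, Equiv.swap_apply_def, apply_ite Fin.val, apply_ite Fin.val]
      simp only [Fin.ext_iff, Fin.val_castSucc, Fin.val_succ]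
    rw [Fin.lt_def, key, key]
    split_ifs <;> omega
  have htt : ∀ p, t (t p) = p := fun p ↦ by rw [ht, Equiv.swap_apply_self]
  let A : Finset (Fin (n + 1) × Fin (n + 1)) := {p | p.1 < p.2}
  let e : Fin (n + 1) × Fin (n + 1) := (i.castSucc, i.succ)
  have he : e ∈ A := by simp [A, e]
  let h : Equiv.Perm (Fin (n + 1)) → Fin (n + 1) × Fin (n + 1) → ℤˣ := fun σ p ↦
    if σ p.2 < σ p.1 then (d (σ p.1) * d (σ p.2)).negOnePow else 1
  have hk : ∀ σ, koszulSign d σ = h σ e * ∏ p ∈ A.erase e, h σ p := fun σ ↦ by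
    rw [Finset.mul_prod_erase _ _ he, koszulSign, ← Finset.filter_filter, Finset.prod_filter]
  have hprod : ∏ p ∈ A.erase e, h (σ * t) p = ∏ p ∈ A.erase e, h σ p := by
    refine Finset.prod_equiv (Equiv.prodCongr t t) (fun p ↦ ?_) (fun p _ ↦ rfl)
    have hmem : ∀ p : Fin (n + 1) × Fin (n + 1), p ∈ A.erase e → (t p.1, t p.2) ∈ A.erase e := by
      rintro ⟨p, q⟩ hp
      simp only [Finset.mem_erase, Finset.mem_filter, A, e, Finset.mem_univ, true_and] at hp ⊢
      refine ⟨fun hh ↦ ?_, hlt p q hp.2 hp.1⟩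
      simp only [Prod.mk.injEq] at hh
      have h1 : p = i.succ := by rw [← htt p, hh.1, ht, Equiv.swap_apply_left]
      have h2 : q = i.castSucc := by rw [← htt q, hh.2, ht, Equiv.swap_apply_right]
      rw [h1, h2, Fin.lt_def] at hp
      simp at hp
    refine ⟨hmem p, fun hp ↦ ?_⟩
    have := hmem _ hp
    simpa [htt] using this
  rw [hk, hk, hprod, mul_right_comm]
  congr 1
  have hne : σ i.castSucc ≠ σ i.succ := fun hh ↦ by simpa [Fin.ext_iff] using σ.injective hh
  simp only [h, e, Equiv.Perm.mul_apply, ht, Equiv.swap_apply_left, Equiv.swap_apply_right]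
  rcases lt_or_gt_of_ne hne with hl | hl
  · rw [if_pos hl, if_neg hl.not_gt, one_mul, mul_comm (d _)]
  · rw [if_neg hl.not_gt, if_pos hl, Int.units_mul_self]

/-- Adjacent transpositions generate the symmetric group, and for one of them both sides change by
the same sign. -/
theorem opIter_perm (n : ℕ) (d : Fin n → ℤ) (f : Fin n → Module.End ℝ V)
    (h : ∀ k l, f l * f k = -((d k * d l).negOnePow • (f k * f l))) (σ : Equiv.Perm (Fin n)) :
    opIter n (f ∘ σ) = (Equiv.Perm.sign σ * koszulSign d σ) • opIter n f := by
  cases n with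
  | zero =>
    have : σ = 1 := Subsingleton.elim _ _
    subst this
    simp [koszulSign, opIter]
  | succ n =>
    have hσ : σ ∈ Submonoid.closure
        (Set.range fun i : Fin n ↦ Equiv.swap i.castSucc i.succ) := by
      rw [Equiv.Perm.mclosure_swap_castSucc_succ]; trivial
    induction hσ using Submonoid.closure_induction_right with
    | one =>
      have : koszulSign d 1 = 1 := by
        apply Finset.prod_eq_one
        rintro ⟨p, q⟩ hp
        rw [Finset.mem_filter] at hp
        exact absurd hp.2.1 (not_lt.2 hp.2.2.le)
      simp [this]
    | mul_right σ _ t ht ih =>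
      obtain ⟨i, rfl⟩ := ht
      have h1 := opIter_swap n (d ∘ σ) (f ∘ σ) (fun k l ↦ h _ _) i
      rw [Equiv.Perm.coe_mul, ← Function.comp_assoc, h1, ih, koszulSign_mul_swap,
        Equiv.Perm.sign_mul, Equiv.Perm.sign_swap (by simp [Fin.ext_iff]), smul_smul,
        ← Units.neg_smul]
      congr 1
      simp only [Function.comp_apply, mul_neg, mul_one, neg_mul]
      congr 1
      rw [mul_comm, mul_assoc]

end Signs

end

/-! ### Nested brackets and multiplication by constant parameters. -/

section

theorem opIter_split {V : Type*} [AddCommGroup V] [Module ℝ V] {q m n : ℕ} (h : q + m = n)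
    (f : Fin n → Module.End ℝ V) :
    opIter n f = opIter m (fun i ↦ f ⟨q + i, by omega⟩) * opIter q fun i ↦ f ⟨i, by omega⟩ := by
  subst h
  induction m with
  | zero => simp [opIter]
  | succ m ih =>
    have := ih fun i ↦ f ⟨i, by omega⟩
    simp only [opIter, mul_assoc]
    change f (Fin.last (q + m)) * opIter (q + m) (fun i ↦ f i.castSucc) = _
    congr 1

namespace Darboux

variable {X Y T : Type*} [Ring T] [Algebra ℝ T] [Fintype X] [Fintype Y] (S : Darboux X Y T)

/-- The nested bracket `λ_{m+1}(λ_q(a₀, …), …)` as a multilinear map. -/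
def nested (H : T) (q m : ℕ) {n : ℕ} (h : q + m = n) : MultilinearMap ℝ (fun _ : Fin n ↦ T) T :=
  (MultilinearMap.uncurrySum (((S.P.toLinearMap.compMultilinearMap (S.iter H (m + 1))).curryLeft ∘ₗ
    S.P.toLinearMap).compMultilinearMap (S.iter H q))).domDomCongr
      (finSumFinEquiv.trans (finCongr h))

theorem nested_apply (H : T) (q m : ℕ) {n : ℕ} (h : q + m = n) (a : Fin n → T) :
    S.nested H q m h a = S.P (S.iter H (m + 1) (Fin.cons (α := fun _ ↦ T)
      (S.P (S.iter H q fun i ↦ a ⟨i, by omega⟩)) fun i ↦ a ⟨q + i, by omega⟩)) := by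
  subst h
  rfl

/-- Elements annihilated by all derivations, and fixed by `P`. -/
structure IsConst (x : T) : Prop where
  d : ∀ i, S.d i x = 0
  c : ∀ i, S.c i x = 0
  P : S.P x = x

/-- `inv` raised to the power `p`. -/
def invPow (p : ℤ) : T →ₗ[ℝ] T := if Even p then LinearMap.id else S.inv.toLinearMap

theorem invPow_even {p : ℤ} (h : Even p) (x : T) : S.invPow p x = x := by rw [invPow, if_pos h]; rfl

theorem invPow_odd {p : ℤ} (h : ¬Even p) (x : T) : S.invPow p x = S.inv x := by
  rw [invPow, if_neg h]; rfl

theorem invPow_mul (p : ℤ) (x y : T) : S.invPow p (x * y) = S.invPow p x * S.invPow p y := by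
  by_cases h : Even p
  · simp only [S.invPow_even h]
  · simp only [S.invPow_odd h, map_mul]

theorem invPow_comm (p q : ℤ) (x : T) :
    S.invPow p (S.invPow q x) = S.invPow q (S.invPow p x) := by
  by_cases h : Even p <;> by_cases h' : Even q
  all_goals first | simp only [S.invPow_even h] | simp only [S.invPow_odd h]
  all_goals first | simp only [S.invPow_even h'] | simp only [S.invPow_odd h']

theorem invPow_homog {p e : ℤ} {x : T} (hx : S.inv x = e.negOnePow • x) :
    S.invPow p x = (p * e).negOnePow • x := by
  by_cases h : Even p
  · rw [S.invPow_even h, Int.negOnePow_even _ (h.mul_right e), one_smul]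
  · rw [S.invPow_odd h, hx]
    congr 1
    rw [Int.negOnePow_eq_iff]
    obtain ⟨k, hk⟩ := Int.not_even_iff_odd.1 h
    exact ⟨-(k * e), by rw [hk]; ring⟩

variable {S}

theorem IsConst.inv {x : T} (hx : S.IsConst x) : S.IsConst (S.inv x) where
  d i := by rw [← S.inv_d, hx.d, map_zero]
  c i := by rw [← neg_eq_zero, ← S.inv_c, hx.c, map_zero]
  P := by rw [← S.inv_P, hx.P]

theorem IsConst.invPow {x : T} (hx : S.IsConst x) (p : ℤ) : S.IsConst (S.invPow p x) := by
  by_cases h : Even p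
  · rwa [S.invPow_even h]
  · rw [S.invPow_odd h]; exact hx.inv

theorem IsConst.mul {x y : T} (hx : S.IsConst x) (hy : S.IsConst y) : S.IsConst (x * y) where
  d i := by rw [S.d_mul, hx.d, hy.d, zero_mul, mul_zero, add_zero]
  c i := by rw [S.c_mul, hx.c, hy.c, zero_mul, mul_zero, add_zero]
  P := by rw [map_mul, hx.P, hy.P]

theorem isConst_one : S.IsConst 1 where
  d i := by simpa using S.d_mul i 1 1
  c i := by simpa using S.c_mul i 1 1
  P := map_one _

theorem tau_mul_const (a K : T) {x : T} (hx : S.IsConst x) :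
    S.tau (a * x) K = S.tau a K * x := by
  simp only [tau_apply, br_apply, S.d_mul, S.c_mul, hx.d, hx.c, mul_zero, add_zero, Finset.sum_mul,
    sub_mul, mul_assoc]

/-- Moving a constant past an argument of parity `p` costs the sign `(-1) ^ (p |x|)`. The operator
`invPow p` encodes it without requiring `x` to be homogeneous. -/
theorem tau_const_mul {p : ℤ} {a : T} (ha : S.inv a = p.negOnePow • a) (K : T) {x : T}
    (hx : S.IsConst x) : S.tau a (K * x) = S.tau a K * S.invPow p x := by
  simp only [tau_apply, br_apply, map_mul, S.d_mul, S.c_mul, hx.inv.d, hx.inv.c, mul_zero, add_zero,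
    Finset.sum_mul]
  refine Finset.sum_congr rfl fun i _ ↦ ?_
  rw [sub_mul, S.inv_inv, mul_assoc, mul_assoc, mul_assoc, mul_assoc]
  by_cases h : Even p
  · rw [Int.negOnePow_even _ h, one_smul] at ha
    rw [S.invPow_even h, S.even_comm (S.d i a) x (by rw [S.inv_d, ha]),
      S.odd_comm (S.c i a) x (by rw [S.inv_c, ha])]
  · rw [Int.negOnePow_odd _ (Int.not_even_iff_odd.1 h), Units.neg_smul, one_smul] at ha
    rw [S.invPow_odd h, S.odd_comm (S.d i a) _ (by rw [S.inv_d, ha, map_neg]), S.inv_inv,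
      S.even_comm (S.c i a) _ (by rw [S.inv_c, ha, map_neg, neg_neg])]

variable (S) in
/-- Right multiplication by a parameter, twisted by the parity of an argument of degree `p`. -/
def paramMul (p : ℤ) (η : T) : Module.End ℝ T := LinearMap.mulRight ℝ η ∘ₗ S.invPow p

theorem paramMul_apply (p : ℤ) (η x : T) : S.paramMul p η x = S.invPow p x * η := rfl

/-- A parameter paired with an argument of degree `p` has parity `p - 1`. With the twist by
`invPow`, parameters obey the same commutation rule as the operators `tau`. This is why permuting
parameters produces precisely the sign of the alternation map. -/
theorem paramMul_comm {p q : ℤ} {η θ : T} (hη : S.inv η = (p - 1).negOnePow • η)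
    (hθ : S.inv θ = (q - 1).negOnePow • θ) :
    S.paramMul q θ * S.paramMul p η =
      -((p * q).negOnePow • (S.paramMul p η * S.paramMul q θ)) := by
  ext x
  simp only [Module.End.mul_apply, LinearMap.neg_apply, LinearMap.smul_apply, paramMul_apply,
    invPow_mul]
  rw [S.invPow_comm q p, S.invPow_homog hη, S.invPow_homog hθ]
  simp only [mul_smul_comm, smul_mul_assoc, mul_assoc]
  rw [S.sign_comm hθ hη]
  simp only [mul_smul_comm, smul_smul, ← Int.negOnePow_add, ← Units.neg_smul]
  congr 1
  rw [← neg_one_mul, ← Int.negOnePow_one, ← Int.negOnePow_add, Int.negOnePow_eq_iff]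
  exact ⟨p - p * q - 1, by ring⟩

section params

variable {n : ℕ} {d : Fin n → ℤ} {η : Fin n → T}

theorem isConst_opIter (hη : ∀ k, S.IsConst (η k)) :
    ∀ (m : ℕ) (r : Fin m → Fin n) {x : T}, S.IsConst x →
      S.IsConst (opIter m (fun i ↦ S.paramMul (d (r i)) (η (r i))) x)
  | 0, _, _, hx => hx
  | m + 1, r, x, hx => ((isConst_opIter hη m (fun i ↦ r i.castSucc) hx).invPow _).mul (hη _)

/-- A parameter of definite parity commutes with everything up to `inv` and signs, so any one that
occurs can be brought to the left end. -/
theorem exists_eq_mul_opIter (hη : ∀ k, S.inv (η k) = (d k - 1).negOnePow • η k) (k : Fin n) :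
    ∀ (m : ℕ) (r : Fin m → Fin n) (x : T), k ∈ Set.range r →
      ∃ y, opIter m (fun i ↦ S.paramMul (d (r i)) (η (r i))) x = η k * y
  | 0, _, _, hk => by obtain ⟨i, _⟩ := hk; exact i.elim0
  | m + 1, r, x, ⟨i, hi⟩ => by
    induction i using Fin.lastCases with
    | last =>
      refine ⟨S.invPow (d k - 1) (S.invPow (d k)
        (opIter m (fun i ↦ S.paramMul (d (r i.castSucc)) (η (r i.castSucc))) x)), ?_⟩
      change S.invPow (d (r _)) _ * η (r _) = _
      rw [hi]
      by_cases h : Even (d k - 1)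
      · rw [S.invPow_even h, S.even_comm (η k)]
        rw [hη, Int.negOnePow_even _ h, one_smul]
      · rw [S.invPow_odd h, S.odd_comm (η k), S.inv_inv]
        rw [hη, Int.negOnePow_odd _ (Int.not_even_iff_odd.1 h), Units.neg_smul, one_smul]
    | cast i =>
      obtain ⟨y, hy⟩ := exists_eq_mul_opIter hη k m (fun i ↦ r i.castSucc) x ⟨i, hi⟩
      refine ⟨(d (r (Fin.last m)) * (d k - 1)).negOnePow •
        (S.invPow (d (r (Fin.last m))) y * η (r (Fin.last m))), ?_⟩
      change S.invPow (d (r _)) (opIter m _ x) * η (r _) = _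
      rw [hy, invPow_mul, S.invPow_homog (hη k), smul_mul_assoc, smul_mul_assoc, mul_smul_comm,
        mul_assoc]

/-- A repeated parameter can be brought next to its copy, and its square is zero. -/
theorem opIter_eq_zero (hη : ∀ k, S.inv (η k) = (d k - 1).negOnePow • η k)
    (hsq : ∀ k, η k * η k = 0) :
    ∀ (m : ℕ) (r : Fin m → Fin n) (x : T), ¬Function.Injective r →
      opIter m (fun i ↦ S.paramMul (d (r i)) (η (r i))) x = 0
  | 0, r, _, hr => absurd (Function.injective_of_subsingleton r) hr
  | m + 1, r, x, hr => by
    change S.invPow (d (r _)) (opIter m (fun i ↦ S.paramMul (d (r i.castSucc)) (η (r i.castSucc))) x)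
      * η (r _) = 0
    by_cases h : Function.Injective fun i : Fin m ↦ r i.castSucc
    · have hk : r (Fin.last m) ∈ Set.range fun i : Fin m ↦ r i.castSucc := by
        by_contra hk
        apply hr
        intro i i'
        induction i using Fin.lastCases with
        | last =>
          induction i' using Fin.lastCases with
          | last => exact fun _ ↦ rfl
          | cast i' => exact fun hh ↦ absurd ⟨i', hh.symm⟩ hk
        | cast i =>
          induction i' using Fin.lastCases with
          | last => exact fun hh ↦ absurd ⟨i, hh⟩ hk
          | cast i' => exact fun hh ↦ congrArg _ (h hh)
      obtain ⟨y, hy⟩ := exists_eq_mul_opIter hη _ m _ x hk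
      rw [hy, invPow_mul, S.invPow_homog (hη _), smul_mul_assoc, smul_mul_assoc, mul_assoc]
      have hcomm : ∀ z, η (r (Fin.last m)) * (z * η (r (Fin.last m))) = 0 := by
        intro z
        by_cases h : Even (d (r (Fin.last m)) - 1)
        · rw [← S.even_comm (η _), ← mul_assoc, hsq, zero_mul]
          rw [hη, Int.negOnePow_even _ h, one_smul]
        · rw [← mul_assoc, S.odd_comm (η _), mul_assoc, hsq, mul_zero]
          rw [hη, Int.negOnePow_odd _ (Int.not_even_iff_odd.1 h), Units.neg_smul, one_smul]
      rw [hcomm, smul_zero]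
    · rw [opIter_eq_zero hη hsq m _ x h, map_zero, zero_mul]

end params

end Darboux

end

/-! ### Polarization and the quadratic identity behind the Jacobi relations. -/

section

namespace Darboux

variable {X Y T T₀ : Type*} [Ring T] [Algebra ℝ T] [Ring T₀] [Algebra ℝ T₀]
  [Fintype X] [Fintype Y]

/-- Algebra homomorphisms compatible with all operations. -/
structure Hom (S₀ : Darboux X Y T₀) (S : Darboux X Y T) where
  toHom : T₀ →ₐ[ℝ] T
  inv : ∀ x, S.inv (toHom x) = toHom (S₀.inv x)
  d : ∀ i x, S.d i (toHom x) = toHom (S₀.d i x)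
  c : ∀ i x, S.c i (toHom x) = toHom (S₀.c i x)
  P : ∀ x, S.P (toHom x) = toHom (S₀.P x)

variable {S₀ : Darboux X Y T₀} {S : Darboux X Y T} (j : Hom S₀ S)

theorem Hom.br (K L : T₀) : S.br (j.toHom K) (j.toHom L) = j.toHom (S₀.br K L) := by
  simp only [br_apply, j.inv, j.d, j.c, ← map_mul, ← map_sub, ← map_sum]

theorem Hom.tau (a K : T₀) : S.tau (j.toHom a) (j.toHom K) = j.toHom (S₀.tau a K) := by
  rw [tau_apply, j.inv, j.br, tau_apply]

/-- Auxiliary data of parameters that make the arguments odd. -/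
structure Params {n : ℕ} (j : Hom S₀ S) (d : Fin n → ℤ) (η : Fin n → T) : Prop where
  const : ∀ k, S.IsConst (η k)
  inv : ∀ k, S.inv (η k) = (d k - 1).negOnePow • η k
  sq : ∀ k, η k * η k = 0
  inj : ∀ x, j.toHom x * opIter n (fun k ↦ S.paramMul (d k) (η k)) 1 = 0 → x = 0

variable {j} {n : ℕ} {d : Fin n → ℤ} {η : Fin n → T}

/-- Constants pass out of each `tau`, from the argument and from the operand, and collect on the
right as a product of the operators `paramMul`. -/
theorem iter_params (hη : Params j d η) (G : T₀) :
    ∀ (m : ℕ) (r : Fin m → Fin n) (a : Fin m → T₀) (_ : ∀ i, S₀.inv (a i) = (d (r i)).negOnePow • a i)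
      {x : T} (_ : S.IsConst x),
      S.iter (j.toHom G * x) m (fun i ↦ j.toHom (a i) * η (r i)) =
        j.toHom (S₀.iter G m a) * opIter m (fun i ↦ S.paramMul (d (r i)) (η (r i))) x
  | 0, _, _, _, _, _ => rfl
  | m + 1, r, a, ha, x, hx => by
    rw [iter_succ, iter_params hη G m (fun i ↦ r i.castSucc) (fun i ↦ a i.castSucc)
      (fun i ↦ ha _) hx, tau_mul_const _ _ (hη.const _), tau_const_mul (p := d (r (Fin.last m))) _ _
      (isConst_opIter hη.const m _ hx), j.tau, mul_assoc, iter_succ]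
    · rfl
    · rw [j.inv, ha, Units.smul_def, Units.smul_def, map_zsmul]

theorem P_iter_params (hη : Params j d η) (G : T₀) {a : Fin n → T₀}
    (ha : ∀ k, S₀.inv (a k) = (d k).negOnePow • a k) (r : Fin n → Fin n) :
    S.P (S.iter (j.toHom G) n (fun i ↦ j.toHom (a (r i)) * η (r i))) =
      j.toHom (S₀.P (S₀.iter G n (a ∘ r))) *
        opIter n (fun i ↦ S.paramMul (d (r i)) (η (r i))) 1 := by
  have := iter_params hη G n r (fun i ↦ a (r i)) (fun i ↦ ha _) isConst_one
  rw [mul_one] at this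
  rw [this, map_mul, (isConst_opIter hη.const n r isConst_one).P, j.P]
  rfl

theorem nested_params (hη : Params j d η) (H : T₀) (q m : ℕ) (h : q + m = n) {a : Fin n → T₀}
    (ha : ∀ k, S₀.inv (a k) = (d k).negOnePow • a k) (r : Fin n → Fin n) :
    S.nested (j.toHom H) q m h (fun i ↦ j.toHom (a (r i)) * η (r i)) =
      j.toHom (S₀.nested H q m h (a ∘ r)) *
        opIter n (fun i ↦ S.paramMul (d (r i)) (η (r i))) 1 := by
  rw [nested_apply, nested_apply, iter_cons, iter_cons]
  have h1 := iter_params hη H q (fun i ↦ r ⟨i, by omega⟩) (fun i ↦ a (r ⟨i, by omega⟩))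
    (fun i ↦ ha _) isConst_one
  have hc : S.IsConst (opIter q
      (fun i ↦ S.paramMul (d (r ⟨i, by omega⟩)) (η (r ⟨i, by omega⟩))) 1) :=
    isConst_opIter hη.const q (fun i ↦ r ⟨i, by omega⟩) isConst_one
  rw [mul_one] at h1
  rw [h1, map_mul, hc.P, tau_mul_const _ _ hc, j.P, j.tau,
    iter_params hη _ m (fun i ↦ r ⟨q + i, by omega⟩) (fun i ↦ a (r ⟨q + i, by omega⟩))
    (fun i ↦ ha _) hc, map_mul, (isConst_opIter hη.const m _ hc).P, j.P, opIter_split h]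
  rfl

/-- Expanding by multilinearity gives one term for each map `Fin n → Fin n`. Non-injective maps
repeat a parameter and contribute zero. For a permutation, restoring the order of the parameters
yields its signature times the Koszul sign. -/
theorem polarize (hη : Params j d η) {N : MultilinearMap ℝ (fun _ : Fin n ↦ T) T} {a : Fin n → T₀}
    {N₀ : (Fin n → T₀) → T₀}
    (h : ∀ r : Fin n → Fin n, N (fun i ↦ j.toHom (a (r i)) * η (r i)) = j.toHom (N₀ (a ∘ r)) *
        opIter n (fun i ↦ S.paramMul (d (r i)) (η (r i))) 1) :
    N (fun _ ↦ ∑ k, j.toHom (a k) * η k) =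
      j.toHom (∑ σ : Equiv.Perm (Fin n), (Equiv.Perm.sign σ * koszulSign d σ) • N₀ (a ∘ σ)) *
        opIter n (fun k ↦ S.paramMul (d k) (η k)) 1 := by
  rw [MultilinearMap.map_sum N (fun _ k ↦ j.toHom (a k) * η k), map_sum, Finset.sum_mul]
  symm
  refine Finset.sum_of_injOn (fun σ : Equiv.Perm (Fin n) ↦ (σ : Fin n → Fin n))
    (fun σ _ σ' _ hh ↦ DFunLike.coe_injective hh) (fun _ _ ↦ Finset.mem_coe.2 (Finset.mem_univ _))
    (fun r _ hr ↦ ?_) (fun σ _ ↦ ?_)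
  · rw [h, opIter_eq_zero hη.inv hη.sq, mul_zero]
    intro hinj
    exact hr ⟨Equiv.ofBijective r (Finite.injective_iff_bijective.1 hinj),
      Finset.mem_coe.2 (Finset.mem_univ _), rfl⟩
  · rw [h]
    have := opIter_perm n d (fun k ↦ S.paramMul (d k) (η k))
      (fun k l ↦ paramMul_comm (hη.inv k) (hη.inv l)) σ
    change _ = _ * opIter n ((fun k ↦ S.paramMul (d k) (η k)) ∘ σ) 1
    rw [this, Units.smul_def, Units.smul_def, map_zsmul]
    simp only [LinearMap.smul_apply, smul_mul_assoc, mul_smul_comm]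

section odd

variable {ξ : T} (hξ : S.inv ξ = -ξ)
include hξ

/-- The Schouten bracket is odd, so bracketing with an odd `ξ` preserves parity. From an even start
the twist by `inv` in `tau` is invisible, while from an odd start it gives a sign at each step, as
`iter_odd_odd` records. -/
theorem iter_odd_even {G : T} (hG : S.inv G = G) :
    ∀ m, S.iter G m (fun _ ↦ ξ) = (fun K ↦ S.br K ξ)^[m] G ∧ S.inv (S.iter G m fun _ ↦ ξ) =
      S.iter G m fun _ ↦ ξ
  | 0 => ⟨rfl, hG⟩
  | m + 1 => by
    obtain ⟨h1, h2⟩ := iter_odd_even hG m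
    refine ⟨?_, ?_⟩
    · rw [iter_succ, tau_apply, h2, h1, Function.iterate_succ_apply']
    · rw [iter_succ, tau_apply, h2, inv_br_odd hξ, h2]

theorem iter_odd_odd {G : T} (hG : S.inv G = -G) :
    ∀ m, S.iter G m (fun _ ↦ ξ) = (-1 : ℝ) ^ m • (fun K ↦ S.br K ξ)^[m] G ∧
      S.inv (S.iter G m fun _ ↦ ξ) = -S.iter G m fun _ ↦ ξ
  | 0 => ⟨by simp [iter_zero], hG⟩
  | m + 1 => by
    obtain ⟨h1, h2⟩ := iter_odd_odd hG m
    refine ⟨?_, ?_⟩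
    · rw [iter_succ, tau_apply, h2, h1, Function.iterate_succ_apply']
      simp [pow_succ]
    · rw [iter_succ, tau_apply, h2, inv_br_odd hξ]
      simp [h2]

/-- The binomial formula for powers of a derivation, here of bracketing with `ξ`, which is a
derivation of the Schouten bracket by `br_br_odd`. -/
theorem iterate_br_br (K L : T) : ∀ n : ℕ, (fun K ↦ S.br K ξ)^[n] (S.br K L) =
    ∑ p ∈ Finset.HasAntidiagonal.antidiagonal n, (n.choose p.1 : ℝ) •
      S.br ((fun K ↦ S.br K ξ)^[p.1] K) ((fun K ↦ S.br K ξ)^[p.2] L)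
  | 0 => by simp
  | n + 1 => by
    have := Finset.sum_antidiagonal_choose_succ_nsmul (fun a b ↦
      S.br ((fun K ↦ S.br K ξ)^[a] K) ((fun K ↦ S.br K ξ)^[b] L)) n
    simp only [Nat.cast_smul_eq_nsmul ℝ] at this ⊢
    rw [this, Function.iterate_succ_apply', iterate_br_br K L n, ← Finset.sum_add_distrib, map_sum,
      LinearMap.sum_apply]
    refine Finset.sum_congr rfl fun p hp ↦ ?_
    rw [Function.iterate_succ_apply', Function.iterate_succ_apply', Nat.cast_smul_eq_nsmul,
      ← Nat.choose_symm_of_eq_add (Finset.HasAntidiagonal.mem_antidiagonal.1 hp).symm, map_nsmul, LinearMap.smul_apply, br_br_odd hξ, smul_add, add_comm]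

end odd

theorem br_comm_even {K L : T} (hK : S.inv K = K) (hL : S.inv L = L) : S.br K L = S.br L K := by
  simp only [br_apply, S.inv_c, hK, hL, neg_mul]
  refine Finset.sum_congr rfl fun i _ ↦ ?_
  rw [S.even_comm (S.d i K) _ (by rw [S.inv_d, hK]), S.even_comm (S.d i L) _ (by rw [S.inv_d, hL])]
  abel

theorem inv_br_even {K L : T} (hK : S.inv K = K) (hL : S.inv L = L) :
    S.inv (S.br K L) = -S.br K L := by
  simp only [br_apply, map_sum, map_sub, map_mul, S.inv_c, S.inv_d, hK, hL, map_neg, neg_neg,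
    ← Finset.sum_neg_distrib]
  refine Finset.sum_congr rfl fun i _ ↦ ?_
  noncomm_ring

/-- The image of `P` is abelian: in every term one of the two factors is a derivation that kills it.
-/
theorem br_of_P {a b : T} (ha : S.P a = a) (hb : S.P b = b) : S.br a b = 0 := by
  simp [br_apply, Fintype.sum_sum_type, d_inr_of_P ha, d_inr_of_P hb, c_inl_of_P ha, c_inl_of_P hb]

/-- Quadratic identity for the iterated brackets with one odd argument. -/
theorem sum_nested_odd {ξ H : T} (hξ : S.inv ξ = -ξ) (hP : S.P ξ = ξ) (hH : S.inv H = H) (n : ℕ) :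
    ∑ q : Fin (n + 1), ((-1 : ℝ) ^ (n - q : ℕ) /
        ((Nat.factorial q : ℝ) * (Nat.factorial (n - q) : ℝ))) •
        S.nested H q (n - q) (n := n) (by omega) (fun _ ↦ ξ) =
      ((-1 : ℝ) ^ n / (2 * (Nat.factorial n : ℝ))) • S.P (S.iter (S.br H H) n fun _ ↦ ξ) := by
  set D : T → T := fun K ↦ S.br K ξ with hD
  have hDn : ∀ m, S.inv (D^[m] H) = D^[m] H := fun m ↦ by
    rw [← (iter_odd_even hξ hH m).1, (iter_odd_even hξ hH m).2]
  -- Since `{b, ξ} = 0` inside the abelian subalgebra, `D` commutes with bracketing by `b`.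
  have hbr : ∀ b, S.P b = b → ∀ m, D^[m] (S.br H b) = S.br (D^[m] H) b := by
    intro b hb m
    induction m with
    | zero => rfl
    | succ m ih =>
      rw [Function.iterate_succ_apply', ih, Function.iterate_succ_apply']
      simp only [hD]
      rw [br_br_odd hξ, br_of_P hb hP, map_zero, add_zero]
  -- The outer iteration starts from the odd element `{H, P D^q H}`, whence the sign `(-1) ^ m`.
  have hn : ∀ q m (h : q + m = n), S.nested H q m h (fun _ ↦ ξ) =
      (-1 : ℝ) ^ m • S.P (S.br (D^[m] H) (S.P (D^[q] H))) := by
    intro q m h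
    rw [nested_apply, iter_cons, (iter_odd_even hξ hH q).1, tau_apply, hH,
      (iter_odd_odd hξ (inv_br_even hH (by rw [S.inv_P, hDn])) m).1, map_smul,
      hbr _ (S.P_P _)]
  -- `P_br` splits each binomial term in two. Reversing the antidiagonal and using that even
  -- elements have a symmetric bracket identifies the two sums, which gives the factor 2.
  have hsum : S.P (D^[n] (S.br H H)) = (2 : ℝ) • ∑ p ∈ Finset.HasAntidiagonal.antidiagonal n, (n.choose p.1 : ℝ) •
      S.P (S.br (D^[p.2] H) (S.P (D^[p.1] H))) := by
    rw [iterate_br_br hξ, map_sum, two_smul]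
    nth_rewrite 2 [← Finset.Nat.sum_antidiagonal_swap]
    rw [← Finset.sum_add_distrib]
    refine Finset.sum_congr rfl fun p hp ↦ ?_
    rw [map_smul, P_br, smul_add, Prod.fst_swap, Prod.snd_swap,
      ← Nat.choose_symm_of_eq_add (Finset.HasAntidiagonal.mem_antidiagonal.1 hp).symm,
      br_comm_even (K := S.P _) (by rw [S.inv_P, hDn]) (hDn _)]
  rw [(iter_odd_odd hξ (inv_br_even hH hH) n).1, map_smul, hsum, smul_smul, smul_smul,
    Finset.Nat.sum_antidiagonal_eq_sum_range_succ_mk, ← Fin.sum_univ_eq_sum_range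
      (fun q ↦ (n.choose q : ℝ) • S.P (S.br (D^[n - q] H) (S.P (D^[q] H)))), Finset.smul_sum]
  refine Finset.sum_congr rfl fun q _ ↦ ?_
  rw [hn, smul_smul, smul_smul]
  congr 1
  have hq : (q : ℕ) ≤ n := by omega
  -- All signs occur squared; what remains is `n.choose q / n! = 1 / (q! (n - q)!)`.
  rw [Nat.cast_choose ℝ hq, div_mul_eq_mul_div, ← mul_pow, div_mul_eq_mul_div, ← mul_pow]
  have h1 : (Nat.factorial n : ℝ) ≠ 0 := by positivity
  field_simp
  norm_num

/-- The generalized Jacobi identities, up to the defect coming from `{H, H}`. -/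
theorem sum_perm_nested (hη : Params j d η) {H : T₀} (hH : S₀.inv H = H) {a : Fin n → T₀}
    (ha : ∀ k, S₀.inv (a k) = (d k).negOnePow • a k) (hP : ∀ k, S₀.P (a k) = a k) :
    ∑ σ : Equiv.Perm (Fin n), (Equiv.Perm.sign σ * koszulSign d σ) •
      ∑ q : Fin (n + 1), ((-1 : ℝ) ^ (n - q : ℕ) /
        ((Nat.factorial q : ℝ) * (Nat.factorial (n - q) : ℝ))) •
        S₀.nested H q (n - q) (n := n) (by omega) (a ∘ σ) =
    ∑ σ : Equiv.Perm (Fin n), (Equiv.Perm.sign σ * koszulSign d σ) •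
      ((-1 : ℝ) ^ n / (2 * (Nat.factorial n : ℝ))) • S₀.P (S₀.iter (S₀.br H H) n (a ∘ σ)) := by
  -- The factors `a k` and `η k` have parities `d k` and `d k - 1`, so each product is odd whatever
  -- the degree of `a k`.
  have hξ : S.inv (∑ k, j.toHom (a k) * η k) = -∑ k, j.toHom (a k) * η k := by
    rw [map_sum, ← Finset.sum_neg_distrib]
    refine Finset.sum_congr rfl fun k _ ↦ ?_
    rw [map_mul, j.inv, ha, hη.inv, Units.smul_def, map_zsmul, ← Units.smul_def, smul_mul_smul_comm,
      ← Int.negOnePow_add, Int.negOnePow_odd, Units.neg_smul, one_smul]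
    exact ⟨d k - 1, by ring⟩
  have hPξ : S.P (∑ k, j.toHom (a k) * η k) = ∑ k, j.toHom (a k) * η k := by
    rw [map_sum]
    refine Finset.sum_congr rfl fun k _ ↦ ?_
    rw [map_mul, j.P, hP, (hη.const k).P]
  have key := sum_nested_odd hξ hPξ (H := j.toHom H) (by rw [j.inv, hH]) n
  have h2 := polarize hη (N := S.P.toLinearMap.compMultilinearMap
    (S.iter (j.toHom (S₀.br H H)) n)) (N₀ := fun b ↦ S₀.P (S₀.iter (S₀.br H H) n b))
    (fun r ↦ P_iter_params hη (S₀.br H H) ha r)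
  simp only [LinearMap.compMultilinearMap_apply, AlgHom.toLinearMap_apply] at h2
  rw [j.br, h2] at key
  have h3 : ∀ q : Fin (n + 1), _ := fun q ↦ polarize hη (N := S.nested (j.toHom H) q (n - q)
    (n := n) (by omega)) (N₀ := S₀.nested H q (n - q) (by omega))
    (fun r ↦ nested_params hη H q (n - q) (by omega) ha r)
  simp only [h3] at key
  simp only [← smul_mul_assoc, ← Finset.sum_mul, ← map_smul, ← map_sum] at key
  rw [← sub_eq_zero, ← sub_mul, ← map_sub] at key
  -- Both sides are now multiples of the product of all parameters, and the coefficient of that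
  -- product is unique.
  have := sub_eq_zero.1 (hη.inj _ key)
  simp only [Finset.smul_sum] at this ⊢
  have hsc : ∀ (u : ℤˣ) (r : ℝ) (x : T₀), u • r • x = r • u • x := fun u r x ↦ by
    rw [Units.smul_def, Units.smul_def, smul_comm]
  simp only [hsc]
  rw [Finset.sum_comm, this]

end Darboux

end

/-! ### Contraction, parity and degree on an exterior algebra. -/

section

section ExteriorContraction

variable {W W' : Type*} [AddCommGroup W] [Module ℝ W] [AddCommGroup W'] [Module ℝ W']

/-- Contraction with a covector. -/
def extContract (u : Module.Dual ℝ W) : ExteriorAlgebra ℝ W →ₗ[ℝ] ExteriorAlgebra ℝ W :=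
  CliffordAlgebra.contractLeft u

/-- The parity involution. -/
def extInv : ExteriorAlgebra ℝ W →ₐ[ℝ] ExteriorAlgebra ℝ W := CliffordAlgebra.involute

theorem extInv_ι (v : W) : extInv (ExteriorAlgebra.ι ℝ v) = -ExteriorAlgebra.ι ℝ v :=
  CliffordAlgebra.involute_ι v

theorem extInv_extInv (x : ExteriorAlgebra ℝ W) : extInv (extInv x) = x :=
  CliffordAlgebra.involute_involute x

theorem extContract_ι (u : Module.Dual ℝ W) (v : W) :
    extContract u (ExteriorAlgebra.ι ℝ v) = algebraMap ℝ _ (u v) :=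
  CliffordAlgebra.contractLeft_ι _ u v

theorem extContract_algebraMap (u : Module.Dual ℝ W) (r : ℝ) :
    extContract u (algebraMap ℝ _ r) = 0 :=
  CliffordAlgebra.contractLeft_algebraMap _ u r

theorem extContract_ι_mul (u : Module.Dual ℝ W) (v : W) (x : ExteriorAlgebra ℝ W) :
    extContract u (ExteriorAlgebra.ι ℝ v * x) =
      u v • x - ExteriorAlgebra.ι ℝ v * extContract u x :=
  CliffordAlgebra.contractLeft_ι_mul u v x

theorem ext_induction {p : ExteriorAlgebra ℝ W → Prop} (h0 : ∀ r, p (algebraMap ℝ _ r))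
    (ha : ∀ x y, p x → p y → p (x + y)) (hm : ∀ v x, p x → p (ExteriorAlgebra.ι ℝ v * x))
    (x : ExteriorAlgebra ℝ W) : p x :=
  CliffordAlgebra.left_induction (P := p) 0 h0 ha (fun x v hx ↦ hm v x hx) x

theorem extContract_mul (u : Module.Dual ℝ W) (x y : ExteriorAlgebra ℝ W) :
    extContract u (x * y) = extContract u x * y + extInv x * extContract u y := by
  induction x using ext_induction with
  | h0 r =>
    rw [extContract_algebraMap, AlgHom.commutes, zero_mul, zero_add, ← Algebra.smul_def,
      ← Algebra.smul_def, map_smul]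
  | ha x x' hx hx' => simp only [add_mul, map_add, hx, hx']; abel
  | hm v x hx =>
    rw [mul_assoc, extContract_ι_mul, hx, extContract_ι_mul, map_mul, extInv_ι, sub_mul, mul_add,
      smul_mul_assoc]
    noncomm_ring

theorem extContract_comm (u u' : Module.Dual ℝ W) (x : ExteriorAlgebra ℝ W) :
    extContract u (extContract u' x) = -extContract u' (extContract u x) :=
  CliffordAlgebra.contractLeft_comm u u' x

theorem extInv_extContract (u : Module.Dual ℝ W) (x : ExteriorAlgebra ℝ W) :
    extInv (extContract u x) = -extContract u (extInv x) := by
  induction x using ext_induction with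
  | h0 r => simp [extContract_algebraMap]
  | ha x x' hx hx' => simp only [map_add, hx, hx', neg_add]
  | hm v x hx =>
    rw [extContract_ι_mul, map_mul, extInv_ι, map_sub, map_mul, extInv_ι, hx, neg_mul, neg_mul, map_neg,
      extContract_ι_mul, map_smul]
    noncomm_ring

theorem extContract_map (f : W →ₗ[ℝ] W') (u : Module.Dual ℝ W') (x : ExteriorAlgebra ℝ W) :
    extContract u (ExteriorAlgebra.map f x) = ExteriorAlgebra.map f (extContract (u ∘ₗ f) x) := by
  induction x using ext_induction with
  | h0 r => simp [extContract_algebraMap]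
  | ha x x' hx hx' => simp only [map_add, hx, hx']
  | hm v x hx =>
    rw [map_mul, ExteriorAlgebra.map_apply_ι, extContract_ι_mul, hx, extContract_ι_mul, map_sub,
      map_smul, map_mul, ExteriorAlgebra.map_apply_ι]
    rfl

theorem extInv_map (f : W →ₗ[ℝ] W') (x : ExteriorAlgebra ℝ W) :
    extInv (ExteriorAlgebra.map f x) = ExteriorAlgebra.map f (extInv x) := by
  induction x using ext_induction with
  | h0 r => simp
  | ha x x' hx hx' => simp only [map_add, hx, hx']
  | hm v x hx => simp [extInv_ι, hx]

theorem mul_ι_eq (x : ExteriorAlgebra ℝ W) (v : W) :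
    x * ExteriorAlgebra.ι ℝ v = ExteriorAlgebra.ι ℝ v * extInv x := by
  induction x using ext_induction with
  | h0 r => simp [Algebra.commutes]
  | ha x x' hx hx' => simp only [add_mul, map_add, mul_add, hx, hx']
  | hm w x hx =>
    have h : ExteriorAlgebra.ι ℝ w * ExteriorAlgebra.ι ℝ v =
        -(ExteriorAlgebra.ι ℝ v * ExteriorAlgebra.ι ℝ w) :=
      eq_neg_of_add_eq_zero_left (ExteriorAlgebra.ι_add_mul_swap w v)
    rw [mul_assoc, hx, ← mul_assoc, h, map_mul, extInv_ι]
    noncomm_ring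

theorem ext_even_comm {x : ExteriorAlgebra ℝ W} (hx : extInv x = x) (y : ExteriorAlgebra ℝ W) :
    x * y = y * x := by
  induction y using ext_induction with
  | h0 r => exact (Algebra.commutes r x).symm
  | ha y y' h h' => rw [mul_add, add_mul, h, h']
  | hm v y h => rw [← mul_assoc, mul_ι_eq, hx, mul_assoc, h, mul_assoc]

theorem ext_odd_comm {x : ExteriorAlgebra ℝ W} (hx : extInv x = -x) (y : ExteriorAlgebra ℝ W) :
    x * y = extInv y * x := by
  induction y using ext_induction with
  | h0 r => rw [AlgHom.commutes]; exact (Algebra.commutes r x).symm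
  | ha y y' h h' => rw [mul_add, map_add, add_mul, h, h']
  | hm v y h => rw [← mul_assoc, mul_ι_eq, hx, map_mul, extInv_ι, mul_neg, neg_mul, mul_assoc, h]; noncomm_ring

theorem map_map_apply {W'' : Type*} [AddCommGroup W''] [Module ℝ W''] (g : W' →ₗ[ℝ] W'')
    (f : W →ₗ[ℝ] W') (x : ExteriorAlgebra ℝ W) :
    ExteriorAlgebra.map g (ExteriorAlgebra.map f x) = ExteriorAlgebra.map (g ∘ₗ f) x := by
  rw [← AlgHom.comp_apply, ExteriorAlgebra.map_comp_map]

/-- The homogeneous part of integral degree. -/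
def extDeg (W : Type*) [AddCommGroup W] [Module ℝ W] : ℤ → Submodule ℝ (ExteriorAlgebra ℝ W)
  | (k : ℕ) => ⋀[ℝ]^k W
  | Int.negSucc _ => ⊥

theorem extDeg_of_neg {k : ℤ} (hk : k < 0) : extDeg W k = ⊥ := by
  cases k with
  | ofNat k => exact absurd hk (by simp)
  | negSucc k => rfl

theorem extDeg_mul_mem {i j : ℤ} {x y : ExteriorAlgebra ℝ W} (hx : x ∈ extDeg W i)
    (hy : y ∈ extDeg W j) : x * y ∈ extDeg W (i + j) := by
  rcases i with i | i
  · rcases j with j | j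
    · exact SetLike.GradedMul.mul_mem (A := fun i : ℕ ↦ ⋀[ℝ]^i W) hx hy
    · rw [show y = 0 from hy, mul_zero]; exact zero_mem _
  · rw [show x = 0 from hx, zero_mul]; exact zero_mem _

theorem extDeg_map_mem (f : W →ₗ[ℝ] W') {i : ℤ} {x : ExteriorAlgebra ℝ W} (hx : x ∈ extDeg W i) :
    ExteriorAlgebra.map f x ∈ extDeg W' i := by
  rcases i with i | i
  · exact exteriorAlgebra_map_mem f hx
  · rw [show x = 0 from hx, map_zero]; exact zero_mem _

theorem extInv_of_mem {i : ℤ} {x : ExteriorAlgebra ℝ W} (hx : x ∈ extDeg W i) :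
    extInv x = i.negOnePow • x := by
  rcases i with i | i
  · change x ∈ ⋀[ℝ]^i W at hx
    induction hx using Submodule.pow_induction_on_left' with
    | algebraMap r => simp
    | add x y i hx hy ihx ihy => rw [map_add, ihx, ihy, smul_add]
    | mem_mul m hm i x hx ih =>
      obtain ⟨w, rfl⟩ := hm
      rw [map_mul, extInv_ι, ih]
      simp only [Int.ofNat_eq_natCast, Nat.succ_eq_add_one, Nat.cast_add, Nat.cast_one,
        Int.negOnePow_succ, Units.neg_smul, mul_smul_comm, neg_mul, smul_neg]
  · rw [show x = 0 from hx, map_zero, smul_zero]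

theorem extContract_mem (u : Module.Dual ℝ W) {i : ℤ} {x : ExteriorAlgebra ℝ W}
    (hx : x ∈ extDeg W i) : extContract u x ∈ extDeg W (i - 1) := by
  rcases i with i | i
  · change x ∈ ⋀[ℝ]^i W at hx
    induction hx using Submodule.pow_induction_on_left' with
    | algebraMap r => rw [extContract_algebraMap]; exact zero_mem _
    | add x y i hx hy ihx ihy => rw [map_add]; exact add_mem ihx ihy
    | mem_mul m hm i x hx ih =>
      obtain ⟨w, rfl⟩ := hm
      rw [extContract_ι_mul]
      have e : (Int.ofNat i.succ - 1) = (i : ℤ) := by simp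
      rw [e]
      refine sub_mem (Submodule.smul_mem _ _ hx) ?_
      have h1 : ExteriorAlgebra.ι ℝ w ∈ extDeg W 1 := by
        change _ ∈ ⋀[ℝ]^1 W
        rw [ExteriorAlgebra.exteriorPower, pow_one]; exact ⟨w, rfl⟩
      have := extDeg_mul_mem h1 ih
      rwa [show (1 + (Int.ofNat i - 1)) = (i : ℤ) by simp] at this
  · rw [show x = 0 from hx, map_zero]; exact zero_mem _

theorem mem_extDeg_one (w : W) : ExteriorAlgebra.ι ℝ w ∈ extDeg W 1 := by
  change _ ∈ ⋀[ℝ]^1 W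
  rw [ExteriorAlgebra.exteriorPower, pow_one]; exact ⟨w, rfl⟩

theorem algebraMap_mem_extDeg (r : ℝ) : algebraMap ℝ (ExteriorAlgebra ℝ W) r ∈ extDeg W 0 :=
  SetLike.algebraMap_mem_graded (fun i : ℕ ↦ ⋀[ℝ]^i W) r

end ExteriorContraction

/-! ### Differential calculus with values in a finite-dimensional exterior algebra. -/

section Norm

variable (W : Type*) [AddCommGroup W] [Module ℝ W] [FiniteDimensional ℝ W]

instance finiteDimensional_exteriorAlgebra : FiniteDimensional ℝ (ExteriorAlgebra ℝ W) :=
  (Module.finBasis ℝ W).ExteriorAlgebra.finiteDimensional_of_finite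

/-- An auxiliary norm on a finite-dimensional exterior algebra. -/
@[reducible] def extNormedAddCommGroup : NormedAddCommGroup (ExteriorAlgebra ℝ W) :=
  NormedAddCommGroup.induced _ _ (Module.finBasis ℝ (ExteriorAlgebra ℝ W)).equivFun.toLinearMap
    (Module.finBasis ℝ (ExteriorAlgebra ℝ W)).equivFun.injective

attribute [local instance] extNormedAddCommGroup

/-- The normed space structure for the auxiliary norm. -/
@[reducible] def extNormedSpace : NormedSpace ℝ (ExteriorAlgebra ℝ W) :=
  NormedSpace.induced ℝ _ _ (Module.finBasis ℝ (ExteriorAlgebra ℝ W)).equivFun.toLinearMap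

attribute [local instance] extNormedSpace

variable {W} {V : Type*} [NormedAddCommGroup V] [NormedSpace ℝ V]

/-- Multiplication as a continuous bilinear map. -/
def extMulL : ExteriorAlgebra ℝ W →L[ℝ] ExteriorAlgebra ℝ W →L[ℝ] ExteriorAlgebra ℝ W :=
  LinearMap.toContinuousLinearMap
    (LinearMap.toContinuousLinearMap.toLinearMap ∘ₗ LinearMap.mul ℝ (ExteriorAlgebra ℝ W))

theorem contDiff_ext_mul {n : WithTop ℕ∞} {K L : V → ExteriorAlgebra ℝ W} (hK : ContDiff ℝ n K)
    (hL : ContDiff ℝ n L) : ContDiff ℝ n fun z ↦ K z * L z :=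
  (extMulL (W := W)).isBoundedBilinearMap.contDiff.comp (hK.prodMk hL)

theorem fderiv_ext_mul {K L : V → ExteriorAlgebra ℝ W} {z : V} (hK : DifferentiableAt ℝ K z)
    (hL : DifferentiableAt ℝ L z) (v : V) : fderiv ℝ (fun z ↦ K z * L z) z v =
      fderiv ℝ K z v * L z + K z * fderiv ℝ L z v := by
  have := ((extMulL (W := W)).hasFDerivAt_of_bilinear hK.hasFDerivAt hL.hasFDerivAt).fderiv
  change fderiv ℝ (fun z ↦ K z * L z) z = _ at this
  rw [this, add_comm]
  rfl

theorem contDiff_ext_linear {W' : Type*} [AddCommGroup W'] [Module ℝ W'] [FiniteDimensional ℝ W']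
    (f : ExteriorAlgebra ℝ W →ₗ[ℝ] ExteriorAlgebra ℝ W') {n : WithTop ℕ∞}
    {K : V → ExteriorAlgebra ℝ W} (hK : ContDiff ℝ n K) : ContDiff ℝ n fun z ↦ f (K z) :=
  (LinearMap.toContinuousLinearMap f).contDiff.comp hK

theorem fderiv_ext_linear {G : Type*} [NormedAddCommGroup G] [NormedSpace ℝ G]
    [FiniteDimensional ℝ G] (f : ExteriorAlgebra ℝ W →ₗ[ℝ] G)
    {K : V → ExteriorAlgebra ℝ W} {z : V} (hK : DifferentiableAt ℝ K z) (v : V) :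
    fderiv ℝ (fun z ↦ f (K z)) z v = f (fderiv ℝ K z v) := by
  have := ((LinearMap.toContinuousLinearMap f).hasFDerivAt.comp z hK.hasFDerivAt).fderiv
  change fderiv ℝ (fun z ↦ f (K z)) z = _ at this
  rw [this]
  rfl

/-- A linear projection onto the subspace fixes the map, hence it also fixes its derivative. This is
how derivatives of homogeneous polyvector fields keep their degree. -/
theorem fderiv_mem_submodule {S : Submodule ℝ (ExteriorAlgebra ℝ W)}
    {K : V → ExteriorAlgebra ℝ W} {z : V} (hK : DifferentiableAt ℝ K z) (hS : ∀ z, K z ∈ S) (v : V) :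
    fderiv ℝ K z v ∈ S := by
  obtain ⟨f, hf⟩ := S.subtype.exists_leftInverse_of_injective S.ker_subtype
  have h := fderiv_ext_linear (S.subtype ∘ₗ f) hK v
  have hfun : (fun z ↦ (S.subtype ∘ₗ f) (K z)) = K := by
    funext z
    exact congrArg Subtype.val (LinearMap.congr_fun hf ⟨K z, hS z⟩)
  rw [hfun] at h
  rw [h]
  exact (f (fderiv ℝ K z v)).2

end Norm

end

/-! ### Polyvector fields on a vector space as an instance of the Darboux structure. -/

section

attribute [local instance] extNormedAddCommGroup extNormedSpace

section Polyvectors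

variable (V : Type*) [NormedAddCommGroup V] [NormedSpace ℝ V]
  (W : Type*) [AddCommGroup W] [Module ℝ W] [FiniteDimensional ℝ W]

/-- Smooth functions on `V` with values in `∧W`. -/
def smoothExtSubalgebra : Subalgebra ℝ (V → ExteriorAlgebra ℝ W) where
  carrier := {K | ContDiff ℝ ∞ K}
  mul_mem' {a b} (ha : ContDiff ℝ ∞ a) (hb : ContDiff ℝ ∞ b) := contDiff_ext_mul ha hb
  add_mem' {a b} (ha : ContDiff ℝ ∞ a) (hb : ContDiff ℝ ∞ b) := ContDiff.add ha hb
  algebraMap_mem' r := (contDiff_const : ContDiff ℝ ∞ fun _ : V ↦ algebraMap ℝ _ r)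

/-- The algebra of smooth functions on `V` with values in `∧W`. -/
def smoothExt : Type _ := ↥(smoothExtSubalgebra V W)

instance : Ring (smoothExt V W) := inferInstanceAs (Ring ↥(smoothExtSubalgebra V W))

instance : Algebra ℝ (smoothExt V W) := inferInstanceAs (Algebra ℝ ↥(smoothExtSubalgebra V W))

variable {V W}

/-- Constructor for smooth functions with values in `∧W`. -/
def smoothExt.mk (f : V → ExteriorAlgebra ℝ W) (h : ContDiff ℝ ∞ f) : smoothExt V W := ⟨f, h⟩

@[ext] theorem smoothExt.ext {K L : smoothExt V W} (h : ∀ z, K.1 z = L.1 z) : K = L :=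
  Subtype.ext (funext h)

theorem smoothExt.sum_apply {ι : Type*} (s : Finset ι) (f : ι → smoothExt V W) (z : V) :
    (∑ i ∈ s, f i).1 z = ∑ i ∈ s, (f i).1 z := by
  have : (∑ i ∈ s, f i).1 = ∑ i ∈ s, (f i).1 :=
    map_sum (smoothExtSubalgebra V W).val f s
  rw [this, Finset.sum_apply]

theorem smoothExt.smul_apply (r : ℝ) (f : smoothExt V W) (z : V) : (r • f).1 z = r • f.1 z := rfl

theorem smoothExt.zsmul_apply (r : ℤ) (f : smoothExt V W) (z : V) : (r • f).1 z = r • f.1 z := by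
  rw [← Int.cast_smul_eq_zsmul ℝ, smoothExt.smul_apply, Int.cast_smul_eq_zsmul]

theorem smoothExt.contDiff (K : smoothExt V W) : ContDiff ℝ ∞ K.1 := K.2

theorem smoothExt.differentiableAt (K : smoothExt V W) (z : V) : DifferentiableAt ℝ K.1 z :=
  (smoothExt.contDiff K).differentiable (by simp) z

/-- The derivative in a constant direction. -/
def smoothExt.deriv (v : V) : smoothExt V W →ₗ[ℝ] smoothExt V W where
  toFun K := smoothExt.mk (fun z ↦ fderiv ℝ K.1 z v)
    (((smoothExt.contDiff K).fderiv_right (m := ∞) (by simp)).clm_apply contDiff_const)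
  map_add' K L := by
    ext z
    change fderiv ℝ (K.1 + L.1) z v = _
    rw [fderiv_add (smoothExt.differentiableAt K z) (smoothExt.differentiableAt L z)]; rfl
  map_smul' r K := by
    ext z
    change fderiv ℝ (r • K.1) z v = _
    rw [fderiv_const_smul (smoothExt.differentiableAt K z)]; rfl

/-- Pointwise application of a linear map. -/
def smoothExt.postcomp {W' : Type*} [AddCommGroup W'] [Module ℝ W'] [FiniteDimensional ℝ W']
    (f : ExteriorAlgebra ℝ W →ₗ[ℝ] ExteriorAlgebra ℝ W') : smoothExt V W →ₗ[ℝ] smoothExt V W' where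
  toFun K := smoothExt.mk (fun z ↦ f (K.1 z)) (contDiff_ext_linear f (smoothExt.contDiff K))
  map_add' K L := by ext z; exact map_add f _ _
  map_smul' r K := by ext z; exact map_smul f r _

/-- Pointwise application of an algebra homomorphism after a linear substitution. -/
def smoothExt.mapHom {W' : Type*} [AddCommGroup W'] [Module ℝ W'] [FiniteDimensional ℝ W']
    (f : ExteriorAlgebra ℝ W →ₐ[ℝ] ExteriorAlgebra ℝ W') (g : V →L[ℝ] V) :
    smoothExt V W →ₐ[ℝ] smoothExt V W' where
  toFun K := smoothExt.mk (fun z ↦ f (K.1 (g z)))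
    (contDiff_ext_linear f.toLinearMap ((smoothExt.contDiff K).comp g.contDiff))
  map_one' := by ext z; exact map_one f
  map_mul' K L := by ext z; exact map_mul f _ _
  map_zero' := by ext z; exact map_zero f
  map_add' K L := by ext z; exact map_add f _ _
  commutes' r := by ext z; exact f.commutes r

/-- Symmetry of the second derivative. -/
theorem smoothExt.deriv_comm (v w : V) (K : smoothExt V W) :
    smoothExt.deriv v (smoothExt.deriv w K) = smoothExt.deriv w (smoothExt.deriv v K) := by
  ext z
  have h : ∀ v w, (smoothExt.deriv v (smoothExt.deriv w K)).1 z =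
      fderiv ℝ (fderiv ℝ K.1) z v w := by
    intro v w
    change fderiv ℝ (fun z ↦ fderiv ℝ K.1 z w) z v = _
    have hd : DifferentiableAt ℝ (fderiv ℝ K.1) z :=
      ((smoothExt.contDiff K).fderiv_right (m := 1) (by norm_cast)).differentiable (by simp) z
    rw [fderiv_clm_apply hd (differentiableAt_const w)]
    simp
  rw [h, h]
  exact ((smoothExt.contDiff K).contDiffAt.isSymmSndFDerivAt
    (by simpa using (WithTop.coe_le_coe.2 le_top : ((2 : ℕ∞) : WithTop ℕ∞) ≤ ∞))).eq v w

theorem smoothExt.deriv_mul (v : V) (K L : smoothExt V W) :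
    smoothExt.deriv v (K * L) = smoothExt.deriv v K * L + K * smoothExt.deriv v L := by
  ext z
  exact fderiv_ext_mul (smoothExt.differentiableAt K z) (smoothExt.differentiableAt L z) v

theorem smoothExt.deriv_postcomp {W' : Type*} [AddCommGroup W'] [Module ℝ W']
    [FiniteDimensional ℝ W'] (f : ExteriorAlgebra ℝ W →ₗ[ℝ] ExteriorAlgebra ℝ W') (v : V)
    (K : smoothExt V W) : smoothExt.deriv v (smoothExt.postcomp f K) =
      smoothExt.postcomp f (smoothExt.deriv v K) := by
  ext z
  exact fderiv_ext_linear f (smoothExt.differentiableAt K z) v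

theorem smoothExt.deriv_mapHom {W' : Type*} [AddCommGroup W'] [Module ℝ W']
    [FiniteDimensional ℝ W'] (f : ExteriorAlgebra ℝ W →ₐ[ℝ] ExteriorAlgebra ℝ W') (g : V →L[ℝ] V)
    (v : V) (K : smoothExt V W) : smoothExt.deriv v (smoothExt.mapHom f g K) =
      smoothExt.mapHom f g (smoothExt.deriv (g v) K) := by
  ext z
  have h1 : DifferentiableAt ℝ (fun z ↦ K.1 (g z)) z :=
    (smoothExt.differentiableAt K (g z)).comp z g.differentiableAt
  have h2 := fderiv_ext_linear f.toLinearMap h1 v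
  have h3 := ((smoothExt.differentiableAt K (g z)).hasFDerivAt.comp z g.hasFDerivAt).fderiv
  change fderiv ℝ (fun z ↦ K.1 (g z)) z = _ at h3
  rw [h3] at h2
  exact h2

theorem smoothExt.deriv_zero (K : smoothExt V W) : smoothExt.deriv 0 K = 0 := by
  ext z; exact map_zero (fderiv ℝ K.1 z)

/-- The data of a product decomposition of `V`, with coordinates, and polyvector generators `W`. -/
structure FrameData (X Y V W : Type*) [NormedAddCommGroup V] [NormedSpace ℝ V] [AddCommGroup W]
    [Module ℝ W] where
  e : X ⊕ Y → V
  u : X ⊕ Y → Module.Dual ℝ W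
  pr : V →L[ℝ] V
  p : W →ₗ[ℝ] W
  pr_pr : pr ∘L pr = pr
  p_p : p ∘ₗ p = p
  pr_inl : ∀ i, pr (e (.inl i)) = e (.inl i)
  pr_inr : ∀ i, pr (e (.inr i)) = 0
  u_inl : ∀ i, u (.inl i) ∘ₗ p = 0
  u_inr : ∀ i, u (.inr i) ∘ₗ p = u (.inr i)

theorem extContract_zero (x : ExteriorAlgebra ℝ W) : extContract 0 x = 0 := by
  unfold extContract; rw [map_zero, LinearMap.zero_apply]

variable {X Y : Type*}

/-- The superalgebra of polyvector fields. -/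
def polyvector (D : FrameData X Y V W) : Darboux X Y (smoothExt V W) where
  inv := smoothExt.mapHom extInv (ContinuousLinearMap.id ℝ V)
  inv_inv K := by ext z; exact extInv_extInv _
  d i := smoothExt.deriv (D.e i)
  d_mul i := smoothExt.deriv_mul _
  c i := smoothExt.postcomp (extContract (D.u i))
  c_mul i K L := by ext z; exact extContract_mul _ _ _
  d_d i j := smoothExt.deriv_comm _ _
  c_c i j K := by ext z; exact extContract_comm _ _ _
  d_c i j K := smoothExt.deriv_postcomp _ _ _
  inv_d i K := (smoothExt.deriv_mapHom extInv (ContinuousLinearMap.id ℝ V) _ K).symm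
  inv_c i K := by ext z; exact extInv_extContract _ _
  even_comm K L h := by ext z; exact ext_even_comm (congrFun (congrArg Subtype.val h) z) _
  odd_comm K L h := by ext z; exact ext_odd_comm (congrFun (congrArg Subtype.val h) z) _
  P := smoothExt.mapHom (ExteriorAlgebra.map D.p) D.pr
  P_P K := by
    ext z
    change ExteriorAlgebra.map D.p (ExteriorAlgebra.map D.p (K.1 ((D.pr ∘L D.pr) z))) = _
    rw [map_map_apply, D.p_p, D.pr_pr]; rfl
  inv_P K := by ext z; exact extInv_map _ _
  P_d_inl i K := by rw [smoothExt.deriv_mapHom, D.pr_inl]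
  d_inr_P i K := by rw [smoothExt.deriv_mapHom, D.pr_inr, smoothExt.deriv_zero, map_zero]
  P_c_inr i K := by
    ext z
    change ExteriorAlgebra.map D.p (extContract _ _) = extContract _ (ExteriorAlgebra.map D.p _)
    rw [extContract_map, D.u_inr]
  c_inl_P i K := by
    ext z
    change extContract _ (ExteriorAlgebra.map D.p _) = 0
    rw [extContract_map, D.u_inl, extContract_zero, map_zero]

variable [Fintype X] [Fintype Y] (D : FrameData X Y V W)

theorem polyvector_br_apply (K L : smoothExt V W) (z : V) :
    ((polyvector D).br K L).1 z = ∑ i, (extInv (extContract (D.u i) (K.1 z)) *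
      fderiv ℝ L.1 z (D.e i) - fderiv ℝ K.1 z (D.e i) * extContract (D.u i) (L.1 z)) := by
  rw [Darboux.br_apply]
  rw [smoothExt.sum_apply]
  rfl

theorem polyvector_tau_apply (a K : smoothExt V W) (z : V) :
    ((polyvector D).tau a K).1 z = ∑ i, (-(extContract (D.u i) (K.1 z) *
      fderiv ℝ a.1 z (D.e i)) - extInv (fderiv ℝ K.1 z (D.e i)) * extContract (D.u i) (a.1 z)) := by
  rw [Darboux.tau_apply, polyvector_br_apply]
  refine Finset.sum_congr rfl fun i _ ↦ ?_
  have h1 : ((polyvector D).inv K).1 z = extInv (K.1 z) := rfl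
  have h2 : fderiv ℝ ((polyvector D).inv K).1 z (D.e i) = extInv (fderiv ℝ K.1 z (D.e i)) :=
    fderiv_ext_linear extInv.toLinearMap (smoothExt.differentiableAt K z) _
  rw [h1, h2, extInv_extContract, extInv_extInv, neg_mul]

open Filter Topology

/-- The bracket uses only values and first derivatives, so it depends on germs. This makes it
harmless to extend local data to the whole model space by cutoff functions. -/
theorem polyvector_br_congr {K L K' L' : smoothExt V W} {z : V} (hK : K.1 =ᶠ[𝓝 z] K'.1)
    (hL : L.1 =ᶠ[𝓝 z] L'.1) : ((polyvector D).br K L).1 =ᶠ[𝓝 z] ((polyvector D).br K' L').1 := by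
  filter_upwards [hK.eventuallyEq_nhds, hL.eventuallyEq_nhds] with y h1 h2
  rw [polyvector_br_apply, polyvector_br_apply, h1.fderiv_eq, h2.fderiv_eq, h1.eq_of_nhds,
    h2.eq_of_nhds]

theorem polyvector_tau_congr {a K a' K' : smoothExt V W} {z : V} (ha : a.1 =ᶠ[𝓝 z] a'.1)
    (hK : K.1 =ᶠ[𝓝 z] K'.1) : ((polyvector D).tau a K).1 =ᶠ[𝓝 z] ((polyvector D).tau a' K').1 := by
  rw [Darboux.tau_apply, Darboux.tau_apply]
  refine polyvector_br_congr D ?_ ha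
  filter_upwards [hK] with y hy
  exact congrArg extInv hy

theorem polyvector_iter_congr {G G' : smoothExt V W} {z : V} (hG : G.1 =ᶠ[𝓝 z] G'.1) :
    ∀ (n : ℕ) {a a' : Fin n → smoothExt V W} (_ : ∀ i, (a i).1 =ᶠ[𝓝 z] (a' i).1),
      ((polyvector D).iter G n a).1 =ᶠ[𝓝 z] ((polyvector D).iter G' n a').1
  | 0, _, _, _ => hG
  | n + 1, _, _, ha => polyvector_tau_congr D (ha _)
      (polyvector_iter_congr hG n fun i ↦ ha i.castSucc)

theorem polyvector_P_congr {K K' : smoothExt V W} {z : V} (hK : K.1 =ᶠ[𝓝 (D.pr z)] K'.1) :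
    ((polyvector D).P K).1 =ᶠ[𝓝 z] ((polyvector D).P K').1 := by
  filter_upwards [D.pr.continuous.continuousAt.eventually hK] with y hy
  exact congrArg (ExteriorAlgebra.map D.p) hy

theorem polyvector_tau_mem {a K : smoothExt V W} {i k : ℤ} (ha : ∀ z, a.1 z ∈ extDeg W i)
    (hK : ∀ z, K.1 z ∈ extDeg W k) (z : V) :
    ((polyvector D).tau a K).1 z ∈ extDeg W (k + i - 1) := by
  rw [polyvector_tau_apply]
  refine sum_mem fun j _ ↦ sub_mem (neg_mem ?_) ?_
  · have := extDeg_mul_mem (extContract_mem (D.u j) (hK z))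
      (fderiv_mem_submodule (smoothExt.differentiableAt a z) ha (D.e j))
    rwa [show k - 1 + i = k + i - 1 by ring] at this
  · have h1 := fderiv_mem_submodule (smoothExt.differentiableAt K z) hK (D.e j)
    have := extDeg_mul_mem h1 (extContract_mem (D.u j) (ha z))
    rw [extInv_of_mem h1, smul_mul_assoc, show k + i - 1 = k + (i - 1) by ring, Units.smul_def]
    exact zsmul_mem this _

/-- Each bracketing adds the degree of its argument and subtracts one. Starting from a bivector,
this gives the degree `2 - n` of the `n`-ary bracket. -/
theorem polyvector_iter_mem {G : smoothExt V W} {k : ℤ} (hG : ∀ z, G.1 z ∈ extDeg W k) :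
    ∀ (n : ℕ) {a : Fin n → smoothExt V W} {d : Fin n → ℤ} (_ : ∀ i z, (a i).1 z ∈ extDeg W (d i))
      (z : V), ((polyvector D).iter G n a).1 z ∈ extDeg W (k - n + ∑ i, d i)
  | 0, _, _, _, z => by simpa [Darboux.iter_zero] using hG z
  | n + 1, a, d, ha, z => by
    have := polyvector_tau_mem D (ha (Fin.last n))
      (polyvector_iter_mem hG n fun i ↦ ha i.castSucc) z
    rw [Fin.sum_univ_castSucc, Darboux.iter_succ,
      show k - ((n + 1 : ℕ) : ℤ) + (∑ i : Fin n, d i.castSucc + d (Fin.last n)) =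
        k - n + ∑ i : Fin n, d i.castSucc + d (Fin.last n) - 1 by push_cast; ring]
    exact this

end Polyvectors

end

/-! ### Adjoining odd parameters to polyvector fields; the local Jacobi identities. -/

section

attribute [local instance] extNormedAddCommGroup extNormedSpace

section Parameters

variable {V : Type*} [NormedAddCommGroup V] [NormedSpace ℝ V]
  {W : Type*} [AddCommGroup W] [Module ℝ W] [FiniteDimensional ℝ W]
  {X Y : Type*} [Fintype X] [Fintype Y] (D : FrameData X Y V W)

/-- Adjoin parameters to the polyvector generators. -/
def FrameData.extend (G : Type*) [AddCommGroup G] [Module ℝ G] : FrameData X Y V (W × G) where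
  e := D.e
  u i := D.u i ∘ₗ LinearMap.fst ℝ W G
  pr := D.pr
  p := D.p.prodMap LinearMap.id
  pr_pr := D.pr_pr
  p_p := by rw [LinearMap.prodMap_comp, D.p_p]; rfl
  pr_inl := D.pr_inl
  pr_inr := D.pr_inr
  u_inl i := by
    ext x
    · exact LinearMap.congr_fun (D.u_inl i) x
    · simp
  u_inr i := by
    ext x
    · exact LinearMap.congr_fun (D.u_inr i) x
    · simp

/-- The inclusion of polyvector fields without parameters. -/
def extendHom (G : Type*) [AddCommGroup G] [Module ℝ G] [FiniteDimensional ℝ G] :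
    Darboux.Hom (polyvector D) (polyvector (D.extend G)) where
  toHom := smoothExt.mapHom (ExteriorAlgebra.map (LinearMap.inl ℝ W G)) (ContinuousLinearMap.id ℝ V)
  inv K := by ext z; exact extInv_map _ _
  d i K := smoothExt.deriv_mapHom _ _ _ _
  c i K := by
    ext z
    change extContract _ (ExteriorAlgebra.map _ _) = ExteriorAlgebra.map _ (extContract _ _)
    rw [extContract_map]
    rfl
  P K := by
    ext z
    change ExteriorAlgebra.map _ (ExteriorAlgebra.map _ _) =
      ExteriorAlgebra.map _ (ExteriorAlgebra.map _ _)
    rw [map_map_apply, map_map_apply]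
    rfl

variable {G : Type*} [AddCommGroup G] [Module ℝ G] [FiniteDimensional ℝ G]

/-- The constant odd element attached to a parameter vector. -/
def paramVec (g : G) : smoothExt V (W × G) :=
  smoothExt.mk (fun _ ↦ ExteriorAlgebra.ι ℝ (0, g)) contDiff_const

/-- Contraction with a covector on the parameter space. -/
def paramContract (u : Module.Dual ℝ G) : smoothExt V (W × G) →ₗ[ℝ] smoothExt V (W × G) :=
  smoothExt.postcomp (extContract (u ∘ₗ LinearMap.snd ℝ W G))

theorem isConst_paramVec (g : G) : (polyvector (D.extend G)).IsConst (paramVec g) where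
  d i := by
    ext z
    change fderiv ℝ (fun _ ↦ ExteriorAlgebra.ι ℝ ((0 : W), g)) z _ = 0
    rw [fderiv_fun_const]
    rfl
  c i := by
    ext z
    change extContract _ (ExteriorAlgebra.ι ℝ _) = 0
    rw [extContract_ι]
    simp [FrameData.extend]
  P := by
    ext z
    change ExteriorAlgebra.map _ (ExteriorAlgebra.ι ℝ _) = ExteriorAlgebra.ι ℝ _
    rw [ExteriorAlgebra.map_apply_ι]
    simp [FrameData.extend]

theorem inv_paramVec (g : G) :
    (polyvector (D.extend G)).inv (paramVec g) = -paramVec g := by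
  ext z; exact extInv_ι _

theorem paramContract_mul (u : Module.Dual ℝ G) (K L : smoothExt V (W × G)) :
    paramContract u (K * L) = paramContract u K * L +
      (polyvector (D.extend G)).inv K * paramContract u L := by
  ext z; exact extContract_mul _ _ _

theorem inv_paramContract (u : Module.Dual ℝ G) (K : smoothExt V (W × G)) :
    (polyvector (D.extend G)).inv (paramContract u K) =
      -paramContract u ((polyvector (D.extend G)).inv K) := by
  ext z; exact extInv_extContract _ _

theorem paramContract_paramVec (u : Module.Dual ℝ G) (g : G) :
    (paramContract u (paramVec g) : smoothExt V (W × G)) = algebraMap ℝ _ (u g) := by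
  ext z
  change extContract _ (ExteriorAlgebra.ι ℝ _) = _
  rw [extContract_ι]; rfl

theorem paramContract_extendHom (u : Module.Dual ℝ G) (K : smoothExt V W) :
    paramContract u ((extendHom D G).toHom K) = 0 := by
  ext z
  change extContract _ (ExteriorAlgebra.map _ _) = 0
  rw [extContract_map]
  have : (u ∘ₗ LinearMap.snd ℝ W G) ∘ₗ LinearMap.inl ℝ W G = 0 := by ext; simp
  rw [this, extContract_zero, map_zero]

theorem extendHom_injective : Function.Injective (extendHom D G).toHom := by
  intro K L h
  ext z
  have h1 := congrFun (congrArg Subtype.val h) z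
  change ExteriorAlgebra.map (LinearMap.inl ℝ W G) _ = ExteriorAlgebra.map _ _ at h1
  have h2 := congrArg (ExteriorAlgebra.map (LinearMap.fst ℝ W G)) h1
  rw [map_map_apply, map_map_apply, LinearMap.fst_comp_inl, ExteriorAlgebra.map_id] at h2
  exact h2

variable {n : ℕ} (d : Fin n → ℤ)

/-- Parameters making arguments of degree `d k` odd. -/
def etaParam (k : Fin n) : smoothExt V (W × (Fin n ⊕ Fin n → ℝ)) :=
  if Even (d k) then paramVec (Pi.single (.inl k) 1)
  else paramVec (Pi.single (.inl k) 1) * paramVec (Pi.single (.inr k) 1)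

theorem isConst_etaParam (k : Fin n) :
    (polyvector (D.extend (Fin n ⊕ Fin n → ℝ))).IsConst (etaParam d k) := by
  unfold etaParam
  split_ifs
  · exact isConst_paramVec D _
  · exact (isConst_paramVec D _).mul (isConst_paramVec D _)

theorem inv_etaParam (k : Fin n) : (polyvector (D.extend (Fin n ⊕ Fin n → ℝ))).inv (etaParam d k) =
    (d k - 1).negOnePow • etaParam d k := by
  unfold etaParam
  split_ifs with h
  · rw [inv_paramVec, Int.negOnePow_odd _ (h.sub_odd odd_one), Units.neg_smul, one_smul]
  · rw [map_mul, inv_paramVec, inv_paramVec, neg_mul_neg,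
      Int.negOnePow_even _ ((Int.not_even_iff_odd.1 h).sub_odd odd_one), one_smul]

/-- For odd `d k` an even parameter is needed, and `1` would not do: discarding repeated indices
requires square zero. A product of two odd generators has both properties. -/
theorem etaParam_sq (k : Fin n) :
    (etaParam d k : smoothExt V (W × (Fin n ⊕ Fin n → ℝ))) * etaParam d k = 0 := by
  ext z
  unfold etaParam
  split_ifs with h
  · exact ExteriorAlgebra.ι_sq_zero _
  · have key : ∀ v w : W × (Fin n ⊕ Fin n → ℝ), (ExteriorAlgebra.ι ℝ v * ExteriorAlgebra.ι ℝ w) *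
        (ExteriorAlgebra.ι ℝ v * ExteriorAlgebra.ι ℝ w) = 0 := fun v w ↦ by
      rw [mul_assoc, ← mul_assoc (ExteriorAlgebra.ι ℝ w), mul_ι_eq (ExteriorAlgebra.ι ℝ w),
        extInv_ι, ← mul_assoc, ← mul_assoc, ExteriorAlgebra.ι_sq_zero, zero_mul, zero_mul]
    exact key _ _

/-- Coordinate of the parameter space. -/
def paramCoord (g : Fin n ⊕ Fin n) : Module.Dual ℝ (Fin n ⊕ Fin n → ℝ) := LinearMap.proj g

theorem paramContract_etaParam {k l : Fin n} (h : k ≠ l) (g : Fin n ⊕ Fin n)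
    (hg : g = .inl k ∨ g = .inr k) :
    (paramContract (paramCoord g) (etaParam d l) :
      smoothExt V (W × (Fin n ⊕ Fin n → ℝ))) = 0 := by
  have h1 : ∀ s : Fin n ⊕ Fin n, s = .inl l ∨ s = .inr l →
      paramCoord g (Pi.single (M := fun _ ↦ ℝ) s 1) = 0 := by
    intro s hs
    rw [paramCoord, LinearMap.proj_apply, Pi.single_eq_of_ne]
    rcases hg with rfl | rfl <;> rcases hs with rfl | rfl <;> simp [h]
  ext z
  unfold etaParam
  split_ifs
  · rw [paramContract_paramVec, h1 _ (.inl rfl), map_zero]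
  · have key : ∀ (u : Module.Dual ℝ (W × (Fin n ⊕ Fin n → ℝ))) (v w : W × (Fin n ⊕ Fin n → ℝ)),
        u v = 0 → u w = 0 → extContract u (ExteriorAlgebra.ι ℝ v * ExteriorAlgebra.ι ℝ w) = 0 :=
      fun u v w hv hw ↦ by
        rw [extContract_ι_mul, extContract_ι, hv, hw, zero_smul, map_zero, mul_zero, sub_zero]
    exact key _ _ _ (h1 _ (.inl rfl)) (h1 _ (.inr rfl))

include D in
-- Contraction with a parameter covector that kills `K` strips that generator off the product,
-- leaving `K` up to parity. An even parameter needs two such contractions.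
theorem eq_zero_of_mul_etaParam (k : Fin n) {K : smoothExt V (W × (Fin n ⊕ Fin n → ℝ))}
    (h1 : paramContract (paramCoord (.inl k)) K = 0)
    (h2 : paramContract (paramCoord (.inr k)) K = 0) (h : K * etaParam d k = 0) : K = 0 := by
  have hinv' : ∀ L, (polyvector (D.extend (Fin n ⊕ Fin n → ℝ))).inv L = 0 → L = 0 := fun L hL ↦ by
    rw [← (polyvector (D.extend _)).inv_inv L, hL, map_zero]
  have e1 : paramCoord (Sum.inl k) (Pi.single (M := fun _ ↦ ℝ) (Sum.inl k) 1) = 1 := by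
    simp [paramCoord]
  have e2 : paramCoord (Sum.inr k) (Pi.single (M := fun _ ↦ ℝ) (Sum.inr k) 1) = 1 := by
    simp [paramCoord]
  have e3 : paramCoord (Sum.inl k) (Pi.single (M := fun _ ↦ ℝ) (Sum.inr k) 1) = 0 := by
    simp [paramCoord]
  have hc := congrArg (paramContract (paramCoord (.inl k))) h
  rw [paramContract_mul D, h1, zero_mul, zero_add, map_zero] at hc
  unfold etaParam at hc
  split_ifs at hc
  · rw [paramContract_paramVec, e1, map_one, mul_one] at hc
    exact hinv' _ hc
  · rw [paramContract_mul D, paramContract_paramVec, paramContract_paramVec, e1, e3, map_one,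
      map_zero, mul_zero, add_zero, one_mul] at hc
    have hc2 := congrArg (paramContract (paramCoord (.inr k))) hc
    have h3 : paramContract (paramCoord (.inr k))
        ((polyvector (D.extend (Fin n ⊕ Fin n → ℝ))).inv K) = 0 := by
      rw [← neg_eq_zero, ← inv_paramContract, h2, map_zero]
    rw [paramContract_mul D, h3, zero_mul, zero_add, (polyvector (D.extend _)).inv_inv,
      paramContract_paramVec, e2, map_one, mul_one, map_zero] at hc2
    exact hc2

theorem paramContract_opIter {k : Fin n} (g : Fin n ⊕ Fin n) (hg : g = .inl k ∨ g = .inr k) :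
    ∀ (m : ℕ) (r : Fin m → Fin n) (_ : ∀ i, k ≠ r i),
      paramContract (paramCoord g) (opIter m (fun i ↦
        (polyvector (D.extend (Fin n ⊕ Fin n → ℝ))).paramMul (d (r i)) (etaParam d (r i))) 1) = 0
  | 0, r, _ => by
    ext z
    change extContract _ (1 : ExteriorAlgebra ℝ _) = 0
    rw [← map_one (algebraMap ℝ _), extContract_algebraMap]
  | m + 1, r, hr => by
    have ih := paramContract_opIter g hg m (fun i ↦ r i.castSucc) fun i ↦ hr _
    change paramContract _ ((polyvector (D.extend (Fin n ⊕ Fin n → ℝ))).invPow _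
      (opIter m _ 1) * etaParam d (r _)) = 0
    rw [paramContract_mul D, paramContract_etaParam d (hr _) g hg, mul_zero, add_zero]
    by_cases he : Even (d (r (Fin.last m)))
    · rw [Darboux.invPow_even _ he, ih, zero_mul]
    · rw [Darboux.invPow_odd _ he, ← neg_eq_zero, ← neg_mul, ← inv_paramContract, ih, map_zero,
        zero_mul]

/-- The parameters are peeled off from the right. The remaining factor involves only polyvectors
without parameters and the other parameters, so it is killed by the contractions for the last one.
-/
theorem eq_zero_of_mul_opIter :
    ∀ (m : ℕ) (r : Fin m → Fin n) (_ : Function.Injective r) (K : smoothExt V W),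
      (extendHom D (Fin n ⊕ Fin n → ℝ)).toHom K * opIter m (fun i ↦
        (polyvector (D.extend (Fin n ⊕ Fin n → ℝ))).paramMul (d (r i)) (etaParam d (r i))) 1 = 0 →
      K = 0
  | 0, r, _, K, h => by
    change _ * (1 : smoothExt V (W × (Fin n ⊕ Fin n → ℝ))) = 0 at h
    rw [mul_one] at h
    exact extendHom_injective D (h.trans (map_zero _).symm)
  | m + 1, r, hr, K, h => by
    have hr' : Function.Injective fun i : Fin m ↦ r i.castSucc :=
      hr.comp (Fin.castSucc_injective m)
    have hne : ∀ i : Fin m, r (Fin.last m) ≠ r i.castSucc := fun i hh ↦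
      (Fin.castSucc_lt_last i).ne (hr hh).symm
    set S := polyvector (D.extend (Fin n ⊕ Fin n → ℝ))
    set Z := opIter m (fun i : Fin m ↦ S.paramMul (d (r i.castSucc)) (etaParam d (r i.castSucc))) 1
      with hZ
    change (extendHom D (Fin n ⊕ Fin n → ℝ)).toHom K *
      (S.invPow (d (r (Fin.last m))) Z * etaParam d (r (Fin.last m))) = 0 at h
    rw [← mul_assoc] at h
    have hc : ∀ g, g = .inl (r (Fin.last m)) ∨ g = .inr (r (Fin.last m)) →
        paramContract (paramCoord g) ((extendHom D (Fin n ⊕ Fin n → ℝ)).toHom K *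
          S.invPow (d (r (Fin.last m))) Z) = 0 := by
      intro g hg
      have ih := paramContract_opIter D d g hg m (fun i ↦ r i.castSucc) hne
      rw [paramContract_mul D, paramContract_extendHom, zero_mul, zero_add]
      by_cases he : Even (d (r (Fin.last m)))
      · rw [Darboux.invPow_even _ he, ih, mul_zero]
      · rw [Darboux.invPow_odd _ he, ← neg_eq_zero, ← mul_neg, ← inv_paramContract, ih, map_zero,
          mul_zero]
    have h0 := eq_zero_of_mul_etaParam D d _ (hc _ (.inl rfl)) (hc _ (.inr rfl)) h
    by_cases he : Even (d (r (Fin.last m)))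
    · rw [Darboux.invPow_even _ he] at h0
      exact eq_zero_of_mul_opIter m _ hr' K h0
    · rw [Darboux.invPow_odd _ he] at h0
      have h1 := congrArg S.inv h0
      rw [map_mul, S.inv_inv, map_zero, (extendHom D _).inv] at h1
      have := eq_zero_of_mul_opIter m _ hr' _ h1
      rw [← (polyvector D).inv_inv K, this, map_zero]

theorem params_etaParam :
    Darboux.Params (extendHom D (Fin n ⊕ Fin n → ℝ)) d (etaParam d) where
  const := isConst_etaParam D d
  inv := inv_etaParam D d
  sq := etaParam_sq d
  inj K h := eq_zero_of_mul_opIter D d n id Function.injective_id K h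

open Filter Topology

/-- The generalized Jacobi identity at a point near which the Schouten square vanishes. -/
theorem polyvector_jacobi {H : smoothExt V W} (hH : ∀ z, H.1 z ∈ extDeg W 2) {z : V}
    (hz : ((polyvector D).br H H).1 =ᶠ[𝓝 (D.pr z)] 0) {a : Fin n → smoothExt V W}
    (ha : ∀ k z, (a k).1 z ∈ extDeg W (d k)) (hP : ∀ k, (polyvector D).P (a k) = a k) :
    ∑ σ : Equiv.Perm (Fin n), (Equiv.Perm.sign σ * koszulSign d σ) •
      ∑ q : Fin (n + 1), ((-1 : ℝ) ^ (n - q : ℕ) /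
        ((Nat.factorial q : ℝ) * (Nat.factorial (n - q) : ℝ))) •
        ((polyvector D).nested H q (n - q) (n := n) (by omega) (a ∘ σ)).1 z = 0 := by
  have key := Darboux.sum_perm_nested (params_etaParam D d) (H := H)
    (by
      ext z
      have := extInv_of_mem (hH z)
      rw [Int.negOnePow_even _ even_two, one_smul] at this
      exact this) (a := a) (fun k ↦ by
      ext z
      have := extInv_of_mem (ha k z)
      rw [Units.smul_def] at this ⊢
      exact this) hP
  have h1 := congrFun (congrArg Subtype.val key) z
  -- The value of `P` at `z` sees only the germ at `D.pr z`, where `{H, H}` is zero; iterated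
  -- brackets of zero vanish.
  have h0 : ∀ σ : Equiv.Perm (Fin n), ((polyvector D).P
      ((polyvector D).iter ((polyvector D).br H H) n (a ∘ σ))).1 z = 0 := by
    intro σ
    have := (polyvector_P_congr D (polyvector_iter_congr D (G' := 0) hz n
      (a := a ∘ σ) (a' := a ∘ σ) fun i ↦ EventuallyEq.rfl)).eq_of_nhds
    rw [this]
    have hzero : ∀ m (a : Fin m → smoothExt V W), (polyvector D).iter 0 m a = 0 := by
      intro m
      induction m with
      | zero => exact fun _ ↦ rfl
      | succ m ih => intro a; rw [Darboux.iter_succ, ih, map_zero]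
    rw [hzero, map_zero]; rfl
  simp only [smoothExt.sum_apply, Units.smul_def, smoothExt.zsmul_apply, smoothExt.smul_apply, h0,
    smul_zero, Finset.sum_const_zero] at h1 ⊢
  exact h1

end Parameters

end

/-! ### Hadamard's lemma and localization on the model space. -/

section

open Filter Topology MeasureTheory

section Hadamard

universe u
variable {V : Type u} [NormedAddCommGroup V] [NormedSpace ℝ V] [FiniteDimensional ℝ V]

/-- Induction by differentiation under the integral sign, dominated by a bound on `[0, 1]` times a
closed ball. The target `G` varies since the derivative takes values in `V →L[ℝ] G`; putting `G` and
`V` in one universe keeps that space in the range of the induction. -/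
theorem contDiff_integral_line (n : ℕ) : ∀ {G : Type u} [NormedAddCommGroup G]
    [NormedSpace ℝ G] [CompleteSpace G] {f : ℝ → V → G}
    (_ : ContDiff ℝ ∞ (Function.uncurry f)),
    ContDiff ℝ n fun z ↦ ∫ t in (0 : ℝ)..1, f t z := by
  induction n with
  | zero =>
    intro G _ _ _ f hf
    rw [Nat.cast_zero, contDiff_zero]
    exact intervalIntegral.continuous_parametric_intervalIntegral_of_continuous'
      (f := fun z t ↦ f t z)
      (show Continuous fun p : V × ℝ ↦ f p.2 p.1 from
        hf.continuous.comp (continuous_snd.prodMk continuous_fst)) 0 1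
  | succ n ih =>
    intro G _ _ _ f hf
    have hf' : ContDiff ℝ ∞ (Function.uncurry fun t z ↦ fderiv ℝ (f t) z) := by
      have := ContDiff.fderiv (n := ∞) (m := ∞) (f := fun p : ℝ × V ↦ f p.1) (g := fun p : ℝ × V ↦ p.2)
        (hf.comp ((contDiff_fst.comp contDiff_fst).prodMk contDiff_snd)) contDiff_snd (by simp)
      exact this
    have hd : ∀ t z, HasFDerivAt (f t) (fderiv ℝ (f t) z) z := fun t z ↦
      ((hf.comp (contDiff_const.prodMk contDiff_id)).differentiable (by simp) z).hasFDerivAt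
    have hint : ∀ z, HasFDerivAt (fun z ↦ ∫ t in (0 : ℝ)..1, f t z)
        (∫ t in (0 : ℝ)..1, fderiv ℝ (f t) z) z := by
      intro z
      obtain ⟨C, hC⟩ := ((isCompact_Icc (a := (0 : ℝ)) (b := 1)).prod
        (isCompact_closedBall z 1)).exists_bound_of_continuousOn hf'.continuous.continuousOn
      refine (intervalIntegral.hasFDerivAt_integral_of_dominated_of_fderiv_le
        (F := fun z t ↦ f t z) (F' := fun z t ↦ fderiv ℝ (f t) z) (bound := fun _ ↦ C)
        (s := Metric.ball z 1) (Metric.ball_mem_nhds z one_pos) ?_ ?_ ?_ ?_ ?_ ?_)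
      · exact Eventually.of_forall fun z ↦
          (hf.continuous.comp (continuous_id.prodMk continuous_const)).aestronglyMeasurable
      · exact (hf.continuous.comp (continuous_id.prodMk continuous_const)).intervalIntegrable _ _
      · exact (hf'.continuous.comp (continuous_id.prodMk continuous_const)).aestronglyMeasurable
      · refine Eventually.of_forall fun t ht y hy ↦ hC (t, y) ⟨?_, Metric.ball_subset_closedBall hy⟩
        rw [Set.uIoc_of_le zero_le_one] at ht
        exact ⟨ht.1.le, ht.2⟩
      · exact intervalIntegrable_const
      · exact Eventually.of_forall fun t _ y _ ↦ hd t y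
    rw [Nat.cast_succ]
    exact contDiff_succ_iff_hasFDerivAt.2 ⟨_, ih hf', hint⟩

/-- Hadamard's lemma. -/
theorem exists_hadamard {K : V → ℝ} (hK : ContDiff ℝ ∞ K) (z₀ : V) :
    ∃ g : V → V →L[ℝ] ℝ, ContDiff ℝ ∞ g ∧ g z₀ = fderiv ℝ K z₀ ∧
      ∀ z, K z = K z₀ + g z (z - z₀) := by
  refine ⟨fun z ↦ ∫ t in (0 : ℝ)..1, fderiv ℝ K (z₀ + t • (z - z₀)), ?_, ?_, fun z ↦ ?_⟩
  · rw [contDiff_infty]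
    intro n
    refine contDiff_integral_line n (f := fun t z ↦ fderiv ℝ K (z₀ + t • (z - z₀))) ?_
    exact (hK.fderiv_right (m := ∞) (by simp)).comp
      (contDiff_const.add (contDiff_fst.smul (contDiff_snd.sub contDiff_const)))
  · simp
  · have hcont : Continuous fun t : ℝ ↦ fderiv ℝ K (z₀ + t • (z - z₀)) :=
      (hK.continuous_fderiv (by simp)).comp (by fun_prop)
    change K z = K z₀ + (∫ t in (0 : ℝ)..1, fderiv ℝ K (z₀ + t • (z - z₀))) (z - z₀)
    rw [ContinuousLinearMap.intervalIntegral_apply (hcont.intervalIntegrable _ _)]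
    have := intervalIntegral.integral_eq_sub_of_hasDerivAt (a := 0) (b := 1)
      (f := fun t : ℝ ↦ K (z₀ + t • (z - z₀)))
      (f' := fun t : ℝ ↦ fderiv ℝ K (z₀ + t • (z - z₀)) (z - z₀)) (fun t _ ↦ ?_)
      ((hcont.clm_apply continuous_const).intervalIntegrable _ _)
    · rw [this]; simp
    · have h1 : HasDerivAt (fun t : ℝ ↦ z₀ + t • (z - z₀)) (z - z₀) t := by
        simpa using ((hasDerivAt_id t).smul_const (z - z₀)).const_add z₀
      exact ((hK.differentiable (by simp) _).hasFDerivAt).comp_hasDerivAt t h1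

theorem contDiff_bump_smul {G : Type*} [NormedAddCommGroup G] [NormedSpace ℝ G] {c : V}
    (ρ : ContDiffBump c) {O : Set V} (hO : IsOpen O) (hρ : Metric.closedBall c ρ.rOut ⊆ O)
    {f : V → G} (hf : ContDiffOn ℝ ∞ f O) : ContDiff ℝ ∞ fun z ↦ ρ z • f z := by
  rw [contDiff_iff_contDiffAt]
  intro z
  by_cases hz : z ∈ O
  · exact ρ.contDiff.contDiffAt.smul (hf.contDiffAt (hO.mem_nhds hz))
  · have : (fun z ↦ ρ z • f z) =ᶠ[𝓝 z] fun _ ↦ 0 := by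
      filter_upwards [Metric.isClosed_closedBall.isOpen_compl.mem_nhds fun h ↦ hz (hρ h)] with y hy
      rw [ρ.zero_of_le_dist, zero_smul]
      simp only [Set.mem_compl_iff, Metric.mem_closedBall, not_le] at hy
      exact hy.le
    exact contDiffAt_const.congr_of_eventuallyEq this

theorem exists_contDiffBump_subset (c : V) {O : Set V} (hO : O ∈ 𝓝 c) :
    ∃ ρ : ContDiffBump c, Metric.closedBall c ρ.rOut ⊆ O := by
  obtain ⟨r, hr, h⟩ := Metric.nhds_basis_closedBall.mem_iff.1 hO
  exact ⟨⟨r / 2, r, half_pos hr, half_lt_self hr⟩, h⟩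

end Hadamard

/-! ### Derivations at a point of a manifold. -/

section PointDerivation

universe u
variable {EM : Type u} [NormedAddCommGroup EM] [NormedSpace ℝ EM] [FiniteDimensional ℝ EM]
  {HM : Type*} [TopologicalSpace HM] (J : ModelWithCorners ℝ EM HM) [J.Boundaryless]
  {M : Type*} [TopologicalSpace M] [T2Space M] [ChartedSpace HM M] [IsManifold J ∞ M]

/-- A derivation at a point. -/
structure IsPointDerivation (m : M) (δ : C^∞⟮J, M; ℝ⟯ →ₗ[ℝ] ℝ) : Prop where
  mul : ∀ f g : C^∞⟮J, M; ℝ⟯, δ (f * g) = δ f * g m + f m * δ g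

variable {J}

theorem contDiffOn_comp_symm (m₀ : M) (f : C^∞⟮J, M; ℝ⟯) :
    ContDiffOn ℝ ∞ (f ∘ (extChartAt J m₀).symm) (extChartAt J m₀).target :=
  contMDiffOn_iff_contDiffOn.1 (f.contMDiff.comp_contMDiffOn (contMDiffOn_extChartAt_symm m₀))

theorem exists_smooth_extension {m : M} {U : Set M} (hU : U ∈ 𝓝 m) :
    ∃ χ : C^∞⟮J, M; ℝ⟯, tsupport χ ⊆ U ∧ χ =ᶠ[𝓝 m] 1 := by
  obtain ⟨χ, hχ, h⟩ := (SmoothBumpFunction.nhds_basis_tsupport (I := J) (c := m)).mem_iff.1 hU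
  exact ⟨⟨χ, χ.contMDiff⟩, h, χ.eventuallyEq_one⟩

theorem contMDiff_smul_of_tsupport {χ : C^∞⟮J, M; ℝ⟯} {U : Set M} (hU : IsOpen U)
    (hχ : tsupport χ ⊆ U) {g : M → ℝ} (hg : ContMDiffOn J 𝓘(ℝ, ℝ) ∞ g U) :
    ContMDiff J 𝓘(ℝ, ℝ) ∞ fun x ↦ χ x * g x := by
  refine contMDiff_of_tsupport fun x hx ↦ ?_
  have hxU : x ∈ U := hχ (closure_mono (fun y hy ↦ left_ne_zero_of_mul hy) hx)
  exact χ.contMDiff.contMDiffAt.mul (hg.contMDiffAt (hU.mem_nhds hxU))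

/-- By Hadamard's lemma `f - f m` is, near `m`, a sum of products of functions that both vanish at
`m`, because the differential of `f` vanishes there. A derivation at `m` kills such products. -/
theorem IsPointDerivation.eq_zero {m₀ m : M} {δ : C^∞⟮J, M; ℝ⟯ →ₗ[ℝ] ℝ}
    (hδ : IsPointDerivation J m δ) (hm : m ∈ (extChartAt J m₀).source) {f : C^∞⟮J, M; ℝ⟯}
    (hf : fderiv ℝ (f ∘ (extChartAt J m₀).symm) (extChartAt J m₀ m) = 0) : δ f = 0 := by
  set φ := extChartAt J m₀ with hφ
  have hO : IsOpen φ.target := isOpen_extChartAt_target m₀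
  have hmt : φ m ∈ φ.target := φ.map_source hm
  obtain ⟨ρ, hρ⟩ := exists_contDiffBump_subset (φ m) (hO.mem_nhds hmt)
  obtain ⟨g, hg, hg0, hgK⟩ := exists_hadamard
    (contDiff_bump_smul ρ hO hρ (contDiffOn_comp_symm m₀ f)) (φ m)
  have hloc : (fun z ↦ ρ z • (f ∘ φ.symm) z) =ᶠ[𝓝 (φ m)] f ∘ φ.symm := by
    filter_upwards [ρ.eventuallyEq_one] with z hz
    rw [hz]; simp
  rw [hloc.fderiv_eq, hf] at hg0
  have hsrc : IsOpen φ.source := isOpen_extChartAt_source m₀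
  have hcont : ContinuousOn φ φ.source := continuousOn_extChartAt m₀
  have hev : ∀ᶠ x in 𝓝 m, x ∈ φ.source ∧ f x = f m + g (φ x) (φ x - φ m) := by
    have h1 := (hcont.continuousAt (hsrc.mem_nhds hm)).eventually hloc
    filter_upwards [h1, hsrc.mem_nhds hm] with x hx hxs
    refine ⟨hxs, ?_⟩
    have h2 := hgK (φ x)
    rw [hx, hloc.eq_of_nhds] at h2
    simpa only [Function.comp_apply, φ.left_inv hxs, φ.left_inv hm] using h2
  obtain ⟨χ, hχs, hχ1⟩ := exists_smooth_extension (J := J) hev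
  have hχm : χ m = 1 := hχ1.eq_of_nhds
  have hφs : ContMDiffOn J 𝓘(ℝ, EM) ∞ φ φ.source := by
    rw [hφ, extChartAt_source]; exact contMDiffOn_extChartAt
  let b := Module.finBasis ℝ EM
  have hχs' : tsupport χ ⊆ φ.source := fun x hx ↦ (hχs hx).1
  let A : Fin (Module.finrank ℝ EM) → C^∞⟮J, M; ℝ⟯ := fun i ↦
    ⟨fun x ↦ χ x * b.coord i (φ x - φ m), contMDiff_smul_of_tsupport hsrc hχs'
      (((LinearMap.toContinuousLinearMap (b.coord i)).contDiff.contMDiff).comp_contMDiffOn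
        (hφs.sub contMDiffOn_const))⟩
  let B : Fin (Module.finrank ℝ EM) → C^∞⟮J, M; ℝ⟯ := fun i ↦
    ⟨fun x ↦ χ x * g (φ x) (b i), contMDiff_smul_of_tsupport hsrc hχs'
      (((hg.clm_apply contDiff_const).contMDiff).comp_contMDiffOn hφs)⟩
  -- The cutoff enters squared so that both factors of each product `A i * B i` are globally defined
  -- smooth functions.
  have hid : f * (χ * χ) = f m • (χ * χ) + ∑ i, A i * B i := by
    ext x
    have hsum : (∑ i, A i * B i) x = ∑ i, A i x * B i x := by
      have := map_sum (ContMDiffMap.evalRingHom (I := J) (n := ∞) (R := ℝ) x) (fun i ↦ A i * B i) Finset.univ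
      exact this
    change f x * (χ x * χ x) = f m * (χ x * χ x) + (∑ i, A i * B i) x
    rw [hsum]
    change _ = _ + ∑ i, (χ x * b.coord i (φ x - φ m)) * (χ x * g (φ x) (b i))
    by_cases hx : χ x = 0
    · simp [hx]
    · have h1 := (hχs (subset_tsupport _ hx)).2
      have h2 : g (φ x) (φ x - φ m) = ∑ i, b.coord i (φ x - φ m) * g (φ x) (b i) := by
        conv_lhs => rw [← b.sum_repr (φ x - φ m), map_sum]
        simp [Module.Basis.coord_apply]
      rw [h1, h2, add_mul, Finset.sum_mul]
      congr 1
      exact Finset.sum_congr rfl fun i _ ↦ by ring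
  have h := congrArg δ hid
  rw [hδ.mul, map_add, map_smul, map_sum] at h
  have hz : ∀ i, δ (A i * B i) = 0 := by
    intro i
    have hA : A i m = 0 := by change χ m * b.coord i (φ m - φ m) = 0; simp
    have hB : B i m = 0 := by change χ m * g (φ m) (b i) = 0; simp [hg0]
    rw [hδ.mul, hA, hB, mul_zero, zero_mul, add_zero]
  have hχχ : (χ * χ) m = 1 := by change χ m * χ m = 1; rw [hχm, mul_one]
  simp only [hz, Finset.sum_const_zero, add_zero, hχχ, mul_one, smul_eq_mul] at h
  linarith

theorem IsPointDerivation.eq_sum {ι : Type*} [Fintype ι] (b : Module.Basis ι ℝ EM) {m₀ m : M}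
    {δ : C^∞⟮J, M; ℝ⟯ →ₗ[ℝ] ℝ} (hδ : IsPointDerivation J m δ)
    (hm : m ∈ (extChartAt J m₀).source) {z : ι → C^∞⟮J, M; ℝ⟯}
    (hz : ∀ i, z i =ᶠ[𝓝 m] fun x ↦ b.coord i (extChartAt J m₀ x)) (f : C^∞⟮J, M; ℝ⟯) :
    δ f = ∑ i, fderiv ℝ (f ∘ (extChartAt J m₀).symm) (extChartAt J m₀ m) (b i) * δ (z i) := by
  set φ := extChartAt J m₀ with hφ
  set c : ι → ℝ := fun i ↦ fderiv ℝ (f ∘ φ.symm) (φ m) (b i)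
  have hO : IsOpen φ.target := isOpen_extChartAt_target m₀
  have hmt : φ m ∈ φ.target := φ.map_source hm
  have hdiff : ∀ h : C^∞⟮J, M; ℝ⟯, DifferentiableAt ℝ (h ∘ φ.symm) (φ m) := fun h ↦
    ((contDiffOn_comp_symm m₀ h).contDiffAt (hO.mem_nhds hmt)).differentiableAt (by simp)
  have hzd : ∀ i, fderiv ℝ (z i ∘ φ.symm) (φ m) = LinearMap.toContinuousLinearMap (b.coord i) := by
    intro i
    have h1 : z i ∘ φ.symm =ᶠ[𝓝 (φ m)] LinearMap.toContinuousLinearMap (b.coord i) := by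
      have hcs : Tendsto φ.symm (𝓝 (φ m)) (𝓝 m) := by
        have := (continuousOn_extChartAt_symm (I := J) m₀).continuousAt (hO.mem_nhds hmt)
        rw [ContinuousAt, ← hφ, φ.left_inv hm] at this
        exact this
      filter_upwards [hcs.eventually (hz i), hO.mem_nhds hmt] with y hy hyt
      rw [Function.comp_apply, hy, φ.right_inv hyt]
      rfl
    rw [h1.fderiv_eq, ContinuousLinearMap.fderiv]
  have key := hδ.eq_zero hm (f := f - ∑ i, c i • z i) (by
    have hfun : ((f - ∑ i, c i • z i : C^∞⟮J, M; ℝ⟯) : M → ℝ) ∘ φ.symm =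
        (f ∘ φ.symm) - ∑ i, c i • (z i ∘ φ.symm) := by
      funext y
      have := map_sum (ContMDiffMap.evalRingHom (I := J) (n := ∞) (R := ℝ) (φ.symm y))
        (fun i ↦ c i • z i) Finset.univ
      change f (φ.symm y) - (∑ i, c i • z i : C^∞⟮J, M; ℝ⟯) (φ.symm y) = _
      rw [show (∑ i, c i • z i : C^∞⟮J, M; ℝ⟯) (φ.symm y) = _ from this]
      simp only [Pi.sub_apply, Finset.sum_apply]
      rfl
    rw [hfun, fderiv_sub (hdiff f), fderiv_sum]
    · refine ContinuousLinearMap.ext fun y ↦ ?_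
      simp only [fderiv_const_smul (hdiff (z _)), hzd]
      change fderiv ℝ (f ∘ φ.symm) (φ m) y - _ = 0
      rw [sub_eq_zero]
      conv_lhs => rw [← b.sum_repr y, map_sum]
      change _ = (∑ i, c i • LinearMap.toContinuousLinearMap (b.coord i) : EM →L[ℝ] ℝ) y
      rw [sum_apply]
      refine Finset.sum_congr rfl fun i _ ↦ ?_
      rw [map_smul, smul_eq_mul, mul_comm]
      rfl
    · exact fun i _ ↦ (hdiff (z i)).const_smul _
    · exact DifferentiableAt.sum fun i _ ↦ (hdiff (z i)).const_smul _)
  rw [map_sub, map_sum, sub_eq_zero] at key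
  rw [key]
  exact Finset.sum_congr rfl fun i _ ↦ by rw [map_smul, smul_eq_mul]

end PointDerivation

section TotalSpace

/-- The bump functions used on the total space need it to be Hausdorff. Points of one fibre are
separated in a trivialization, and points of different fibres are separated over the base. -/
theorem t2Space_totalSpace {C F : Type*} [TopologicalSpace C] [T2Space C] [TopologicalSpace F]
    [T2Space F] (E : C → Type*) [TopologicalSpace (TotalSpace F E)] [∀ x, TopologicalSpace (E x)]
    [FiberBundle F E] : T2Space (TotalSpace F E) := by
  refine ⟨fun p q hpq ↦ ?_⟩
  by_cases h : p.proj = q.proj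
  · set e := trivializationAt F E p.proj
    have hp : p ∈ e.source := FiberBundle.mem_trivializationAt_proj_source
    have hq : q ∈ e.source := by
      rw [e.mem_source, ← h]; exact FiberBundle.mem_baseSet_trivializationAt' _
    have hne : e p ≠ e q := fun hh ↦ hpq (e.injOn hp hq hh)
    obtain ⟨U, U', hU, hU', hpU, hqU', hd⟩ := t2_separation hne
    refine ⟨e.source ∩ e ⁻¹' U, e.source ∩ e ⁻¹' U', e.continuousOn.isOpen_inter_preimage e.open_source hU,
      e.continuousOn.isOpen_inter_preimage e.open_source hU', ⟨hp, hpU⟩, ⟨hq, hqU'⟩, ?_⟩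
    exact (hd.preimage e).mono Set.inter_subset_right Set.inter_subset_right
  · obtain ⟨U, U', hU, hU', hpU, hqU', hd⟩ := t2_separation h
    have hc := FiberBundle.continuous_proj F E
    exact ⟨_, _, hU.preimage hc, hU'.preimage hc, hpU, hqU', hd.preimage _⟩

end TotalSpace

end

/-! ### Pairings of bivectors with covectors. -/

section

attribute [local instance] extNormedAddCommGroup extNormedSpace

open Filter Topology

section Pairing

variable {W : Type*} [AddCommGroup W] [Module ℝ W]

theorem pairTwo_eq (ξ : ExteriorAlgebra ℝ W) (u w : Module.Dual ℝ W) :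
    pairTwo ξ u w = ExteriorAlgebra.algebraMapInv (extContract w (extContract u ξ)) := rfl

theorem pairOne_eq (ξ : ExteriorAlgebra ℝ W) (u : Module.Dual ℝ W) :
    pairOne ξ u = ExteriorAlgebra.algebraMapInv (extContract u ξ) := rfl

/-- The pairing of bivectors with a fixed pair of covectors. -/
def pairTwoL (u w : Module.Dual ℝ W) : ExteriorAlgebra ℝ W →ₗ[ℝ] ℝ :=
  ExteriorAlgebra.algebraMapInv.toLinearMap ∘ₗ extContract w ∘ₗ extContract u

theorem pairTwoL_apply (ξ : ExteriorAlgebra ℝ W) (u w : Module.Dual ℝ W) :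
    pairTwoL u w ξ = pairTwo ξ u w := rfl

theorem pairTwo_map {W' : Type*} [AddCommGroup W'] [Module ℝ W'] (f : W →ₗ[ℝ] W')
    (ξ : ExteriorAlgebra ℝ W) (u w : Module.Dual ℝ W') :
    pairTwo (ExteriorAlgebra.map f ξ) u w = pairTwo ξ (u ∘ₗ f) (w ∘ₗ f) := by
  rw [pairTwo_eq, extContract_map, extContract_map, pairTwo_eq]
  generalize extContract (w ∘ₗ f) (extContract (u ∘ₗ f) ξ) = x
  induction x using ext_induction with
  | h0 r => simp
  | ha x y hx hy => simp only [map_add, hx, hy]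
  | hm v x hx => simp [ExteriorAlgebra.algebraMapInv]

theorem pairOne_map {W' : Type*} [AddCommGroup W'] [Module ℝ W'] (f : W →ₗ[ℝ] W')
    (ξ : ExteriorAlgebra ℝ W) (u : Module.Dual ℝ W') :
    pairOne (ExteriorAlgebra.map f ξ) u = pairOne ξ (u ∘ₗ f) := by
  rw [pairOne_eq, extContract_map, pairOne_eq]
  generalize extContract (u ∘ₗ f) ξ = x
  induction x using ext_induction with
  | h0 r => simp
  | ha x y hx hy => simp only [map_add, hx, hy]
  | hm v x hx => simp [ExteriorAlgebra.algebraMapInv]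

theorem extDeg_two_induction {p : ExteriorAlgebra ℝ W → Prop}
    (ha : ∀ x y, p x → p y → p (x + y))
    (hm : ∀ v w, p (ExteriorAlgebra.ι ℝ v * ExteriorAlgebra.ι ℝ w))
    {x : ExteriorAlgebra ℝ W} (hx : x ∈ extDeg W 2) : p x := by
  have hx' : x ∈ LinearMap.range (ExteriorAlgebra.ι ℝ (M := W)) *
      LinearMap.range (ExteriorAlgebra.ι ℝ (M := W)) := by
    rw [← pow_two]; exact hx
  refine Submodule.mul_induction_on hx' ?_ ha
  rintro _ ⟨v, rfl⟩ _ ⟨w, rfl⟩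
  exact hm v w

theorem pairTwo_add (ξ η : ExteriorAlgebra ℝ W) (u w : Module.Dual ℝ W) :
    pairTwo (ξ + η) u w = pairTwo ξ u w + pairTwo η u w := map_add (pairTwoL u w) ξ η

theorem pairTwo_add_left {ξ : ExteriorAlgebra ℝ W} (u u' w : Module.Dual ℝ W) :
    pairTwo ξ (u + u') w = pairTwo ξ u w + pairTwo ξ u' w := by
  simp only [pairTwo, map_add, LinearMap.add_apply]

theorem pairTwo_add_right {ξ : ExteriorAlgebra ℝ W} (u w w' : Module.Dual ℝ W) :
    pairTwo ξ u (w + w') = pairTwo ξ u w + pairTwo ξ u w' := by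
  simp only [pairTwo, map_add, LinearMap.add_apply]

theorem ι_mul_ι_cyclic (a b c : W) :
    ExteriorAlgebra.ι ℝ a * (ExteriorAlgebra.ι ℝ b * ExteriorAlgebra.ι ℝ c) =
      ExteriorAlgebra.ι ℝ b * (ExteriorAlgebra.ι ℝ c * ExteriorAlgebra.ι ℝ a) := by
  have h : ExteriorAlgebra.ι ℝ c * ExteriorAlgebra.ι ℝ a =
      -(ExteriorAlgebra.ι ℝ a * ExteriorAlgebra.ι ℝ c) :=
    eq_neg_of_add_eq_zero_left (ExteriorAlgebra.ι_add_mul_swap c a)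
  have h' : ExteriorAlgebra.ι ℝ b * ExteriorAlgebra.ι ℝ a =
      -(ExteriorAlgebra.ι ℝ a * ExteriorAlgebra.ι ℝ b) :=
    eq_neg_of_add_eq_zero_left (ExteriorAlgebra.ι_add_mul_swap b a)
  rw [h, mul_neg, ← mul_assoc, ← mul_assoc, h', neg_mul, neg_neg]

/-- The triple product is invariant under cyclic rotation, so the sums with rotated coefficients are
equal. Their total is zero, and it is three times the given sum. -/
theorem sum_cyclic_eq_zero {ι : Type*} [Fintype ι] (b : ι → W) {T : ι → ι → ι → ℝ}
    (hT : ∀ i j k, T i j k + T j k i + T k i j = 0) :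
    ∑ i, ∑ j, ∑ k, T i j k • (ExteriorAlgebra.ι ℝ (b i) *
      (ExteriorAlgebra.ι ℝ (b j) * ExteriorAlgebra.ι ℝ (b k))) = 0 := by
  set ε := fun i j k ↦ ExteriorAlgebra.ι ℝ (b i) *
      (ExteriorAlgebra.ι ℝ (b j) * ExteriorAlgebra.ι ℝ (b k)) with hε
  have hcyc : ∀ i j k, ε i j k = ε j k i := fun i j k ↦ ι_mul_ι_cyclic _ _ _
  have hrot : ∀ G : ι → ι → ι → ExteriorAlgebra ℝ W,
      ∑ i, ∑ j, ∑ k, G j k i = ∑ i, ∑ j, ∑ k, G i j k := fun G ↦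
    Finset.sum_comm.trans (Finset.sum_congr rfl fun _ _ ↦ Finset.sum_comm)
  have h1 : ∑ i, ∑ j, ∑ k, T j k i • ε i j k = ∑ i, ∑ j, ∑ k, T i j k • ε i j k := by
    rw [← hrot fun i j k ↦ T i j k • ε i j k]
    simp only [← hcyc]
  have h2 : ∑ i, ∑ j, ∑ k, T k i j • ε i j k = ∑ i, ∑ j, ∑ k, T j k i • ε i j k := by
    rw [← hrot fun i j k ↦ T j k i • ε i j k]
    simp only [← hcyc]
  have h3 : ∑ i, ∑ j, ∑ k, T i j k • ε i j k + ∑ i, ∑ j, ∑ k, T j k i • ε i j k +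
      ∑ i, ∑ j, ∑ k, T k i j • ε i j k = 0 := by
    simp only [← Finset.sum_add_distrib, ← add_smul, hT, zero_smul, Finset.sum_const_zero]
  rw [h2, h1] at h3
  have h4 : (3 : ℝ) • ∑ i, ∑ j, ∑ k, T i j k • ε i j k = 0 := by rw [← h3]; module
  exact (smul_eq_zero.1 h4).resolve_left (by norm_num)

end Pairing

/-! ### The bivector field of a Poisson bracket and its Lie derivatives. -/

section Bivector

universe u
variable {EM : Type u} [NormedAddCommGroup EM] [NormedSpace ℝ EM] [FiniteDimensional ℝ EM]
  {HM : Type*} [TopologicalSpace HM] {J : ModelWithCorners ℝ EM HM} [J.Boundaryless]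
  {M : Type*} [TopologicalSpace M] [T2Space M] [ChartedSpace HM M] [IsManifold J ∞ M]

/-- The polyvector field `K` on `O` represents the bidifferential operation `B`. -/
def Represents (m₀ : M) (O : Set EM) (K : EM → ExteriorAlgebra ℝ EM)
    (B : C^∞⟮J, M; ℝ⟯ → C^∞⟮J, M; ℝ⟯ → C^∞⟮J, M; ℝ⟯) : Prop :=
  ∀ z ∈ O, ∀ f g : C^∞⟮J, M; ℝ⟯, B f g ((extChartAt J m₀).symm z) =
    pairTwo (K z) (fderiv ℝ (f ∘ (extChartAt J m₀).symm) z : EM →L[ℝ] ℝ)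
      (fderiv ℝ (g ∘ (extChartAt J m₀).symm) z : EM →L[ℝ] ℝ)

/-- Evaluation at a point. -/
def evalPt (m : M) : C^∞⟮J, M; ℝ⟯ →ₗ[ℝ] ℝ where
  toFun f := f m
  map_add' _ _ := rfl
  map_smul' _ _ := rfl

theorem PoissonBracket.isPointDerivation (P : PoissonBracket ℝ C^∞⟮J, M; ℝ⟯) (f : C^∞⟮J, M; ℝ⟯)
    (m : M) : IsPointDerivation J m (evalPt m ∘ₗ P.bracket f) :=
  ⟨fun g h ↦ congrArg (evalPt m) (P.leibniz f g h)⟩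

variable {ι : Type*} [Fintype ι] (b : Module.Basis ι ℝ EM)

theorem PoissonBracket.apply_eq_sum (P : PoissonBracket ℝ C^∞⟮J, M; ℝ⟯) {m₀ m : M}
    (hm : m ∈ (extChartAt J m₀).source) {z : ι → C^∞⟮J, M; ℝ⟯}
    (hz : ∀ i, z i =ᶠ[𝓝 m] fun x ↦ b.coord i (extChartAt J m₀ x)) (f g : C^∞⟮J, M; ℝ⟯) :
    P.bracket f g m = ∑ i, fderiv ℝ (g ∘ (extChartAt J m₀).symm) (extChartAt J m₀ m) (b i) *
      P.bracket f (z i) m :=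
  (P.isPointDerivation f m).eq_sum b hm hz g

theorem PoissonBracket.skew_apply (P : PoissonBracket ℝ C^∞⟮J, M; ℝ⟯) (f g : C^∞⟮J, M; ℝ⟯) (m : M) :
    P.bracket f g m = -P.bracket g f m := by
  rw [P.skew]; rfl

theorem PoissonBracket.apply_eq_sum_sum (P : PoissonBracket ℝ C^∞⟮J, M; ℝ⟯) {m₀ m : M}
    (hm : m ∈ (extChartAt J m₀).source) {z : ι → C^∞⟮J, M; ℝ⟯}
    (hz : ∀ i, z i =ᶠ[𝓝 m] fun x ↦ b.coord i (extChartAt J m₀ x)) (f g : C^∞⟮J, M; ℝ⟯) :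
    P.bracket f g m = ∑ i, ∑ j, P.bracket (z i) (z j) m *
      (fderiv ℝ (f ∘ (extChartAt J m₀).symm) (extChartAt J m₀ m) (b i) *
        fderiv ℝ (g ∘ (extChartAt J m₀).symm) (extChartAt J m₀ m) (b j)) := by
  rw [P.apply_eq_sum b hm hz, Finset.sum_comm]
  refine Finset.sum_congr rfl fun j _ ↦ ?_
  rw [P.skew_apply, P.apply_eq_sum b hm hz, ← Finset.sum_neg_distrib, Finset.mul_sum]
  refine Finset.sum_congr rfl fun i _ ↦ ?_
  rw [P.skew_apply (z j)]; ring

/-- The bracket accepts only globally defined functions, so the chart coordinates are cut off; on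
`U` they still agree with the true coordinates as germs. -/
theorem exists_coordinates (m₀ : M) : ∃ (z : ι → C^∞⟮J, M; ℝ⟯) (U : Set M), IsOpen U ∧ m₀ ∈ U ∧
    U ⊆ (extChartAt J m₀).source ∧
    ∀ m ∈ U, ∀ i, z i =ᶠ[𝓝 m] fun x ↦ b.coord i (extChartAt J m₀ x) := by
  set φ := extChartAt J m₀
  have hsrc : IsOpen φ.source := isOpen_extChartAt_source m₀
  have hm : m₀ ∈ φ.source := mem_extChartAt_source m₀
  obtain ⟨χ, hχs, hχ1⟩ := exists_smooth_extension (J := J) (hsrc.mem_nhds hm)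
  have hφs : ContMDiffOn J 𝓘(ℝ, EM) ∞ φ φ.source := by
    change ContMDiffOn J 𝓘(ℝ, EM) ∞ (extChartAt J m₀) (extChartAt J m₀).source
    rw [extChartAt_source]; exact contMDiffOn_extChartAt
  obtain ⟨U, hU, hUo, hmU⟩ := eventually_nhds_iff.1 (hχ1.and (hsrc.mem_nhds hm))
  refine ⟨fun i ↦ ⟨fun x ↦ χ x * b.coord i (φ x), contMDiff_smul_of_tsupport hsrc hχs
    ((LinearMap.toContinuousLinearMap (b.coord i)).contDiff.contMDiff.comp_contMDiffOn hφs)⟩,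
    U, hUo, hmU, fun x hx ↦ (hU x hx).2, fun m hmU' i ↦ ?_⟩
  filter_upwards [hUo.mem_nhds hmU'] with x hx
  change χ x * b.coord i (φ x) = _
  rw [(hU x hx).1, Pi.one_apply, one_mul]

/-- A Poisson bracket is given by a bivector field in a chart. -/
theorem PoissonBracket.exists_bivector {X Y : Type*} [Fintype X] [Fintype Y]
    (P : PoissonBracket ℝ C^∞⟮J, M; ℝ⟯) (m₀ : M) (D : FrameData X Y EM EM)
    (b : Module.Basis (X ⊕ Y) ℝ EM) (hDe : ∀ i, D.e i = b i) (hDu : ∀ i, D.u i = b.coord i) :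
    ∃ (H : smoothExt EM EM) (O : Set EM), IsOpen O ∧ extChartAt J m₀ m₀ ∈ O ∧
      O ⊆ (extChartAt J m₀).target ∧ (∀ z, H.1 z ∈ extDeg EM 2) ∧
      Represents m₀ O H.1 (fun f g ↦ P.bracket f g) ∧
      ∀ z ∈ O, ((polyvector D).br H H).1 z = 0 := by
  obtain ⟨x, U, hUo, hmU, hUs, hx⟩ := exists_coordinates (J := J) b m₀
  set φ := extChartAt J m₀ with hφ
  have hto : IsOpen φ.target := isOpen_extChartAt_target m₀
  have hmt : φ m₀ ∈ φ.target := φ.map_source (hUs hmU)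
  have hO₁ : IsOpen (φ.target ∩ φ.symm ⁻¹' U) :=
    (continuousOn_extChartAt_symm m₀).isOpen_inter_preimage hto hUo
  have hmO₁ : φ m₀ ∈ φ.target ∩ φ.symm ⁻¹' U := ⟨hmt, by
    rw [Set.mem_preimage, φ.left_inv (hUs hmU)]; exact hmU⟩
  obtain ⟨ρ, hρ⟩ := exists_contDiffBump_subset (φ m₀) (hto.mem_nhds hmt)
  let B₀ : X ⊕ Y → X ⊕ Y → EM → ℝ := fun i j z ↦ P.bracket (x i) (x j) (φ.symm z)
  have hB : ∀ i j, ContDiffOn ℝ ∞ (B₀ i j) φ.target := fun i j ↦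
    contDiffOn_comp_symm m₀ (P.bracket (x i) (x j))
  have hBs : ∀ i j z, B₀ i j z = -B₀ j i z := fun i j z ↦ P.skew_apply _ _ _
  let c : X ⊕ Y → X ⊕ Y → EM → ℝ := fun i j z ↦ ρ z • B₀ i j z
  have hc : ∀ i j, ContDiff ℝ ∞ (c i j) := fun i j ↦ contDiff_bump_smul ρ hto hρ (hB i j)
  have hcs : ∀ i j z, c i j z = -c j i z := fun i j z ↦ by
    change ρ z * B₀ i j z = -(ρ z * B₀ j i z); rw [hBs]; ring
  let ε : X ⊕ Y → ExteriorAlgebra ℝ EM := fun i ↦ ExteriorAlgebra.ι ℝ (b i)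
  -- The factor `1 / 2` compensates for each pair of indices occurring twice in the double sum.
  let Hf : EM → ExteriorAlgebra ℝ EM := fun z ↦ ∑ i, ∑ j, (1 / 2 * c i j z) • (ε i * ε j)
  have hH : ContDiff ℝ ∞ Hf := ContDiff.sum fun i _ ↦ ContDiff.sum fun j _ ↦
    ContDiff.smul (f := fun z ↦ 1 / 2 * c i j z) (g := fun _ ↦ ε i * ε j)
      (contDiff_const.mul (hc i j)) contDiff_const
  have hdeg : ∀ z, Hf z ∈ extDeg EM 2 := fun z ↦ sum_mem fun i _ ↦ sum_mem fun j _ ↦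
    Submodule.smul_mem _ _ (extDeg_mul_mem (i := 1) (j := 1) (mem_extDeg_one _) (mem_extDeg_one _))
  obtain ⟨O, hO, hOo, hmO⟩ := eventually_nhds_iff.1
    (ρ.eventuallyEq_one.and (hO₁.mem_nhds hmO₁))
  have hcB₀ : ∀ z ∈ O, ∀ i j, c i j =ᶠ[𝓝 z] B₀ i j := by
    intro z hz i j
    filter_upwards [hOo.mem_nhds hz] with y hy
    change ρ y • B₀ i j y = _
    rw [(hO y hy).1, Pi.one_apply, one_smul]
  have hext : ∀ z ∈ O, ∀ f g : C^∞⟮J, M; ℝ⟯, P.bracket f g (φ.symm z) =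
      ∑ i, ∑ j, c i j z * (fderiv ℝ (f ∘ φ.symm) z (b i) * fderiv ℝ (g ∘ φ.symm) z (b j)) := by
    intro z hz f g
    obtain ⟨hzt, hzU⟩ := (hO z hz).2
    have h := P.apply_eq_sum_sum b (m₀ := m₀) (hUs hzU) (hx _ hzU) f g
    rw [← hφ, φ.right_inv hzt] at h
    rw [h]
    refine Finset.sum_congr rfl fun i _ ↦ Finset.sum_congr rfl fun j _ ↦ ?_
    rw [(hcB₀ z hz i j).eq_of_nhds]
  refine ⟨smoothExt.mk Hf hH, O, hOo, hmO, fun z hz ↦ (hO z hz).2.1, hdeg, ?_, ?_⟩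
  · intro z hz f g
    rw [← hφ, hext z hz]
    change _ = pairTwoL _ _ (Hf z)
    simp only [Hf, map_sum, map_smul, pairTwoL_apply, ε, pairTwo_ι_mul_ι, smul_eq_mul, mul_sub,
      Finset.sum_sub_distrib]
    have h1 : ∀ u w : X ⊕ Y → ℝ, ∑ i, ∑ j, 1 / 2 * c i j z * (u j * w i) =
        -∑ i, ∑ j, 1 / 2 * c i j z * (u i * w j) := by
      intro u w
      rw [Finset.sum_comm, ← Finset.sum_neg_distrib]
      refine Finset.sum_congr rfl fun i _ ↦ ?_
      rw [← Finset.sum_neg_distrib]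
      refine Finset.sum_congr rfl fun j _ ↦ ?_
      rw [hcs j i]; ring
    refine Eq.trans ?_ (congrArg (_ - ·) (h1 _ _)).symm
    rw [sub_neg_eq_add, ← two_mul, Finset.mul_sum]
    refine Finset.sum_congr rfl fun i _ ↦ ?_
    rw [Finset.mul_sum]
    refine Finset.sum_congr rfl fun j _ ↦ ?_
    change _ = 2 * (1 / 2 * c i j z * (fderiv ℝ (f ∘ φ.symm) z (b i) * fderiv ℝ (g ∘ φ.symm) z (b j)))
    ring
  · intro z hz
    have hd : ∀ i j, DifferentiableAt ℝ (c i j) z := fun i j ↦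
      (hc i j).differentiable (by simp) z
    have hfd : ∀ v, fderiv ℝ Hf z v =
        ∑ i, ∑ j, (1 / 2 * fderiv ℝ (c i j) z v) • (ε i * ε j) := by
      intro v
      have : HasFDerivAt Hf (∑ i, ∑ j, ((1 / 2 : ℝ) • fderiv ℝ (c i j) z).smulRight (ε i * ε j)) z :=
        HasFDerivAt.fun_sum fun i _ ↦ HasFDerivAt.fun_sum fun j _ ↦
          ((hd i j).hasFDerivAt.const_mul (1 / 2)).smul_const (ε i * ε j)
      rw [this.fderiv]
      simp [sum_apply]
    -- The two positions of `A` contribute equally because `c` is skew, and the factor `1 / 2`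
    -- disappears.
    have hct : ∀ A, extContract (b.coord A) (Hf z) = ∑ j, c A j z • ε j := by
      classical
      intro A
      have h1 : ∀ i j, extContract (b.coord A) (ε i * ε j) =
          (if i = A then (1 : ℝ) else 0) • ε j - (if j = A then (1 : ℝ) else 0) • ε i := by
        intro i j
        rw [extContract_ι_mul, extContract_ι, Module.Basis.coord_apply, Module.Basis.coord_apply,
          b.repr_self, b.repr_self, Finsupp.single_apply, Finsupp.single_apply, ← Algebra.commutes,
          ← Algebra.smul_def]
      simp only [Hf, map_sum, map_smul, h1, smul_sub, Finset.sum_sub_distrib, ite_smul,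
        smul_ite, one_smul, zero_smul, smul_zero]
      have h2 : ∑ i, ∑ j, (if i = A then (1 / 2 * c i j z) • ε j else 0) =
          ∑ j, (1 / 2 * c A j z) • ε j := by
        rw [Finset.sum_eq_single A]
        · simp
        · intro i _ hi; simp [hi]
        · simp
      rw [h2]
      simp only [Finset.sum_ite_eq', Finset.mem_univ, if_true]
      rw [← Finset.sum_sub_distrib]
      refine Finset.sum_congr rfl fun j _ ↦ ?_
      rw [hcs j A, ← sub_smul]; congr 1; ring
    -- Since `P.bracket (x i)` is a derivation, its value on `P.bracket (x j) (x k)` is a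
    -- combination of partial derivatives; the terms of the Schouten square thus become double
    -- Poisson brackets.
    have hT : ∀ i j k, ∑ A, c A i z * fderiv ℝ (c j k) z (b A) =
        -P.bracket (x i) (P.bracket (x j) (x k)) (φ.symm z) := by
      intro i j k
      obtain ⟨hzt, hzU⟩ := (hO z hz).2
      have h := P.apply_eq_sum b (m₀ := m₀) (hUs hzU) (hx _ hzU) (x i) (P.bracket (x j) (x k))
      rw [← hφ, φ.right_inv hzt] at h
      rw [h, ← Finset.sum_neg_distrib]
      refine Finset.sum_congr rfl fun A _ ↦ ?_
      rw [(hcB₀ z hz j k).fderiv_eq, hcs, (hcB₀ z hz i A).eq_of_nhds]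
      change -B₀ i A z * fderiv ℝ (B₀ j k) z (b A) = -(fderiv ℝ (B₀ j k) z (b A) * B₀ i A z)
      ring
    rw [polyvector_br_apply]
    -- The two halves of the Schouten square coincide, as derivatives of `H` are even and its
    -- contractions odd. The resulting factor 2 cancels the `1 / 2` in the derivative of `H`.
    have hterm : ∀ A, extInv (extContract (D.u A) (Hf z)) * fderiv ℝ Hf z (D.e A) -
        fderiv ℝ Hf z (D.e A) * extContract (D.u A) (Hf z) =
        ∑ i, ∑ j, ∑ k, (-(c A i z * fderiv ℝ (c j k) z (b A))) • (ε i * (ε j * ε k)) := by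
      intro A
      rw [hDe, hDu]
      have h1 : extInv (extContract (b.coord A) (Hf z)) = -extContract (b.coord A) (Hf z) := by
        rw [extInv_of_mem (extContract_mem _ (hdeg z)), Int.negOnePow_odd _ (by decide),
          Units.neg_smul, one_smul]
      have h2 : extInv (fderiv ℝ Hf z (b A)) = fderiv ℝ Hf z (b A) := by
        rw [extInv_of_mem (fderiv_mem_submodule (hH.differentiable (by simp) z) hdeg _),
          Int.negOnePow_even _ (by decide), one_smul]
      rw [h1, ext_even_comm h2, hct, hfd, neg_mul, ← neg_add', ← two_smul ℝ, ← smul_neg,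
        Finset.sum_mul, ← Finset.sum_neg_distrib, Finset.smul_sum]
      refine Finset.sum_congr rfl fun i _ ↦ ?_
      rw [Finset.mul_sum, ← Finset.sum_neg_distrib, Finset.smul_sum]
      refine Finset.sum_congr rfl fun j _ ↦ ?_
      rw [Finset.mul_sum, ← Finset.sum_neg_distrib, Finset.smul_sum]
      refine Finset.sum_congr rfl fun k _ ↦ ?_
      rw [smul_mul_smul_comm, ← neg_smul, smul_smul]
      congr 1; ring
    change ∑ A, (extInv (extContract (D.u A) (Hf z)) * fderiv ℝ Hf z (D.e A) -
        fderiv ℝ Hf z (D.e A) * extContract (D.u A) (Hf z)) = 0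
    simp only [hterm]
    rw [Finset.sum_comm]
    have hswap : ∑ i, ∑ A, ∑ j, ∑ k, (-(c A i z * fderiv ℝ (c j k) z (b A))) • (ε i * (ε j * ε k)) =
        ∑ i, ∑ j, ∑ k, P.bracket (x i) (P.bracket (x j) (x k)) (φ.symm z) •
          (ε i * (ε j * ε k)) := by
      refine Finset.sum_congr rfl fun i _ ↦ ?_
      rw [Finset.sum_comm]
      refine Finset.sum_congr rfl fun j _ ↦ ?_
      rw [Finset.sum_comm]
      refine Finset.sum_congr rfl fun k _ ↦ ?_
      rw [← Finset.sum_smul, Finset.sum_neg_distrib, hT, neg_neg]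
    -- The coefficients are double brackets of coordinate functions, whose cyclic sums vanish by the
    -- Jacobi identity.
    refine hswap.trans (sum_cyclic_eq_zero b fun i j k ↦ ?_)
    exact congrArg (evalPt (φ.symm z)) (P.jacobi (x i) (x j) (x k))

theorem pairTwo_eq_sum {ι : Type*} [Fintype ι] (b : Module.Basis ι ℝ EM) (ξ : ExteriorAlgebra ℝ EM)
    (u w : Module.Dual ℝ EM) : pairTwo ξ u w =
      ∑ i, ∑ j, u (b i) * w (b j) * pairTwoL (b.coord i) (b.coord j) ξ := by
  have h : ∀ u : Module.Dual ℝ EM, u = ∑ i, u (b i) • b.coord i := fun u ↦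
    b.ext fun j ↦ by simp
  conv_lhs => rw [h u, h w]
  simp only [pairTwo, map_sum, map_smul, LinearMap.sum_apply, LinearMap.smul_apply, smul_eq_mul,
    Finset.mul_sum]
  refine Finset.sum_congr rfl fun i _ ↦ Finset.sum_congr rfl fun j _ ↦ ?_
  rw [pairTwoL_apply, pairTwo]; ring

/-- Up to sign the left side is the derivation extension of `A` to `∧²`, and the right side is its
transpose acting on covectors. It suffices to compare them on `p ∧ q`. -/
theorem pairTwo_sum_contract_mul {ι : Type*} [Fintype ι] (b : Module.Basis ι ℝ EM)
    (A : EM →ₗ[ℝ] EM) {ξ : ExteriorAlgebra ℝ EM} (hξ : ξ ∈ extDeg EM 2) (u w : Module.Dual ℝ EM) :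
    pairTwo (∑ i, extContract (b.coord i) ξ * ExteriorAlgebra.ι ℝ (A (b i))) u w =
      -(pairTwo ξ (u ∘ₗ A) w + pairTwo ξ u (w ∘ₗ A)) := by
  refine extDeg_two_induction (p := fun ξ ↦ pairTwo (∑ i, extContract (b.coord i) ξ *
    ExteriorAlgebra.ι ℝ (A (b i))) u w = -(pairTwo ξ (u ∘ₗ A) w + pairTwo ξ u (w ∘ₗ A)))
    (fun x y hx hy ↦ ?_) (fun p q ↦ ?_) hξ
  · simp only [map_add, add_mul, Finset.sum_add_distrib, pairTwo_add, hx, hy]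
    ring
  · have h1 : ∑ i, extContract (b.coord i) (ExteriorAlgebra.ι ℝ p * ExteriorAlgebra.ι ℝ q) *
        ExteriorAlgebra.ι ℝ (A (b i)) =
        ExteriorAlgebra.ι ℝ q * ExteriorAlgebra.ι ℝ (A p) -
          ExteriorAlgebra.ι ℝ p * ExteriorAlgebra.ι ℝ (A q) := by
      have h2 : ∀ x, ExteriorAlgebra.ι ℝ (A x) = ∑ i, b.coord i x • ExteriorAlgebra.ι ℝ (A (b i)) := by
        intro x
        conv_lhs => rw [← b.sum_repr x, map_sum, map_sum]
        simp [Module.Basis.coord_apply]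
      rw [h2 p, h2 q, Finset.mul_sum, Finset.mul_sum, ← Finset.sum_sub_distrib]
      refine Finset.sum_congr rfl fun i _ ↦ ?_
      rw [extContract_ι_mul, extContract_ι, ← Algebra.commutes, ← Algebra.smul_def, sub_mul,
        smul_mul_assoc, smul_mul_assoc, mul_smul_comm, mul_smul_comm]
    have h3 : ExteriorAlgebra.ι ℝ q * ExteriorAlgebra.ι ℝ (A p) -
        ExteriorAlgebra.ι ℝ p * ExteriorAlgebra.ι ℝ (A q) = ExteriorAlgebra.ι ℝ q *
          ExteriorAlgebra.ι ℝ (A p) + ExteriorAlgebra.ι ℝ (-p) * ExteriorAlgebra.ι ℝ (A q) := by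
      rw [map_neg, neg_mul, sub_eq_add_neg]
    rw [h1, h3, pairTwo_add]
    simp only [pairTwo_ι_mul_ι, LinearMap.comp_apply]
    simp only [map_neg]
    ring

/-- The Lie derivative of a bidifferential operation along the vector field represented by `a`. -/
theorem Represents.lie {X Y : Type*} [Fintype X] [Fintype Y] {m₀ : M} {D : FrameData X Y EM EM}
    (b : Module.Basis (X ⊕ Y) ℝ EM) (hDe : ∀ i, D.e i = b i) (hDu : ∀ i, D.u i = b.coord i)
    {O : Set EM} (hO : IsOpen O) (hOt : O ⊆ (extChartAt J m₀).target)
    {K a : smoothExt EM EM} (hK : ∀ z, K.1 z ∈ extDeg EM 2)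
    {B : C^∞⟮J, M; ℝ⟯ → C^∞⟮J, M; ℝ⟯ → C^∞⟮J, M; ℝ⟯} (hB : Represents m₀ O K.1 B)
    {v : EM → EM} (ha : ∀ z ∈ O, a.1 z = ExteriorAlgebra.ι ℝ (v z)) (hv : ContDiffOn ℝ ∞ v O)
    {δ : C^∞⟮J, M; ℝ⟯ → C^∞⟮J, M; ℝ⟯}
    (hδ : ∀ z ∈ O, ∀ f : C^∞⟮J, M; ℝ⟯, δ f ((extChartAt J m₀).symm z) =
      fderiv ℝ (f ∘ (extChartAt J m₀).symm) z (v z)) :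
    Represents m₀ O (-(polyvector D).tau a K).1
      (fun f g ↦ δ (B f g) - B (δ f) g - B f (δ g)) := by
  intro z hz f g
  set φ := extChartAt J m₀
  have hvz : HasFDerivAt v (fderiv ℝ v z) z :=
    ((hv.contDiffAt (hO.mem_nhds hz)).differentiableAt (by simp)).hasFDerivAt
  have hsm : ∀ f : C^∞⟮J, M; ℝ⟯, ContDiffAt ℝ ∞ (f ∘ φ.symm) z := fun f ↦
    ((contDiffOn_comp_symm m₀ f).mono hOt).contDiffAt (hO.mem_nhds hz)
  have hsm2 : ∀ f : C^∞⟮J, M; ℝ⟯, DifferentiableAt ℝ (fderiv ℝ (f ∘ φ.symm)) z := fun f ↦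
    ((hsm f).fderiv_right (m := 1) (by norm_cast)).differentiableAt (by simp)
  -- The part with second derivatives of `f` will cancel against the corresponding term of `B f g`
  -- differentiated along `v`. Only the part with the derivative of `v` survives.
  have hδf : ∀ f : C^∞⟮J, M; ℝ⟯, (fderiv ℝ (δ f ∘ φ.symm) z : EM →ₗ[ℝ] ℝ) =
      (fderiv ℝ (fderiv ℝ (f ∘ φ.symm)) z (v z) : EM →ₗ[ℝ] ℝ) +
        (fderiv ℝ (f ∘ φ.symm) z : EM →ₗ[ℝ] ℝ) ∘ₗ (fderiv ℝ v z : EM →ₗ[ℝ] EM) := by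
    intro f
    have h1 : δ f ∘ φ.symm =ᶠ[𝓝 z] fun y ↦ fderiv ℝ (f ∘ φ.symm) y (v y) := by
      filter_upwards [hO.mem_nhds hz] with y hy using hδ y hy f
    ext w
    have h2 := ((hsm2 f).hasFDerivAt.clm_apply hvz).fderiv
    have h3 : fderiv ℝ (fderiv ℝ (f ∘ φ.symm)) z w (v z) =
        fderiv ℝ (fderiv ℝ (f ∘ φ.symm)) z (v z) w :=
      ((hsm f).isSymmSndFDerivAt
        (by simpa using (WithTop.coe_le_coe.2 le_top : ((2 : ℕ∞) : WithTop ℕ∞) ≤ ∞))).eq _ _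
    change fderiv ℝ (δ f ∘ φ.symm) z w = fderiv ℝ (fderiv ℝ (f ∘ φ.symm)) z (v z) w +
      fderiv ℝ (f ∘ φ.symm) z (fderiv ℝ v z w)
    rw [h1.fderiv_eq, h2, ← h3]
    simp [add_comm]
  have hBfg : fderiv ℝ (B f g ∘ φ.symm) z (v z) =
      pairTwo (fderiv ℝ K.1 z (v z)) (fderiv ℝ (f ∘ φ.symm) z : EM →L[ℝ] ℝ)
        (fderiv ℝ (g ∘ φ.symm) z : EM →L[ℝ] ℝ) +
      pairTwo (K.1 z) (fderiv ℝ (fderiv ℝ (f ∘ φ.symm)) z (v z) : EM →L[ℝ] ℝ)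
        (fderiv ℝ (g ∘ φ.symm) z : EM →L[ℝ] ℝ) +
      pairTwo (K.1 z) (fderiv ℝ (f ∘ φ.symm) z : EM →L[ℝ] ℝ)
        (fderiv ℝ (fderiv ℝ (g ∘ φ.symm)) z (v z) : EM →L[ℝ] ℝ) := by
    have h1 : B f g ∘ φ.symm =ᶠ[𝓝 z] fun y ↦ ∑ i, ∑ j, fderiv ℝ (f ∘ φ.symm) y (b i) *
        fderiv ℝ (g ∘ φ.symm) y (b j) * pairTwoL (b.coord i) (b.coord j) (K.1 y) := by
      filter_upwards [hO.mem_nhds hz] with y hy using (hB y hy f g).trans (pairTwo_eq_sum b _ _ _)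
    have hdf : ∀ (f : C^∞⟮J, M; ℝ⟯) (w : EM), HasFDerivAt (fun y ↦ fderiv ℝ (f ∘ φ.symm) y w)
        ((fderiv ℝ (fderiv ℝ (f ∘ φ.symm)) z).flip w) z := fun f w ↦ by
      simpa using (hsm2 f).hasFDerivAt.clm_apply (hasFDerivAt_const w z)
    have h2 := (HasFDerivAt.fun_sum fun i (_ : i ∈ Finset.univ) ↦ HasFDerivAt.fun_sum
      fun j (_ : j ∈ Finset.univ) ↦ ((hdf f (b i)).fun_mul (hdf g (b j))).fun_mul
        (((LinearMap.toContinuousLinearMap (pairTwoL (b.coord i) (b.coord j))).hasFDerivAt.comp z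
          (smoothExt.differentiableAt K z).hasFDerivAt))).fderiv
    rw [h1.fderiv_eq]
    refine (congrArg (fun L : EM →L[ℝ] ℝ ↦ L (v z)) h2).trans ?_
    simp only [pairTwo_eq_sum b, ← Finset.sum_add_distrib, sum_apply]
    refine Finset.sum_congr rfl fun i _ ↦ Finset.sum_congr rfl fun j _ ↦ ?_
    simp
    ring
  -- This is the coordinate formula for the Lie derivative of a bivector field: its derivative along
  -- `v`, and the action of the derivative of `v` on its two slots.
  have htau : -((polyvector D).tau a K).1 z = fderiv ℝ K.1 z (v z) +
      ∑ i, extContract (b.coord i) (K.1 z) * ExteriorAlgebra.ι ℝ (fderiv ℝ v z (b i)) := by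
    have h1 : ∀ w, fderiv ℝ a.1 z w = ExteriorAlgebra.ι ℝ (fderiv ℝ v z w) := by
      intro w
      have h2 : a.1 =ᶠ[𝓝 z] fun y ↦ LinearMap.toContinuousLinearMap (ExteriorAlgebra.ι ℝ) (v y) := by
        filter_upwards [hO.mem_nhds hz] with y hy using ha y hy
      rw [h2.fderiv_eq]
      have := (((LinearMap.toContinuousLinearMap (ExteriorAlgebra.ι ℝ (M := EM))).hasFDerivAt).comp
        z hvz).fderiv
      exact congrArg (fun L : EM →L[ℝ] ExteriorAlgebra ℝ EM ↦ L w) this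
    have h3 : fderiv ℝ K.1 z (v z) = ∑ i, fderiv ℝ K.1 z (b i) *
        algebraMap ℝ (ExteriorAlgebra ℝ EM) (b.coord i (v z)) := by
      conv_lhs => rw [← b.sum_repr (v z), map_sum]
      refine Finset.sum_congr rfl fun i _ ↦ ?_
      rw [← Algebra.commutes, ← Algebra.smul_def, map_smul]; rfl
    rw [polyvector_tau_apply, h3, ← Finset.sum_add_distrib, ← Finset.sum_neg_distrib]
    refine Finset.sum_congr rfl fun i _ ↦ ?_
    rw [hDe, hDu, ha z hz, extContract_ι, h1,
      extInv_of_mem (fderiv_mem_submodule (smoothExt.differentiableAt K z) hK _),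
      Int.negOnePow_even _ (by decide), one_smul]
    abel
  have hcon : ∀ u w : Module.Dual ℝ EM, pairTwo (∑ i, extContract (b.coord i) (K.1 z) *
      ExteriorAlgebra.ι ℝ (fderiv ℝ v z (b i))) u w =
      -(pairTwo (K.1 z) (u ∘ₗ (fderiv ℝ v z : EM →ₗ[ℝ] EM)) w +
        pairTwo (K.1 z) u (w ∘ₗ (fderiv ℝ v z : EM →ₗ[ℝ] EM))) := by
    exact fun u w ↦ pairTwo_sum_contract_mul b _ (hK z) u w
  change δ (B f g) (φ.symm z) - B (δ f) g (φ.symm z) - B f (δ g) (φ.symm z) =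
    pairTwo (-((polyvector D).tau a K).1 z) _ _
  rw [hδ z hz, hB z hz, hB z hz, hBfg, htau, pairTwo_add, hcon, hδf, hδf, pairTwo_add_left,
    pairTwo_add_right]
  ring

end Bivector

end

/-! ### Local structure of sections of the exterior bundle. -/

section

open Filter Topology

section Sections

variable {EB : Type*} [NormedAddCommGroup EB] [NormedSpace ℝ EB] [FiniteDimensional ℝ EB]
  {HB : Type*} [TopologicalSpace HB] {I : ModelWithCorners ℝ EB HB} [I.Boundaryless]
  {C : Type*} [TopologicalSpace C] [T2Space C] [ChartedSpace HB C] [IsManifold I ∞ C]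

section exists_section
variable {F : Type*} [NormedAddCommGroup F] [NormedSpace ℝ F]
  {E : C → Type*} [∀ x, AddCommGroup (E x)] [∀ x, Module ℝ (E x)]
  [TopologicalSpace (TotalSpace F E)] [∀ x, TopologicalSpace (E x)]
  [FiberBundle F E] [VectorBundle ℝ F E] [ContMDiffVectorBundle ∞ F E I]

theorem exists_section_eventuallyEq (x₀ : C) (w : F) : ∃ v : Cₛ^∞⟮I; F, E⟯,
    ∀ᶠ x in 𝓝 x₀, v x = (trivializationAt F E x₀).symmₗ ℝ x w := by
  set T := trivializationAt F E x₀
  have hx₀ : x₀ ∈ T.baseSet := FiberBundle.mem_baseSet_trivializationAt' x₀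
  obtain ⟨χ, hχ, hχ1⟩ := exists_smooth_extension (J := I) (T.open_baseSet.mem_nhds hx₀)
  have h : ContMDiffOn I (I.prod 𝓘(ℝ, F)) ∞ (fun x ↦ TotalSpace.mk' F x (T.symmₗ ℝ x w)) T.baseSet :=
    (T.contMDiffOn_section_baseSet_iff (IB := I) (n := ∞)).2
      ((contMDiffOn_const (c := w)).congr fun x hx ↦ by
        rw [T.symmₗ_apply hx, T.apply_mk_symm hx])
  refine ⟨⟨fun x ↦ χ x • T.symmₗ ℝ x w,
    ContMDiffOn.smul_section_of_tsupport χ.contMDiff.contMDiffOn T.open_baseSet hχ h⟩, ?_⟩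
  filter_upwards [hχ1] with x hx
  change χ x • T.symmₗ ℝ x w = _
  rw [hx, Pi.one_apply, one_smul]

theorem exists_section_eq (x₀ : C) (w : E x₀) : ∃ v : Cₛ^∞⟮I; F, E⟯, v x₀ = w := by
  have hx₀ := FiberBundle.mem_baseSet_trivializationAt' (F := F) (E := E) x₀
  obtain ⟨v, hv⟩ := exists_section_eventuallyEq (I := I) (E := E) x₀
    ((trivializationAt F E x₀).linearMapAt ℝ x₀ w)
  exact ⟨v, by rw [hv.self_of_nhds, Trivialization.symmₗ_linearMapAt _ hx₀]⟩

end exists_section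

variable {F : Type*} [NormedAddCommGroup F] [NormedSpace ℝ F] [FiniteDimensional ℝ F]
  {E : C → Type*} [∀ x, AddCommGroup (E x)] [∀ x, Module ℝ (E x)]
  [TopologicalSpace (TotalSpace F E)] [∀ x, TopologicalSpace (E x)]
  [FiberBundle F E] [VectorBundle ℝ F E]

variable (F E) in
/-- The exterior algebra of a fibre in the preferred trivialization. -/
def extTriv (x₀ x : C) : ExteriorAlgebra ℝ (E x) →ₐ[ℝ] ExteriorAlgebra ℝ F :=
  ExteriorAlgebra.map ((trivializationAt F E x₀).linearMapAt ℝ x)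

variable (F E) in
/-- The inverse of `extTriv`. -/
def extTrivSymm (x₀ x : C) : ExteriorAlgebra ℝ F →ₐ[ℝ] ExteriorAlgebra ℝ (E x) :=
  ExteriorAlgebra.map ((trivializationAt F E x₀).symmₗ ℝ x)

theorem extTrivSymm_extTriv {x₀ x : C} (hx : x ∈ (trivializationAt F E x₀).baseSet)
    (a : ExteriorAlgebra ℝ (E x)) : extTrivSymm F E x₀ x (extTriv F E x₀ x a) = a := by
  rw [extTrivSymm, extTriv, map_map_apply]
  have : (trivializationAt F E x₀).symmₗ ℝ x ∘ₗ (trivializationAt F E x₀).linearMapAt ℝ x =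
      LinearMap.id := LinearMap.ext fun y ↦ Trivialization.symmₗ_linearMapAt _ hx y
  rw [this, ExteriorAlgebra.map_id, AlgHom.id_apply]

theorem extTriv_extTrivSymm {x₀ x : C} (hx : x ∈ (trivializationAt F E x₀).baseSet)
    (a : ExteriorAlgebra ℝ F) : extTriv F E x₀ x (extTrivSymm F E x₀ x a) = a := by
  rw [extTrivSymm, extTriv, map_map_apply]
  have : (trivializationAt F E x₀).linearMapAt ℝ x ∘ₗ (trivializationAt F E x₀).symmₗ ℝ x =
      LinearMap.id := LinearMap.ext fun y ↦ Trivialization.linearMapAt_symmₗ _ hx y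
  rw [this, ExteriorAlgebra.map_id, AlgHom.id_apply]

theorem mem_baseSet_nhds (x₀ : C) : (trivializationAt F E x₀).baseSet ∈ 𝓝 x₀ :=
  (trivializationAt F E x₀).open_baseSet.mem_nhds (FiberBundle.mem_baseSet_trivializationAt' x₀)

/-- Smoothness of a section of the exterior bundle is a local property. -/
theorem mem_extSections_of_locally {s : ∀ x, ExteriorAlgebra ℝ (E x)}
    (h : ∀ x₀, ∃ t : extSections I F E, ∀ᶠ x in 𝓝 x₀, s x = t.1 x) : s ∈ extSections I F E := by
  intro x₀ ℓ x hx
  obtain ⟨t, ht⟩ := h x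
  have h1 := (t.2 x₀ ℓ).contMDiffAt ((trivializationAt F E x₀).open_baseSet.mem_nhds hx)
  refine (h1.congr_of_eventuallyEq ?_).contMDiffWithinAt
  filter_upwards [ht] with y hy
  rw [hy]

variable (I F E) in
/-- Evaluation of sections at a point. -/
def evalSection (x : C) : extSections I F E →ₐ[ℝ] ExteriorAlgebra ℝ (E x) :=
  (Pi.evalAlgHom ℝ (fun x ↦ ExteriorAlgebra ℝ (E x)) x).comp (extSections I F E).val

theorem evalSection_apply (x : C) (s : extSections I F E) : evalSection I F E x s = s.1 x := rfl

theorem fnSection_one : (fnSection 1 : extSections I F E) = 1 := by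
  ext x; exact map_one _

theorem fnSection_mem (f : C^∞⟮I, C; ℝ⟯) : fnSection f ∈ extSectionsDeg I F E 0 :=
  fun x ↦ algebraMap_mem_extDeg (W := E x) (f x)

variable [ContMDiffVectorBundle ∞ F E I]

theorem vecSection_mem (v : Cₛ^∞⟮I; F, E⟯) : vecSection v ∈ extSectionsDeg I F E 1 :=
  fun x ↦ mem_extDeg_one (W := E x) (v x)

variable (I F E) in
/-- Functions on the base and sections of the bundle. -/
def sectionGenerators : Set (extSections I F E) := Set.range fnSection ∪ Set.range vecSection

/-- Locally, a section of the exterior bundle is a polynomial in functions and sections. -/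
theorem exists_mem_adjoin (x₀ : C) {U : Set C} (hU : U ∈ 𝓝 x₀) {K : C → ExteriorAlgebra ℝ F}
    (hK : ∀ ℓ : ExteriorAlgebra ℝ F →ₗ[ℝ] ℝ, ContMDiffOn I 𝓘(ℝ, ℝ) ∞ (fun x ↦ ℓ (K x)) U) :
    ∃ t ∈ Algebra.adjoin ℝ (sectionGenerators I F E),
      ∀ᶠ x in 𝓝 x₀, t.1 x = extTrivSymm F E x₀ x (K x) := by
  -- Constant elements of `∧F` come first, by induction on products of generators. A general section
  -- is then a combination of a basis with cut-off coefficient functions.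
  have h1 : ∀ w : ExteriorAlgebra ℝ F, ∃ t ∈ Algebra.adjoin ℝ (sectionGenerators I F E),
      ∀ᶠ x in 𝓝 x₀, t.1 x = extTrivSymm F E x₀ x w := by
    intro w
    induction w using ext_induction with
    | h0 r => exact ⟨algebraMap ℝ _ r, Subalgebra.algebraMap_mem _ r, Eventually.of_forall fun x ↦
        ((extTrivSymm F E x₀ x).commutes r).symm⟩
    | ha w w' h h' =>
      obtain ⟨t, ht, hw⟩ := h
      obtain ⟨t', ht', hw'⟩ := h'
      refine ⟨t + t', add_mem ht ht', ?_⟩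
      filter_upwards [hw, hw'] with x h1 h2
      rw [map_add, ← h1, ← h2]; rfl
    | hm v w h =>
      obtain ⟨t, ht, hw⟩ := h
      obtain ⟨s, hs⟩ := exists_section_eventuallyEq (I := I) (E := E) x₀ v
      refine ⟨vecSection s * t,
        mul_mem (Algebra.subset_adjoin (Set.mem_union_right _ ⟨s, rfl⟩)) ht, ?_⟩
      filter_upwards [hw, hs] with x h1 h2
      rw [map_mul, ← h1, extTrivSymm, ExteriorAlgebra.map_apply_ι, ← h2]; rfl
  choose t ht hte using h1
  obtain ⟨χ, hχ, hχ1⟩ := exists_smooth_extension (J := I) (interior_mem_nhds.2 hU)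
  let b := Module.finBasis ℝ (ExteriorAlgebra ℝ F)
  let c : Fin (Module.finrank ℝ (ExteriorAlgebra ℝ F)) → C^∞⟮I, C; ℝ⟯ := fun i ↦
    ⟨fun x ↦ χ x * b.coord i (K x), contMDiff_smul_of_tsupport isOpen_interior hχ
      ((hK (b.coord i)).mono interior_subset)⟩
  refine ⟨∑ i, fnSection (c i) * t (b i), sum_mem fun i _ ↦
    mul_mem (Algebra.subset_adjoin (Set.mem_union_left _ ⟨_, rfl⟩)) (ht _), ?_⟩
  filter_upwards [hχ1, Filter.eventually_all.2 fun i ↦ hte (b i)] with x hx hx'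
  rw [← evalSection_apply, map_sum]
  conv_rhs => rw [← b.sum_repr (K x), map_sum]
  refine Finset.sum_congr rfl fun i _ ↦ ?_
  rw [map_mul, evalSection_apply, evalSection_apply, hx', map_smul, Algebra.smul_def]
  change algebraMap ℝ _ (χ x * b.coord i (K x)) * _ = _
  rw [hx, Pi.one_apply, one_mul]; rfl

theorem exists_mem_adjoin_eventuallyEq (x₀ : C) (a : extSections I F E) :
    ∃ t ∈ Algebra.adjoin ℝ (sectionGenerators I F E), ∀ᶠ x in 𝓝 x₀, t.1 x = a.1 x := by
  obtain ⟨t, ht, h⟩ := exists_mem_adjoin (I := I) (E := E) x₀ (mem_baseSet_nhds (F := F) (E := E) x₀)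
    (K := fun x ↦ extTriv F E x₀ x (a.1 x)) fun ℓ ↦ a.2 x₀ ℓ
  refine ⟨t, ht, ?_⟩
  filter_upwards [h, mem_baseSet_nhds (F := F) (E := E) x₀] with x hx hxb
  rw [hx, extTrivSymm_extTriv hxb]

end Sections

section Nondegenerate

variable {W : Type*} [AddCommGroup W] [Module ℝ W]

theorem eq_zero_of_pairOne [FiniteDimensional ℝ W] {ξ : ExteriorAlgebra ℝ W} (hξ : ξ ∈ extDeg W 1)
    (h : ∀ u : Module.Dual ℝ W, pairOne ξ u = 0) : ξ = 0 := by
  change ξ ∈ ⋀[ℝ]^1 W at hξ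
  rw [ExteriorAlgebra.exteriorPower, pow_one] at hξ
  obtain ⟨v, rfl⟩ := hξ
  simp only [pairOne_ι] at h
  rw [(Module.forall_dual_apply_eq_zero_iff ℝ v).1 h, map_zero]

/-- A bivector is recovered from its pairings: summing its coordinates against all products of two
basis vectors gives twice the bivector. -/
theorem eq_zero_of_pairTwo [FiniteDimensional ℝ W] {ξ : ExteriorAlgebra ℝ W} (hξ : ξ ∈ extDeg W 2)
    (h : ∀ u w : Module.Dual ℝ W, pairTwo ξ u w = 0) : ξ = 0 := by
  let b := Module.finBasis ℝ W
  have key : ∑ i, ∑ j, pairTwo ξ (b.coord i) (b.coord j) •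
      (ExteriorAlgebra.ι ℝ (b i) * ExteriorAlgebra.ι ℝ (b j)) = (2 : ℝ) • ξ := by
    refine extDeg_two_induction (p := fun ξ ↦ ∑ i, ∑ j, pairTwo ξ (b.coord i) (b.coord j) •
      (ExteriorAlgebra.ι ℝ (b i) * ExteriorAlgebra.ι ℝ (b j)) = (2 : ℝ) • ξ)
      (fun x y hx hy ↦ ?_) (fun p q ↦ ?_) hξ
    · simp only [pairTwo_add, add_smul, Finset.sum_add_distrib, hx, hy, smul_add]
    · have h2 : ∀ x, ExteriorAlgebra.ι ℝ x = ∑ i, b.coord i x • ExteriorAlgebra.ι ℝ (b i) := by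
        intro x
        conv_lhs => rw [← b.sum_repr x, map_sum]
        simp [Module.Basis.coord_apply]
      have h3 : ∀ p q, ∑ i, ∑ j, (b.coord i p * b.coord j q) •
          (ExteriorAlgebra.ι ℝ (b i) * ExteriorAlgebra.ι ℝ (b j)) =
          ExteriorAlgebra.ι ℝ p * ExteriorAlgebra.ι ℝ q := by
        intro p q
        rw [h2 p, h2 q, Finset.sum_mul_sum]
        exact Finset.sum_congr rfl fun i _ ↦ Finset.sum_congr rfl fun j _ ↦
          (smul_mul_smul_comm _ _ _ _).symm
      simp only [pairTwo_ι_mul_ι, sub_smul, Finset.sum_sub_distrib, h3]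
      rw [eq_neg_of_add_eq_zero_left (ExteriorAlgebra.ι_add_mul_swap q p), sub_neg_eq_add, two_smul]
  simp only [h, zero_smul, Finset.sum_const_zero] at key
  exact (smul_eq_zero.1 key.symm).resolve_left two_ne_zero

end Nondegenerate

end

/-! ### Pointwise uniqueness of the brackets. -/

section

open Filter Topology

section Uniqueness

variable {EB : Type*} [NormedAddCommGroup EB] [NormedSpace ℝ EB] [FiniteDimensional ℝ EB]
  {HB : Type*} [TopologicalSpace HB] {I : ModelWithCorners ℝ EB HB} [I.Boundaryless]
  {C : Type*} [TopologicalSpace C] [T2Space C] [ChartedSpace HB C] [IsManifold I ∞ C]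
  {F : Type*} [NormedAddCommGroup F] [NormedSpace ℝ F] [FiniteDimensional ℝ F]
  {E : C → Type*} [∀ x, AddCommGroup (E x)] [∀ x, Module ℝ (E x)]
  [TopologicalSpace (TotalSpace F E)] [∀ x, TopologicalSpace (E x)]
  [FiberBundle F E] [VectorBundle ℝ F E]

/-- Graded skew-symmetric multiderivations with values in the exterior algebra of a fibre. -/
structure IsSkewDerivation (x : C) {n : ℕ} (ν : MultilinearMap ℝ
    (fun _ : Fin (n + 1) ↦ extSections I F E) (ExteriorAlgebra ℝ (E x))) : Prop where
  degree : ∀ (d : Fin (n + 1) → ℤ) (a : Fin (n + 1) → extSections I F E),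
    (∀ i, a i ∈ extSectionsDeg I F E (d i)) → ν a ∈ extDeg (E x) (2 - (n + 1 : ℕ) + ∑ i, d i)
  skew : ∀ (d : Fin (n + 1) → ℤ) (a : Fin (n + 1) → extSections I F E),
    (∀ i, a i ∈ extSectionsDeg I F E (d i)) → ∀ i : Fin n, ν a =
      -((d i.castSucc * d i.succ).negOnePow • ν (a ∘ Equiv.swap i.castSucc i.succ))
  leibniz : ∀ (d : Fin n → ℤ) (a : Fin n → extSections I F E),
    (∀ i, a i ∈ extSectionsDeg I F E (d i)) → ∀ (e : ℤ) (b c : extSections I F E),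
      b ∈ extSectionsDeg I F E e →
      ν (Fin.snoc (α := fun _ ↦ extSections I F E) a (b * c)) =
        ν (Fin.snoc (α := fun _ ↦ extSections I F E) a b) * c.1 x +
          (e * (2 - (n + 1) + ∑ i, d i)).negOnePow •
            (b.1 x * ν (Fin.snoc (α := fun _ ↦ extSections I F E) a c))

variable {x : C} {n : ℕ} {ν ν' : MultilinearMap ℝ
    (fun _ : Fin (n + 1) ↦ extSections I F E) (ExteriorAlgebra ℝ (E x))}

theorem IsSkewDerivation.sub (hν : IsSkewDerivation x ν) (hν' : IsSkewDerivation x ν') :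
    IsSkewDerivation x (ν - ν') where
  degree d a ha := sub_mem (hν.degree d a ha) (hν'.degree d a ha)
  skew d a ha i := by
    simp only [sub_apply]
    rw [hν.skew d a ha i, hν'.skew d a ha i, smul_sub]; abel
  leibniz d a ha e b c hb := by
    simp only [sub_apply]
    rw [hν.leibniz d a ha e b c hb, hν'.leibniz d a ha e b c hb, sub_mul, mul_sub, smul_sub]; abel

/-- Only vanishing is transported, so the signs can be ignored and it is enough to treat adjacent
transpositions. -/
theorem IsSkewDerivation.comp_perm (hν : IsSkewDerivation x ν) (σ : Equiv.Perm (Fin (n + 1))) :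
    ∀ (d : Fin (n + 1) → ℤ) (a : Fin (n + 1) → extSections I F E),
      (∀ i, a i ∈ extSectionsDeg I F E (d i)) → ν a = 0 → ν (a ∘ σ) = 0 := by
  have hσ : σ ∈ Submonoid.closure
      (Set.range fun i : Fin n ↦ Equiv.swap i.castSucc i.succ) := by
    rw [Equiv.Perm.mclosure_swap_castSucc_succ]; trivial
  induction hσ using Submonoid.closure_induction with
  | mem σ h =>
    obtain ⟨i, rfl⟩ := h
    intro d a ha h0
    rw [hν.skew d a ha i, neg_eq_zero, smul_eq_zero_iff_eq] at h0
    exact h0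
  | one => intro d a _ h0; exact h0
  | mul σ τ _ _ hσ hτ =>
    intro d a ha h0
    exact hτ (d ∘ σ) (a ∘ σ) (fun i ↦ ha _) (hσ d a ha h0)

variable [ContMDiffVectorBundle ∞ F E I]

theorem exists_degree {g : extSections I F E} (hg : g ∈ sectionGenerators I F E) :
    ∃ e, g ∈ extSectionsDeg I F E e := by
  rcases hg with ⟨f, rfl⟩ | ⟨v, rfl⟩
  · exact ⟨0, fnSection_mem f⟩
  · exact ⟨1, vecSection_mem v⟩

/-- The Leibniz rule passes from generators to polynomials in them; every section agrees near `x`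
with such a polynomial, and derivations are local. -/
theorem IsSkewDerivation.snoc_eq_zero (hν : IsSkewDerivation x ν) {d : Fin n → ℤ}
    {a : Fin n → extSections I F E} (ha : ∀ i, a i ∈ extSectionsDeg I F E (d i))
    (hg : ∀ g ∈ sectionGenerators I F E, ν (Fin.snoc (α := fun _ ↦ extSections I F E) a g) = 0)
    (c : extSections I F E) : ν (Fin.snoc (α := fun _ ↦ extSections I F E) a c) = 0 := by
  set D : extSections I F E →ₗ[ℝ] ExteriorAlgebra ℝ (E x) := ν.curryRight a with hD
  change D c = 0
  have hleib : ∀ (e : ℤ) (b c : extSections I F E), b ∈ extSectionsDeg I F E e →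
      D (b * c) = D b * c.1 x + (e * (2 - (n + 1) + ∑ i, d i)).negOnePow • (b.1 x * D c) :=
    fun e b c hb ↦ hν.leibniz d a ha e b c hb
  have hg' : ∀ g ∈ sectionGenerators I F E, D g = 0 := hg
  have hadj : ∀ t ∈ Algebra.adjoin ℝ (sectionGenerators I F E), D t = 0 := by
    intro t ht
    rw [← Subalgebra.mem_toSubmodule, Algebra.adjoin_eq_span] at ht
    refine (Submodule.span_le (p := LinearMap.ker D)).2 (fun s hs ↦ ?_) ht
    rw [SetLike.mem_coe, LinearMap.mem_ker]
    induction hs using Submonoid.closure_induction_left with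
    -- The empty product is the constant function one, which is itself a generator.
    | one => rw [← fnSection_one]; exact hg' _ (Set.mem_union_left _ ⟨_, rfl⟩)
    | mul_left g hgm s _ ih =>
      obtain ⟨e, he⟩ := exists_degree hgm
      rw [hleib e g s he, hg' g hgm, ih, zero_mul, mul_zero, smul_zero, add_zero]
  obtain ⟨t, ht, htc⟩ := exists_mem_adjoin_eventuallyEq x c
  have hs : ∀ᶠ y in 𝓝 x, (c - t).1 y = 0 := by
    filter_upwards [htc] with y hy
    change c.1 y - t.1 y = 0
    rw [hy, sub_self]
  obtain ⟨χ, hχ, hχ1⟩ := exists_smooth_extension (J := I) hs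
  -- Applying the Leibniz rule to `χ (c - t) = 0` at `x`, where `χ = 1` and `c - t = 0`, gives `D (c
  -- - t) = 0`.
  have h0 : fnSection χ * (c - t) = 0 := by
    ext y
    change algebraMap ℝ _ (χ y) * (c - t).1 y = 0
    by_cases h : χ y = 0
    · rw [h, map_zero, zero_mul]
    · rw [show (c - t).1 y = 0 from hχ (subset_tsupport _ h), mul_zero]
  have h1 := hleib 0 (fnSection χ) (c - t) (fnSection_mem χ)
  have h2 : (fnSection χ : extSections I F E).1 x = 1 := by
    change algebraMap ℝ _ (χ x) = 1
    rw [hχ1.self_of_nhds, Pi.one_apply, map_one]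
  rw [h0, map_zero, hs.self_of_nhds, mul_zero, zero_add, zero_mul, Int.negOnePow_zero, one_smul, h2,
    one_mul, map_sub, hadj t ht, sub_zero] at h1
  exact h1.symm

theorem sum_ite_lt {n N : ℕ} (hN : N ≤ n) : ∑ i : Fin n, (if i.1 < N then (1 : ℤ) else 0) = N := by
  rw [Fin.sum_univ_eq_sum_range (fun i ↦ if i < N then (1 : ℤ) else 0), Finset.sum_boole]
  congr 1
  rw [show Finset.filter (fun i ↦ i < N) (Finset.range n) = Finset.range N by
    ext i; simp; omega, Finset.card_range]

/-- A skew multiderivation vanishes if it does so on sections followed by at most two functions. -/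
theorem IsSkewDerivation.eq_zero (hν : IsSkewDerivation x ν)
    (h : ∀ k ≤ 2, k ≤ n + 1 → ∀ a : Fin (n + 1) → extSections I F E,
      (∀ i, i.1 + k < n + 1 → a i ∈ Set.range vecSection) →
      (∀ i, n + 1 ≤ i.1 + k → a i ∈ Set.range fnSection) → ν a = 0) : ν = 0 := by
  -- Up to sign the generators can be sorted so that sections come before functions; `N` is the
  -- number of sections.
  have hsort : ∀ a : Fin (n + 1) → extSections I F E, (∀ i, a i ∈ sectionGenerators I F E) →
      ν a = 0 := by
    classical
    intro a ha
    choose d hd using fun i ↦ exists_degree (ha i)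
    let f : Fin (n + 1) → ℕ := fun i ↦ if a i ∈ Set.range fnSection then 1 else 0
    set σ := Tuple.sort f
    have hmono : Monotone (f ∘ σ) := Tuple.monotone_sort f
    have hex : ∃ N, N ≤ n + 1 ∧ ∀ j : Fin (n + 1), N ≤ j.1 → f (σ j) = 1 :=
      ⟨n + 1, le_rfl, fun j hj ↦ absurd j.2 (by omega)⟩
    set N := Nat.find hex
    obtain ⟨hN, hN1⟩ : N ≤ n + 1 ∧ ∀ j : Fin (n + 1), N ≤ j.1 → f (σ j) = 1 := Nat.find_spec hex
    have hfn : ∀ j : Fin (n + 1), N ≤ j.1 → a (σ j) ∈ Set.range fnSection := by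
      intro j hj
      by_contra hc
      have := hN1 j hj
      simp [f] at this
      exact hc this
    have hvec : ∀ j : Fin (n + 1), j.1 < N → a (σ j) ∈ Set.range vecSection := by
      intro j hj
      refine (ha (σ j)).resolve_left fun hc ↦ Nat.find_min hex hj ⟨by omega, fun i hi ↦ ?_⟩
      have h1 : f (σ j) ≤ f (σ i) := hmono hi
      have h2 : f (σ j) = 1 := if_pos hc
      have h3 : f (σ i) ≤ 1 := by simp only [f]; split_ifs <;> simp
      omega
    have hzero : ν (a ∘ σ) = 0 := by
      by_cases hk : n + 1 - N ≤ 2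
      · exact h (n + 1 - N) hk (by omega) _ (fun i hi ↦ hvec i (by omega))
          fun i hi ↦ hfn i (by omega)
      -- With more than two functions the value has degree `2 - (n + 1) + N < 0`, so it is zero.
      · have h1 := hν.degree (fun i ↦ if i.1 < N then 1 else 0) (a ∘ σ) fun i ↦ by
          by_cases hi : i.1 < N
          · obtain ⟨v, hv⟩ := hvec i hi
            simp only [hi, if_true, Function.comp_apply, ← hv, vecSection_mem]
          · obtain ⟨v, hv⟩ := hfn i (by omega)
            simp only [hi, if_false, Function.comp_apply, ← hv, fnSection_mem]
        rw [sum_ite_lt hN, extDeg_of_neg (by push_cast; omega)] at h1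
        exact h1
    have h2 := hν.comp_perm σ⁻¹ (d ∘ σ) (a ∘ σ) (fun i ↦ hd _) hzero
    rwa [Function.comp_assoc, ← Equiv.Perm.coe_mul, mul_inv_cancel, Equiv.Perm.coe_one,
      Function.comp_id] at h2
  -- Generators are replaced by arbitrary homogeneous elements one position at a time, from the
  -- left. The position in question is swapped into the last slot, where the derivation property
  -- applies.
  have hhom : ∀ k ≤ n + 1, ∀ (d : Fin (n + 1) → ℤ) (a : Fin (n + 1) → extSections I F E),
      (∀ i, a i ∈ extSectionsDeg I F E (d i)) →
      (∀ i, k ≤ i.1 → a i ∈ sectionGenerators I F E) → ν a = 0 := by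
    intro k
    induction k with
    | zero => exact fun _ d a _ ha ↦ hsort a fun i ↦ ha i (Nat.zero_le _)
    | succ k ih =>
      intro hk d a had hag
      let p : Fin (n + 1) := ⟨k, by omega⟩
      set σ := Equiv.swap p (Fin.last n)
      have hsn : ∀ g, ν (Fin.snoc (α := fun _ ↦ extSections I F E)
          (fun i : Fin n ↦ a (σ i.castSucc)) g) = ν (Function.update a p g ∘ σ) := by
        intro g
        congr 1
        ext1 i
        induction i using Fin.lastCases with
        | last => simp [σ]
        | cast i =>
          have : σ i.castSucc ≠ p := fun hc ↦ by
            have := congrArg σ hc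
            simp only [σ, Equiv.swap_apply_self, Equiv.swap_apply_left] at this
            exact (Fin.castSucc_lt_last i).ne this
          simp [this]
      have hzero : ∀ c, ν (Fin.snoc (α := fun _ ↦ extSections I F E)
          (fun i : Fin n ↦ a (σ i.castSucc)) c) = 0 := by
        refine hν.snoc_eq_zero (d := fun i ↦ d (σ i.castSucc)) (fun i ↦ had _) fun g hg ↦ ?_
        rw [hsn]
        obtain ⟨e, he⟩ := exists_degree hg
        have hd' : ∀ i, Function.update a p g i ∈ extSectionsDeg I F E (Function.update d p e i) := by
          intro i
          by_cases hi : i = p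
          · subst hi; simpa using he
          · simpa [hi] using had i
        refine hν.comp_perm σ (Function.update d p e) _ hd' (ih (by omega) _ _ hd' fun i hi ↦ ?_)
        by_cases hip : i = p
        · subst hip; simpa using hg
        · rw [Function.update_of_ne hip]
          exact hag i (lt_of_le_of_ne hi fun hc ↦ hip (Fin.ext hc.symm))
      have h1 := hzero (a p)
      rw [hsn, Function.update_eq_self] at h1
      have h2 := hν.comp_perm σ (d ∘ σ) (a ∘ σ) (fun i ↦ had _) h1
      rwa [Function.comp_assoc, ← Equiv.Perm.coe_mul, Equiv.swap_mul_self, Equiv.Perm.coe_one,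
        Function.comp_id] at h2
  refine MultilinearMap.ext fun a ↦ ?_
  classical
  -- Multilinearity reduces the general case to homogeneous components.
  have hdec : a = fun i ↦ ∑ k ∈ (DirectSum.decompose (extSectionsDeg I F E) (a i)).support,
      ((DirectSum.decompose (extSectionsDeg I F E) (a i) k : extSectionsDeg I F E k) :
        extSections I F E) :=
    funext fun i ↦ (DirectSum.sum_support_decompose (extSectionsDeg I F E) (a i)).symm
  rw [hdec, MultilinearMap.map_sum_finset]
  exact Finset.sum_eq_zero fun r _ ↦ hhom (n + 1) le_rfl r _ (fun i ↦ SetLike.coe_mem _)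
    fun i hi ↦ absurd i.2 (by omega)

variable [∀ x, IsTopologicalAddGroup (E x)] [∀ x, ContinuousSMul ℝ (E x)]

theorem exists_dual_section_eq (x : C) (u : Module.Dual ℝ (E x)) :
    ∃ s : Cₛ^∞⟮I; F →L[ℝ] ℝ, fun x ↦ E x →L[ℝ] Trivial C ℝ x⟯,
      ((s x : E x →L[ℝ] ℝ) : E x →ₗ[ℝ] ℝ) = u := by
  set T := trivializationAt F E x
  have hx : x ∈ T.baseSet := FiberBundle.mem_baseSet_trivializationAt' x
  let L : E x →L[ℝ] ℝ := (LinearMap.toContinuousLinearMap (u ∘ₗ T.symmₗ ℝ x)) ∘L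
    T.continuousLinearMapAt ℝ x
  obtain ⟨s, hs⟩ := exists_section_eq (I := I) (F := F →L[ℝ] ℝ)
    (E := fun x ↦ E x →L[ℝ] Trivial C ℝ x) x L
  refine ⟨s, ?_⟩
  rw [hs]
  ext y
  change u (T.symmₗ ℝ x (T.linearMapAt ℝ x y)) = u y
  rw [Trivialization.symmₗ_linearMapAt _ hx]

/-- The conditions on a `P_∞`-structure induced by a Poisson bracket, without the Jacobi
identities, at a point. -/
structure IsPInftyAt (P : PoissonBracket ℝ C^∞⟮I.prod 𝓘(ℝ, F), TotalSpace F E; ℝ⟯) (x : C)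
    (ν : ∀ n, MultilinearMap ℝ (fun _ : Fin n ↦ extSections I F E) (ExteriorAlgebra ℝ (E x))) :
    Prop where
  skewDerivation : ∀ n, IsSkewDerivation x (ν (n + 1))
  degree_zero : ∀ a, ν 0 a ∈ extDeg (E x) 2
  fn_fn : ∀ (m : ℕ) (v : Fin m → Cₛ^∞⟮I; F, E⟯) (f g : C^∞⟮I, C; ℝ⟯),
    ν (m + 2) (Fin.append (fun i ↦ vecSection (v i)) ![fnSection f, fnSection g]) =
      algebraMap ℝ (ExteriorAlgebra ℝ (E x)) (pInftySign (m + 2) *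
        iterVertDeriv v (P.bracket (pullback f) (pullback g)) (zeroPt F x))
  fn : ∀ (m : ℕ) (v : Fin m → Cₛ^∞⟮I; F, E⟯) (f : C^∞⟮I, C; ℝ⟯)
    (u : Cₛ^∞⟮I; F →L[ℝ] ℝ, fun x ↦ E x →L[ℝ] Trivial C ℝ x⟯),
    pairOne (ν (m + 1) (Fin.append (fun i ↦ vecSection (v i)) ![fnSection f]))
        (u x : E x →L[ℝ] ℝ) = pInftySign (m + 1) *
      iterLieVert v (fun h k ↦ P.bracket h k) (pullback f) (fibreLinear u) (zeroPt F x)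
  vec : ∀ (n : ℕ) (v : Fin n → Cₛ^∞⟮I; F, E⟯)
    (u w : Cₛ^∞⟮I; F →L[ℝ] ℝ, fun x ↦ E x →L[ℝ] Trivial C ℝ x⟯),
    pairTwo (ν n fun i ↦ vecSection (v i)) (u x : E x →L[ℝ] ℝ) (w x : E x →L[ℝ] ℝ) =
      pInftySign n *
        iterLieVert v (fun h k ↦ P.bracket h k) (fibreLinear u) (fibreLinear w) (zeroPt F x)

/-- With zero, one or two functions among the arguments the values lie in degrees 2, 1, 0. There
`pairTwo`, `pairOne` and the value itself determine them, and every covector at `x` extends to a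
smooth section of the dual bundle. -/
theorem IsPInftyAt.eq {P : PoissonBracket ℝ C^∞⟮I.prod 𝓘(ℝ, F), TotalSpace F E; ℝ⟯}
    {ν ν' : ∀ n, MultilinearMap ℝ (fun _ : Fin n ↦ extSections I F E) (ExteriorAlgebra ℝ (E x))}
    (h : IsPInftyAt P x ν) (h' : IsPInftyAt P x ν') : ν = ν' := by
  have : FiniteDimensional ℝ (E x) := (finrank_fibre F x).1
  have hvec : ∀ n (v : Fin n → Cₛ^∞⟮I; F, E⟯), ν n (fun i ↦ vecSection (v i)) -
      ν' n (fun i ↦ vecSection (v i)) ∈ extDeg (E x) 2 →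
      ν n (fun i ↦ vecSection (v i)) = ν' n fun i ↦ vecSection (v i) := by
    intro n v hd
    rw [← sub_eq_zero]
    refine eq_zero_of_pairTwo hd fun u w ↦ ?_
    obtain ⟨u, rfl⟩ := exists_dual_section_eq (I := I) (F := F) x u
    obtain ⟨w, rfl⟩ := exists_dual_section_eq (I := I) (F := F) x w
    rw [← pairTwoL_apply, map_sub, pairTwoL_apply, pairTwoL_apply, h.vec, h'.vec, sub_self]
  funext n
  cases n with
  | zero =>
    refine MultilinearMap.ext fun a ↦ ?_
    have ha : a = fun i ↦ vecSection (Fin.elim0 i) := funext fun i ↦ i.elim0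
    rw [ha]
    exact hvec 0 _ (sub_mem (h.degree_zero _) (h'.degree_zero _))
  | succ n =>
    rw [← sub_eq_zero]
    have hsub := (h.skewDerivation n).sub (h'.skewDerivation n)
    refine hsub.eq_zero fun k hk hkn a hv hf ↦ ?_
    rw [sub_apply, sub_eq_zero]
    interval_cases k
    · choose v hv using fun i : Fin (n + 1) ↦ hv i (by omega)
      obtain rfl := funext hv
      have := hsub.degree (fun _ ↦ 1) _ fun i ↦ vecSection_mem (v i)
      simp only [Finset.sum_const, Finset.card_univ, Fintype.card_fin, nsmul_eq_mul, mul_one,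
        sub_add_cancel] at this
      exact hvec _ _ this
    · choose v hv using fun i : Fin n ↦ hv i.castSucc (by simp)
      obtain ⟨f, hf⟩ := hf (Fin.last n) (by simp)
      have ha : a = Fin.append (fun i ↦ vecSection (v i)) ![fnSection f] := by
        rw [Fin.append_right_eq_snoc]
        ext1 i
        induction i using Fin.lastCases with
        | last => simp [hf]
        | cast i => simp [hv]
      have hd := hsub.degree (Fin.snoc (fun _ ↦ 1) 0) a fun i ↦ by
        induction i using Fin.lastCases with
        | last => rw [← hf, Fin.snoc_last]; exact fnSection_mem f
        | cast i => rw [← hv, Fin.snoc_castSucc]; exact vecSection_mem _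
      rw [Fin.sum_univ_castSucc] at hd
      simp only [Fin.snoc_castSucc, Fin.snoc_last, Finset.sum_const, Finset.card_univ,
        Fintype.card_fin, nsmul_eq_mul, mul_one] at hd
      rw [show 2 - ((n + 1 : ℕ) : ℤ) + (n + 0) = 1 by push_cast; ring, sub_apply] at hd
      rw [← sub_eq_zero]
      refine eq_zero_of_pairOne hd fun u ↦ ?_
      obtain ⟨u, rfl⟩ := exists_dual_section_eq (I := I) (F := F) x u
      have hlin : ∀ ξ η : ExteriorAlgebra ℝ (E x), pairOne (ξ - η) (u x : E x →L[ℝ] ℝ) =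
          pairOne ξ (u x : E x →L[ℝ] ℝ) - pairOne η (u x : E x →L[ℝ] ℝ) := fun ξ η ↦ by
        simp only [pairOne, map_sub]
      rw [hlin, ha, h.fn, h'.fn, sub_self]
    · obtain ⟨m, rfl⟩ : ∃ m, n = m + 1 := ⟨n - 1, by omega⟩
      choose v hv using fun i : Fin m ↦ hv i.castSucc.castSucc (by simp)
      obtain ⟨f, hf₁⟩ := hf (Fin.last m).castSucc (by simp)
      obtain ⟨g, hg⟩ := hf (Fin.last (m + 1)) (by simp)
      have ha : a = Fin.append (fun i ↦ vecSection (v i)) ![fnSection f, fnSection g] := by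
        have : ![(fnSection f : extSections I F E), fnSection g] =
            Fin.snoc (α := fun _ ↦ extSections I F E) ![fnSection f] (fnSection g) := by
          ext i; fin_cases i <;> rfl
        rw [this, Fin.append_snoc, Fin.append_right_eq_snoc]
        ext1 i
        induction i using Fin.lastCases with
        | last => simp [hg]
        | cast i =>
          induction i using Fin.lastCases with
          | last => simp [hf₁]
          | cast i => simp [hv]
      rw [ha, h.fn_fn, h'.fn_fn]

end Uniqueness

end

/-! ### Product charts and the polyvector fields of sections. -/

section

attribute [local instance] extNormedAddCommGroup extNormedSpace

open Filter Topology

namespace Darboux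

variable {X Y T : Type*} [Ring T] [Algebra ℝ T] [Fintype X] [Fintype Y] {S : Darboux X Y T}

theorem iter_eq_opIter (G : T) : ∀ (n : ℕ) (a : Fin n → T),
    S.iter G n a = opIter n (fun i ↦ S.tau (a i)) G
  | 0, _ => rfl
  | n + 1, a => by rw [iter_succ, iter_eq_opIter G n]; rfl

/-- Skew symmetry of the iterated bracket comes entirely from the commutation rule of the operators
`tau`; the starting element plays no part. -/
theorem iter_swap (G : T) {n : ℕ} {d : Fin (n + 1) → ℤ} {a : Fin (n + 1) → T}
    (hP : ∀ i, S.P (a i) = a i) (hd : ∀ i, S.inv (a i) = (d i).negOnePow • a i) (i : Fin n) :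
    S.iter G (n + 1) a = -((d i.castSucc * d i.succ).negOnePow •
      S.iter G (n + 1) (a ∘ Equiv.swap i.castSucc i.succ)) := by
  have h := opIter_swap n d (fun i ↦ S.tau (a i))
    (fun k l ↦ tau_comm (hP k) (hP l) (hd k) (hd l)) i
  have h' := congrArg (fun f : Module.End ℝ T ↦ f G) h
  rw [iter_eq_opIter, iter_eq_opIter]
  change _ = -(_ • opIter (n + 1) ((fun i ↦ S.tau (a i)) ∘ Equiv.swap i.castSucc i.succ) G)
  refine Eq.trans ?_ (congrArg (fun x ↦ -((d i.castSucc * d i.succ).negOnePow • x)) h').symm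
  rw [LinearMap.neg_apply, LinearMap.smul_apply, smul_neg, neg_neg, smul_smul, Int.units_mul_self,
    one_smul]

/-- For odd arguments the operators `tau` commute without sign, so a first bracketing may be moved
to the end. This reconciles `iter`, where the last argument acts outermost, with iterated Lie
derivatives, where the first one does. -/
theorem iter_tau_odd (G : T) {b : T} (hPb : S.P b = b) (hb : S.inv b = -b) :
    ∀ {n : ℕ} {a : Fin n → T} (_ : ∀ i, S.P (a i) = a i) (_ : ∀ i, S.inv (a i) = -a i),
      S.iter (S.tau b G) n a = S.tau b (S.iter G n a)
  | 0, _, _, _ => rfl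
  | n + 1, a, hP, ha => by
    rw [iter_succ, iter_succ, iter_tau_odd G hPb hb (fun i ↦ hP _) fun i ↦ ha _]
    have hodd : ∀ c, S.inv c = -c → S.inv c = (1 : ℤ).negOnePow • c := fun c hc ↦ by
      rw [hc, Int.negOnePow_one, Units.neg_smul, one_smul]
    have h := tau_comm (S := S) (p := 1) (q := 1) hPb (hP (Fin.last n)) (hodd _ hb) (hodd _ (ha _))
    rw [mul_one, Int.negOnePow_one, Units.neg_smul, one_smul, neg_neg] at h
    exact congrArg (fun f : Module.End ℝ T ↦ f (S.iter G n fun i ↦ a i.castSucc)) h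

end Darboux

section Frame

variable (EB F : Type*) [NormedAddCommGroup EB] [NormedSpace ℝ EB] [FiniteDimensional ℝ EB]
  [NormedAddCommGroup F] [NormedSpace ℝ F] [FiniteDimensional ℝ F]

/-- A basis of the product compatible with the factors. -/
def prodBasis : Module.Basis (Fin (Module.finrank ℝ EB) ⊕ Fin (Module.finrank ℝ F)) ℝ (EB × F) :=
  (Module.finBasis ℝ EB).prod (Module.finBasis ℝ F)

/-- The product decomposition `EB × F` with linear coordinates. -/
def prodFrame : FrameData (Fin (Module.finrank ℝ EB)) (Fin (Module.finrank ℝ F)) (EB × F)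
    (EB × F) where
  e := prodBasis EB F
  u := (prodBasis EB F).coord
  pr := ContinuousLinearMap.inl ℝ EB F ∘L ContinuousLinearMap.fst ℝ EB F
  p := LinearMap.inr ℝ EB F ∘ₗ LinearMap.snd ℝ EB F
  pr_pr := rfl
  p_p := rfl
  pr_inl i := by simp [prodBasis]
  pr_inr i := by simp [prodBasis]
  u_inl i := by ext <;> simp [prodBasis]
  u_inr i := by ext <;> simp [prodBasis]

end Frame

section Local

universe u
variable {EB : Type u} [NormedAddCommGroup EB] [NormedSpace ℝ EB] [FiniteDimensional ℝ EB]
  {HB : Type*} [TopologicalSpace HB] {I : ModelWithCorners ℝ EB HB} [I.Boundaryless]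
  {C : Type*} [TopologicalSpace C] [T2Space C] [ChartedSpace HB C] [IsManifold I ∞ C]
  {F : Type*} [NormedAddCommGroup F] [NormedSpace ℝ F] [FiniteDimensional ℝ F]
  {E : C → Type*} [∀ x, AddCommGroup (E x)] [∀ x, Module ℝ (E x)]
  [TopologicalSpace (TotalSpace F E)] [∀ x, TopologicalSpace (E x)]
  [FiberBundle F E] [VectorBundle ℝ F E]

theorem mem_extSectionsDeg {d : ℤ} {a : extSections I F E} :
    a ∈ extSectionsDeg I F E d ↔ ∀ x, a.1 x ∈ extDeg (E x) d := by
  rcases d with k | k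
  · exact Iff.rfl
  · refine ⟨fun h x ↦ ?_, fun h ↦ ?_⟩
    · rw [eq_zero_of_mem_negSucc h]; exact zero_mem _
    · have : a = 0 := by ext x; exact h x
      rw [this]; exact zero_mem _

variable (I F E) in
/-- The domain, in a chart, of the preferred trivialization. -/
def chartDomain (x₀ : C) : Set EB :=
  (extChartAt I x₀).target ∩ (extChartAt I x₀).symm ⁻¹' (trivializationAt F E x₀).baseSet

theorem isOpen_chartDomain (x₀ : C) : IsOpen (chartDomain I F E x₀) :=
  (continuousOn_extChartAt_symm x₀).isOpen_inter_preimage (isOpen_extChartAt_target x₀)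
    (trivializationAt F E x₀).open_baseSet

theorem mem_chartDomain (x₀ : C) : extChartAt I x₀ x₀ ∈ chartDomain I F E x₀ :=
  ⟨mem_extChartAt_target x₀, by
    rw [Set.mem_preimage, extChartAt_to_inv]
    exact FiberBundle.mem_baseSet_trivializationAt' x₀⟩

variable (I F E) in
/-- A cutoff function supported in the domain of a trivialization. -/
def chartBump (x₀ : C) : ContDiffBump (extChartAt I x₀ x₀) :=
  (exists_contDiffBump_subset _ ((isOpen_chartDomain (F := F) (E := E) x₀).mem_nhds
    (mem_chartDomain x₀))).choose

theorem chartBump_subset (x₀ : C) :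
    Metric.closedBall (extChartAt I x₀ x₀) (chartBump I F E x₀).rOut ⊆ chartDomain I F E x₀ :=
  (exists_contDiffBump_subset _ ((isOpen_chartDomain (F := F) (E := E) x₀).mem_nhds
    (mem_chartDomain x₀))).choose_spec

theorem contDiffOn_section (x₀ : C) (a : extSections I F E) :
    ContDiffOn ℝ ∞ (fun ξ ↦ extTriv F E x₀ ((extChartAt I x₀).symm ξ)
      (a.1 ((extChartAt I x₀).symm ξ))) (chartDomain I F E x₀) := by
  let b := Module.finBasis ℝ (ExteriorAlgebra ℝ F)
  have h : ∀ i, ContDiffOn ℝ ∞ (fun ξ ↦ b.coord i (extTriv F E x₀ ((extChartAt I x₀).symm ξ)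
      (a.1 ((extChartAt I x₀).symm ξ)))) (chartDomain I F E x₀) := fun i ↦
    contMDiffOn_iff_contDiffOn.1 ((a.2 x₀ (b.coord i)).comp
      ((contMDiffOn_extChartAt_symm x₀).mono Set.inter_subset_left) fun ξ hξ ↦ hξ.2)
  have h2 : ContDiffOn ℝ ∞ (fun ξ ↦ ∑ i, (b.coord i (extTriv F E x₀ ((extChartAt I x₀).symm ξ)
      (a.1 ((extChartAt I x₀).symm ξ)))) • b i) (chartDomain I F E x₀) :=
    ContDiffOn.sum fun i _ ↦ ContDiffOn.smul (g := fun _ ↦ b i) (h i) contDiffOn_const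
  exact h2.congr fun ξ _ ↦ (b.sum_repr _).symm

variable (I F E) in
/-- The vertical polyvector field, constant along the fibres, that represents a section near the
centre of a chart. -/
def chartSection (x₀ : C) : extSections I F E →ₗ[ℝ] smoothExt (EB × F) (EB × F) where
  toFun a := smoothExt.mk (fun z ↦ ExteriorAlgebra.map (LinearMap.inr ℝ EB F)
      (chartBump I F E x₀ z.1 • extTriv F E x₀ ((extChartAt I x₀).symm z.1)
        (a.1 ((extChartAt I x₀).symm z.1))))
    (contDiff_ext_linear (ExteriorAlgebra.map (LinearMap.inr ℝ EB F)).toLinearMap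
      ((contDiff_bump_smul _ (isOpen_chartDomain x₀) (chartBump_subset x₀)
        (contDiffOn_section x₀ a)).comp contDiff_fst))
  map_add' a b := by
    ext z
    change ExteriorAlgebra.map _ (_ • extTriv F E x₀ _ (a.1 _ + b.1 _)) = _
    rw [map_add, smul_add, map_add]; rfl
  map_smul' r a := by
    ext z
    change ExteriorAlgebra.map _ (_ • extTriv F E x₀ _ (r • a.1 _)) = _
    simp only [map_smul]
    exact smul_comm _ _ _

theorem chartSection_apply (x₀ : C) (a : extSections I F E) (z : EB × F) :
    (chartSection I F E x₀ a).1 z = ExteriorAlgebra.map (LinearMap.inr ℝ EB F)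
      (chartBump I F E x₀ z.1 • extTriv F E x₀ ((extChartAt I x₀).symm z.1)
        (a.1 ((extChartAt I x₀).symm z.1))) := rfl

/-- The field is vertical and does not depend on the fibre coordinate, so it lies in the abelian
subalgebra. -/
theorem P_chartSection (x₀ : C) (a : extSections I F E) :
    (polyvector (prodFrame EB F)).P (chartSection I F E x₀ a) = chartSection I F E x₀ a := by
  ext z
  change ExteriorAlgebra.map (prodFrame EB F).p ((chartSection I F E x₀ a).1 (z.1, 0)) = _
  rw [chartSection_apply, chartSection_apply, map_map_apply]
  rfl

theorem chartSection_mem (x₀ : C) {d : ℤ} {a : extSections I F E}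
    (ha : a ∈ extSectionsDeg I F E d) (z : EB × F) :
    (chartSection I F E x₀ a).1 z ∈ extDeg (EB × F) d :=
  extDeg_map_mem _ (Submodule.smul_mem _ _ (extDeg_map_mem _ (mem_extSectionsDeg.1 ha _)))

theorem inv_of_mem {X Y V : Type*} [NormedAddCommGroup V] [NormedSpace ℝ V] {W : Type*}
    [AddCommGroup W] [Module ℝ W] [FiniteDimensional ℝ W] (D : FrameData X Y V W) {d : ℤ}
    {K : smoothExt V W} (hK : ∀ z, K.1 z ∈ extDeg W d) :
    (polyvector D).inv K = d.negOnePow • K := by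
  ext z
  rw [Units.smul_def, smoothExt.zsmul_apply, ← Units.smul_def]
  exact extInv_of_mem (hK z)

/-- The total space chart in terms of the trivialization. -/
theorem extChartAt_zeroPt_symm {x₀ : C} {z : EB × F}
    (hz : z ∈ (extChartAt (I.prod 𝓘(ℝ, F)) (zeroPt F (E := E) x₀)).target) :
    z.1 ∈ chartDomain I F E x₀ ∧
      (extChartAt (I.prod 𝓘(ℝ, F)) (zeroPt F (E := E) x₀)).symm z =
        ⟨(extChartAt I x₀).symm z.1,
          (trivializationAt F E x₀).symmₗ ℝ ((extChartAt I x₀).symm z.1) z.2⟩ := by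
  rw [FiberBundle.extChartAt_target] at hz
  refine ⟨hz.1, ?_⟩
  have h : (extChartAt I x₀).symm z.1 ∈ (trivializationAt F E x₀).baseSet := hz.1.2
  rw [FiberBundle.extChartAt, (trivializationAt F E x₀).symmₗ_apply h]
  exact (Trivialization.mk_symm _ h _).symm

theorem mem_target_zeroPt {x₀ : C} {ξ : EB} (hξ : ξ ∈ chartDomain I F E x₀) (y : F) :
    (ξ, y) ∈ (extChartAt (I.prod 𝓘(ℝ, F)) (zeroPt F (E := E) x₀)).target := by
  rw [FiberBundle.extChartAt_target]
  exact ⟨hξ, trivial⟩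

theorem extChartAt_zeroPt_self (x₀ : C) :
    extChartAt (I.prod 𝓘(ℝ, F)) (zeroPt F (E := E) x₀) (zeroPt F (E := E) x₀) =
      (extChartAt I x₀ x₀, 0) := by
  rw [FiberBundle.extChartAt]
  have h := (trivializationAt F E x₀).zeroSection ℝ (x := x₀)
    (FiberBundle.mem_baseSet_trivializationAt' x₀)
  change ((extChartAt I x₀).prod (PartialEquiv.refl F)) (trivializationAt F E x₀ (zeroSection F E x₀)) = _
  rw [h]; rfl

end Local

end

/-! ### Local models of the Poisson bracket and of its vertical Lie derivatives. -/

section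

attribute [local instance] extNormedAddCommGroup extNormedSpace

open Filter Topology

section LocalModel

universe u
variable {EB : Type u} [NormedAddCommGroup EB] [NormedSpace ℝ EB] [FiniteDimensional ℝ EB]
  {HB : Type*} [TopologicalSpace HB] {I : ModelWithCorners ℝ EB HB} [I.Boundaryless]
  {C : Type*} [TopologicalSpace C] [T2Space C] [ChartedSpace HB C] [IsManifold I ∞ C]
  {F : Type*} [NormedAddCommGroup F] [NormedSpace ℝ F] [FiniteDimensional ℝ F]
  {E : C → Type*} [∀ x, AddCommGroup (E x)] [∀ x, Module ℝ (E x)]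
  [TopologicalSpace (TotalSpace F E)] [∀ x, TopologicalSpace (E x)]
  [FiberBundle F E] [VectorBundle ℝ F E] [ContMDiffVectorBundle ∞ F E I]
  (P : PoissonBracket ℝ C^∞⟮I.prod 𝓘(ℝ, F), TotalSpace F E; ℝ⟯)

/-- A bivector field that represents a Poisson bracket near a point of the zero section. -/
structure IsLocalModel (x₀ : C) (H : smoothExt (EB × F) (EB × F)) (O : Set (EB × F)) : Prop where
  isOpen : IsOpen O
  mem : (extChartAt I x₀ x₀, 0) ∈ O
  subset : O ⊆ (extChartAt (I.prod 𝓘(ℝ, F)) (zeroPt F (E := E) x₀)).target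
  bump : ∀ z ∈ O, chartBump I F E x₀ z.1 = 1
  degree : ∀ z, H.1 z ∈ extDeg (EB × F) 2
  represents : Represents (zeroPt F (E := E) x₀) O H.1 fun f g ↦ P.bracket f g
  jacobi : ∀ z ∈ O, ((polyvector (prodFrame EB F)).br H H).1 z = 0

theorem exists_isLocalModel (x₀ : C) : ∃ H O, IsLocalModel P x₀ H O := by
  have := t2Space_totalSpace (F := F) E
  obtain ⟨H, O, hO, hm, hs, hd, hr, hj⟩ := P.exists_bivector (zeroPt F x₀) (prodFrame EB F)
    (prodBasis EB F) (fun _ ↦ rfl) fun _ ↦ rfl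
  rw [extChartAt_zeroPt_self] at hm
  have h1 : ∀ᶠ z : EB × F in 𝓝 (extChartAt I x₀ x₀, 0), chartBump I F E x₀ z.1 = 1 :=
    (continuous_fst.tendsto (extChartAt I x₀ x₀, (0 : F))).eventually
      (chartBump I F E x₀).eventuallyEq_one
  obtain ⟨O', hO', hO'o, hmO'⟩ := eventually_nhds_iff.1 h1
  exact ⟨H, O ∩ O', hO.inter hO'o, ⟨hm, hmO'⟩, fun z hz ↦ hs hz.1, fun z hz ↦ hO' z hz.2, hd,
    fun z hz ↦ hr z hz.1, fun z hz ↦ hj z hz.1⟩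

/-- The chart is linear on fibres, so a line in a fibre stays a line and the vertical derivative
becomes a directional derivative. -/
theorem vertDeriv_extChartAt_symm {x₀ : C} (v : Cₛ^∞⟮I; F, E⟯)
    (h : C^∞⟮I.prod 𝓘(ℝ, F), TotalSpace F E; ℝ⟯) {z : EB × F}
    (hz : z ∈ (extChartAt (I.prod 𝓘(ℝ, F)) (zeroPt F (E := E) x₀)).target) :
    vertDeriv v h ((extChartAt (I.prod 𝓘(ℝ, F)) (zeroPt F (E := E) x₀)).symm z) =
      fderiv ℝ (h ∘ (extChartAt (I.prod 𝓘(ℝ, F)) (zeroPt F (E := E) x₀)).symm) z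
        (0, (trivializationAt F E x₀).linearMapAt ℝ ((extChartAt I x₀).symm z.1)
          (v ((extChartAt I x₀).symm z.1))) := by
  have := t2Space_totalSpace (F := F) E
  set Φ := extChartAt (I.prod 𝓘(ℝ, F)) (zeroPt F (E := E) x₀)
  set T := trivializationAt F E x₀
  set y := (extChartAt I x₀).symm z.1
  obtain ⟨hz1, hz2⟩ := extChartAt_zeroPt_symm hz
  have hy : y ∈ T.baseSet := hz1.2
  have hsm : DifferentiableAt ℝ (h ∘ Φ.symm) z :=
    ((contDiffOn_comp_symm (zeroPt F x₀) h).contDiffAt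
      ((isOpen_extChartAt_target _).mem_nhds hz)).differentiableAt (by simp)
  rw [← hsm.lineDeriv_eq_fderiv, hz2]
  change deriv (fun t : ℝ ↦ h ⟨y, T.symmₗ ℝ y z.2 + t • v y⟩) 0 = deriv (fun t : ℝ ↦ h (Φ.symm _)) 0
  congr 1
  funext t
  congr 1
  have ht : z + t • ((0 : EB), T.linearMapAt ℝ y (v y)) = (z.1, z.2 + t • T.linearMapAt ℝ y (v y)) := by
    ext <;> simp
  rw [ht, (extChartAt_zeroPt_symm (mem_target_zeroPt hz1 _)).2]
  change _ = (⟨y, T.symmₗ ℝ y (z.2 + t • T.linearMapAt ℝ y (v y))⟩ : TotalSpace F E)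
  rw [map_add, map_smul, Trivialization.symmₗ_linearMapAt _ hy]

variable {P} {x₀ : C} {H : smoothExt (EB × F) (EB × F)} {O : Set (EB × F)}

theorem IsLocalModel.chartSection_apply (hm : IsLocalModel P x₀ H O) {z : EB × F} (hz : z ∈ O)
    (a : extSections I F E) :
    (chartSection I F E x₀ a).1 z = ExteriorAlgebra.map (LinearMap.inr ℝ EB F)
      (extTriv F E x₀ ((extChartAt I x₀).symm z.1) (a.1 ((extChartAt I x₀).symm z.1))) := by
  rw [_root_.chartSection_apply, hm.bump z hz, one_smul]

theorem IsLocalModel.chartSection_mul (hm : IsLocalModel P x₀ H O) {z : EB × F} (hz : z ∈ O)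
    (a b : extSections I F E) : (chartSection I F E x₀ (a * b)).1 =ᶠ[𝓝 z]
      (chartSection I F E x₀ a * chartSection I F E x₀ b).1 := by
  filter_upwards [hm.isOpen.mem_nhds hz] with y hy
  change _ = (chartSection I F E x₀ a).1 y * (chartSection I F E x₀ b).1 y
  rw [hm.chartSection_apply hy, hm.chartSection_apply hy, hm.chartSection_apply hy, ← map_mul,
    ← map_mul]
  rfl

theorem inv_chartSection {d : ℤ} {a : extSections I F E} (ha : a ∈ extSectionsDeg I F E d) :
    (polyvector (prodFrame EB F)).inv (chartSection I F E x₀ a) =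
      d.negOnePow • chartSection I F E x₀ a :=
  inv_of_mem _ (chartSection_mem x₀ ha)

theorem inv_chartSection_vec (v : Cₛ^∞⟮I; F, E⟯) :
    (polyvector (prodFrame EB F)).inv (chartSection I F E x₀ (vecSection v)) =
      -chartSection I F E x₀ (vecSection v) := by
  rw [inv_chartSection (vecSection_mem v), Int.negOnePow_one, Units.neg_smul, one_smul]

theorem IsLocalModel.chartSection_vec (hm : IsLocalModel P x₀ H O) {z : EB × F} (hz : z ∈ O)
    (v : Cₛ^∞⟮I; F, E⟯) : (chartSection I F E x₀ (vecSection v)).1 z =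
      ExteriorAlgebra.ι ℝ ((0 : EB), (trivializationAt F E x₀).linearMapAt ℝ
        ((extChartAt I x₀).symm z.1) (v ((extChartAt I x₀).symm z.1))) := by
  rw [hm.chartSection_apply hz]
  change ExteriorAlgebra.map _ (ExteriorAlgebra.map _ (ExteriorAlgebra.ι ℝ _)) = _
  rw [ExteriorAlgebra.map_apply_ι, ExteriorAlgebra.map_apply_ι]
  rfl

theorem iter_chartSection_vec_mem (hH : ∀ z, H.1 z ∈ extDeg (EB × F) 2) {m : ℕ}
    (v : Fin m → Cₛ^∞⟮I; F, E⟯) (z : EB × F) : ((polyvector (prodFrame EB F)).iter H m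
      fun i ↦ chartSection I F E x₀ (vecSection (v i))).1 z ∈ extDeg (EB × F) 2 := by
  have := polyvector_iter_mem (prodFrame EB F) hH m
    (a := fun i ↦ chartSection I F E x₀ (vecSection (v i))) (d := fun _ ↦ 1)
    (fun i ↦ chartSection_mem x₀ (vecSection_mem (v i))) z
  simpa using this

/-- Each Lie derivative is represented by `-tau`, and the minus signs accumulate to `(-1) ^ m`. -/
theorem IsLocalModel.represents_iterLieVert (hm : IsLocalModel P x₀ H O) {m : ℕ}
    (v : Fin m → Cₛ^∞⟮I; F, E⟯) : Represents (zeroPt F (E := E) x₀) O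
      ((-1 : ℝ) ^ m • (polyvector (prodFrame EB F)).iter H m
        fun i ↦ chartSection I F E x₀ (vecSection (v i))).1
      (iterLieVert v fun f g ↦ P.bracket f g) := by
  have := t2Space_totalSpace (F := F) E
  induction m with
  | zero =>
    rw [pow_zero, one_smul]
    exact hm.represents
  | succ m ih =>
    have h := (ih fun i ↦ v i.succ).lie (prodBasis EB F) (D := prodFrame EB F) (fun _ ↦ rfl)
      (fun _ ↦ rfl) hm.isOpen hm.subset
      (fun z ↦ Submodule.smul_mem _ _ (iter_chartSection_vec_mem hm.degree _ z))
      (a := chartSection I F E x₀ (vecSection (v 0))) (fun z hz ↦ hm.chartSection_vec hz (v 0))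
      (δ := vertDeriv (v 0)) ?_ (fun z hz f ↦ vertDeriv_extChartAt_symm (v 0) f (hm.subset hz))
    · have h1 : iterLieVert v (fun f g ↦ P.bracket f g) =
          lieVert (v 0) (iterLieVert (fun i ↦ v i.succ) fun f g ↦ P.bracket f g) := by
        rw [iterLieVert, List.ofFn_succ, List.foldr_cons]; rfl
      have h2 : ((-1 : ℝ) ^ (m + 1) • (polyvector (prodFrame EB F)).iter H (m + 1)
          fun i ↦ chartSection I F E x₀ (vecSection (v i))) =
          -(polyvector (prodFrame EB F)).tau (chartSection I F E x₀ (vecSection (v 0)))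
            ((-1 : ℝ) ^ m • (polyvector (prodFrame EB F)).iter H m
              fun i ↦ chartSection I F E x₀ (vecSection (v i.succ))) := by
        have h3 : (fun i ↦ chartSection I F E x₀ (vecSection (v i))) = Fin.cons
            (α := fun _ ↦ smoothExt (EB × F) (EB × F)) (chartSection I F E x₀ (vecSection (v 0)))
            fun i ↦ chartSection I F E x₀ (vecSection (v i.succ)) := by
          funext i
          induction i using Fin.cases <;> rfl
        rw [h3, Darboux.iter_cons, Darboux.iter_tau_odd H (P_chartSection x₀ _)
          (inv_chartSection_vec _) (fun i ↦ P_chartSection x₀ _) fun i ↦ inv_chartSection_vec _,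
          map_smul, pow_succ, mul_neg_one, neg_smul]
      rw [h1, h2]
      exact h
    -- The coefficient of the vertical vector field is read off the globally smooth field
    -- `chartSection` by `ιInv`, which proves it smooth.
    · have h4 : ContDiffOn ℝ ∞ (fun z ↦ LinearMap.toContinuousLinearMap
          (ExteriorAlgebra.ιInv (R := ℝ) (M := EB × F))
            ((chartSection I F E x₀ (vecSection (v 0))).1 z)) O :=
        ((ContinuousLinearMap.contDiff _).comp (smoothExt.contDiff _)).contDiffOn
      refine h4.congr fun z hz ↦ ?_
      rw [hm.chartSection_vec hz]
      exact (ExteriorAlgebra.ι_leftInverse _).symm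

end LocalModel

end

/-! ### Brackets computed in a chart. -/

section

attribute [local instance] extNormedAddCommGroup extNormedSpace

open Filter Topology

section Pairing

variable {W : Type*} [AddCommGroup W] [Module ℝ W]

theorem eq_algebraMap_of_mem_extDeg_zero {ξ : ExteriorAlgebra ℝ W} (hξ : ξ ∈ extDeg W 0) :
    ξ = algebraMap ℝ _ (ExteriorAlgebra.algebraMapInv ξ) := by
  change ξ ∈ ⋀[ℝ]^0 W at hξ
  rw [ExteriorAlgebra.exteriorPower, pow_zero] at hξ
  obtain ⟨r, rfl⟩ := Submodule.mem_one.1 hξ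
  rw [ExteriorAlgebra.algebraMap_leftInverse]

theorem extContract_extContract_of_mem {ξ : ExteriorAlgebra ℝ W} (hξ : ξ ∈ extDeg W 2)
    (u w : Module.Dual ℝ W) :
    extContract w (extContract u ξ) = algebraMap ℝ _ (pairTwo ξ u w) :=
  eq_algebraMap_of_mem_extDeg_zero (extContract_mem w (extContract_mem u hξ))

theorem dual_eq_sum_smul_coord {ι : Type*} [Fintype ι] (b : Module.Basis ι ℝ W)
    (u : Module.Dual ℝ W) : u = ∑ i, u (b i) • b.coord i := by
  classical
  exact b.ext fun j ↦ by simp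

end Pairing

section LieVert

variable {EB : Type*} [NormedAddCommGroup EB] [NormedSpace ℝ EB] [FiniteDimensional ℝ EB]
  {HB : Type*} [TopologicalSpace HB] {I : ModelWithCorners ℝ EB HB}
  {C : Type*} [TopologicalSpace C] [ChartedSpace HB C] [IsManifold I ∞ C]
  {F : Type*} [NormedAddCommGroup F] [NormedSpace ℝ F] [FiniteDimensional ℝ F]
  {E : C → Type*} [∀ x, AddCommGroup (E x)] [∀ x, Module ℝ (E x)]
  [TopologicalSpace (TotalSpace F E)] [∀ x, TopologicalSpace (E x)]
  [FiberBundle F E] [VectorBundle ℝ F E] [ContMDiffVectorBundle ∞ F E I]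

theorem vertDeriv_pullback (v : Cₛ^∞⟮I; F, E⟯) (f : C^∞⟮I, C; ℝ⟯) :
    vertDeriv v (pullback f : C^∞⟮I.prod 𝓘(ℝ, F), TotalSpace F E; ℝ⟯) = 0 := by
  ext e
  exact deriv_const (0 : ℝ) (f e.proj)

theorem vertDeriv_zero (v : Cₛ^∞⟮I; F, E⟯) :
    vertDeriv v (0 : C^∞⟮I.prod 𝓘(ℝ, F), TotalSpace F E; ℝ⟯) = 0 := by
  ext e
  exact deriv_const (0 : ℝ) (0 : ℝ)

/-- Vertical derivatives annihilate functions pulled back from the base, so the two correction terms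
of the Lie derivative vanish. -/
theorem iterLieVert_pullback (P : PoissonBracket ℝ C^∞⟮I.prod 𝓘(ℝ, F), TotalSpace F E; ℝ⟯)
    (f g : C^∞⟮I, C; ℝ⟯) {m : ℕ} (v : Fin m → Cₛ^∞⟮I; F, E⟯) :
    iterLieVert v (fun h k ↦ P.bracket h k) (pullback f) (pullback g) =
      iterVertDeriv v (P.bracket (pullback f) (pullback g)) := by
  rw [iterLieVert, iterVertDeriv]
  -- The induction also carries vanishing on the zero function in each slot, since `lieVert` acts on
  -- arbitrary operations and bilinearity is not part of its type.
  suffices H : ∀ l : List (Cₛ^∞⟮I; F, E⟯),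
      (∀ h, l.foldr lieVert (fun h k ↦ P.bracket h k) 0 h = 0) ∧
      (∀ h, l.foldr lieVert (fun h k ↦ P.bracket h k) h 0 = 0) ∧
      l.foldr lieVert (fun h k ↦ P.bracket h k) (pullback f) (pullback g) =
        l.foldr vertDeriv (P.bracket (pullback f) (pullback g)) from (H _).2.2
  intro l
  induction l with
  | nil => exact ⟨fun h ↦ by simp, fun h ↦ by simp, rfl⟩
  | cons w l ih =>
    obtain ⟨h1, h2, h3⟩ := ih
    refine ⟨fun h ↦ ?_, fun h ↦ ?_, ?_⟩
    · simp only [List.foldr_cons, lieVert, vertDeriv_zero, h1, sub_zero]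
    · simp only [List.foldr_cons, lieVert, vertDeriv_zero, h2, sub_zero]
    · rw [List.foldr_cons, List.foldr_cons, lieVert, vertDeriv_pullback, vertDeriv_pullback, h1, h2,
        sub_zero, sub_zero, h3]

end LieVert

section LocalFormula

universe u
variable {EB : Type u} [NormedAddCommGroup EB] [NormedSpace ℝ EB] [FiniteDimensional ℝ EB]
  {HB : Type*} [TopologicalSpace HB] {I : ModelWithCorners ℝ EB HB} [I.Boundaryless]
  {C : Type*} [TopologicalSpace C] [T2Space C] [ChartedSpace HB C] [IsManifold I ∞ C]
  {F : Type*} [NormedAddCommGroup F] [NormedSpace ℝ F] [FiniteDimensional ℝ F]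
  {E : C → Type*} [∀ x, AddCommGroup (E x)] [∀ x, Module ℝ (E x)]
  [TopologicalSpace (TotalSpace F E)] [∀ x, TopologicalSpace (E x)]
  [FiberBundle F E] [VectorBundle ℝ F E] [ContMDiffVectorBundle ∞ F E I]
  {P : PoissonBracket ℝ C^∞⟮I.prod 𝓘(ℝ, F), TotalSpace F E; ℝ⟯}

variable (I F E) in
/-- The value at a point `x` of a section, read off from a polyvector field in a chart. -/
def chartReadback (x₀ x : C) : smoothExt (EB × F) (EB × F) →ₗ[ℝ] ExteriorAlgebra ℝ (E x) where
  toFun K := ExteriorAlgebra.map ((trivializationAt F E x₀).symmₗ ℝ x ∘ₗ LinearMap.snd ℝ EB F)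
    (K.1 (extChartAt I x₀ x, 0))
  map_add' _ _ := map_add _ _ _
  map_smul' _ _ := map_smul (ExteriorAlgebra.map
    ((trivializationAt F E x₀).symmₗ ℝ x ∘ₗ LinearMap.snd ℝ EB F)) _ _

theorem chartReadback_apply (x₀ x : C) (K : smoothExt (EB × F) (EB × F)) :
    chartReadback I F E x₀ x K = ExteriorAlgebra.map
      ((trivializationAt F E x₀).symmₗ ℝ x ∘ₗ LinearMap.snd ℝ EB F) (K.1 (extChartAt I x₀ x, 0)) :=
  rfl

theorem chartReadback_mul (x₀ x : C) (K L : smoothExt (EB × F) (EB × F)) :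
    chartReadback I F E x₀ x (K * L) = chartReadback I F E x₀ x K * chartReadback I F E x₀ x L :=
  map_mul (ExteriorAlgebra.map ((trivializationAt F E x₀).symmₗ ℝ x ∘ₗ LinearMap.snd ℝ EB F)) _ _

theorem chartReadback_mem {x₀ x : C} {K : smoothExt (EB × F) (EB × F)} {d : ℤ}
    (hK : ∀ z, K.1 z ∈ extDeg (EB × F) d) : chartReadback I F E x₀ x K ∈ extDeg (E x) d :=
  extDeg_map_mem _ (hK _)

/-- The normalization of the brackets. -/
def bracketSign (n : ℕ) : ℝ := pInftySign n * (-1) ^ n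

variable (I E) in
/-- The brackets at a point `x`, computed in a chart. -/
def localBracket (x₀ x : C) (H : smoothExt (EB × F) (EB × F)) (n : ℕ) :
    MultilinearMap ℝ (fun _ : Fin n ↦ extSections I F E) (ExteriorAlgebra ℝ (E x)) :=
  (bracketSign n • chartReadback I F E x₀ x).compMultilinearMap
    (((polyvector (prodFrame EB F)).iter H n).compLinearMap fun _ ↦ chartSection I F E x₀)

theorem localBracket_apply (x₀ x : C) (H : smoothExt (EB × F) (EB × F)) (n : ℕ)
    (a : Fin n → extSections I F E) : localBracket I E x₀ x H n a =
      bracketSign n • chartReadback I F E x₀ x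
        ((polyvector (prodFrame EB F)).iter H n fun i ↦ chartSection I F E x₀ (a i)) := rfl

variable {x₀ x : C} {H : smoothExt (EB × F) (EB × F)} {O : Set (EB × F)}

theorem IsLocalModel.chartReadback_chartSection (hm : IsLocalModel P x₀ H O)
    (hx : x ∈ (extChartAt I x₀).source) (hxO : (extChartAt I x₀ x, 0) ∈ O)
    (a : extSections I F E) : chartReadback I F E x₀ x (chartSection I F E x₀ a) = a.1 x := by
  have hb := (extChartAt_zeroPt_symm (hm.subset hxO)).1.2
  rw [Set.mem_preimage, (extChartAt I x₀).left_inv hx] at hb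
  rw [chartReadback_apply, hm.chartSection_apply hxO, (extChartAt I x₀).left_inv hx, map_map_apply]
  exact extTrivSymm_extTriv hb (a.1 x)

/-- A function has no polyvector part to contract, so only its partial derivatives remain, and they
assemble into contraction with its differential. -/
theorem IsLocalModel.tau_fn (hm : IsLocalModel P x₀ H O) {z : EB × F} (hz : z ∈ O)
    (f : C^∞⟮I, C; ℝ⟯) (K : smoothExt (EB × F) (EB × F)) :
    ((polyvector (prodFrame EB F)).tau (chartSection I F E x₀ (fnSection f)) K).1 z =
      -extContract (fderiv ℝ ((pullback f : C^∞⟮I.prod 𝓘(ℝ, F), TotalSpace F E; ℝ⟯) ∘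
        (extChartAt (I.prod 𝓘(ℝ, F)) (zeroPt F (E := E) x₀)).symm) z : EB × F →L[ℝ] ℝ)
        (K.1 z) := by
  have := t2Space_totalSpace (F := F) E
  set g := (pullback f : C^∞⟮I.prod 𝓘(ℝ, F), TotalSpace F E; ℝ⟯) ∘
        (extChartAt (I.prod 𝓘(ℝ, F)) (zeroPt F (E := E) x₀)).symm with hg
  have hsm : DifferentiableAt ℝ g z :=
    ((contDiffOn_comp_symm (zeroPt F x₀) _).contDiffAt
      ((isOpen_extChartAt_target _).mem_nhds (hm.subset hz))).differentiableAt (by simp)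
  have hval : ∀ y ∈ O, (chartSection I F E x₀ (fnSection f)).1 y = algebraMap ℝ _ (g y) := by
    intro y hy
    rw [hm.chartSection_apply hy, hg, Function.comp_apply,
      (extChartAt_zeroPt_symm (hm.subset hy)).2]
    change ExteriorAlgebra.map _ (extTriv F E x₀ _ (algebraMap ℝ _ _)) = _
    rw [AlgHom.commutes, AlgHom.commutes]
    rfl
  have hev : (chartSection I F E x₀ (fnSection f)).1 =ᶠ[𝓝 z] fun y ↦
      LinearMap.toContinuousLinearMap (Algebra.linearMap ℝ (ExteriorAlgebra ℝ (EB × F))) (g y) := by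
    filter_upwards [hm.isOpen.mem_nhds hz] with y hy using hval y hy
  have hfd : ∀ w, fderiv ℝ (chartSection I F E x₀ (fnSection f)).1 z w =
      algebraMap ℝ _ (fderiv ℝ g z w) := by
    intro w
    rw [hev.fderiv_eq]
    have := ((LinearMap.toContinuousLinearMap (Algebra.linearMap ℝ
      (ExteriorAlgebra ℝ (EB × F)))).hasFDerivAt.comp z hsm.hasFDerivAt).fderiv
    exact congrArg (fun L : EB × F →L[ℝ] ExteriorAlgebra ℝ (EB × F) ↦ L w) this
  have hdec : ((fderiv ℝ g z : EB × F →L[ℝ] ℝ) : EB × F →ₗ[ℝ] ℝ) =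
      ∑ i, fderiv ℝ g z (prodBasis EB F i) • (prodBasis EB F).coord i :=
    dual_eq_sum_smul_coord (prodBasis EB F) _
  have hlin : ∀ (c : Fin (Module.finrank ℝ EB) ⊕ Fin (Module.finrank ℝ F) → ℝ)
      (u : _ → Module.Dual ℝ (EB × F)) (ξ : ExteriorAlgebra ℝ (EB × F)),
      extContract (∑ i, c i • u i) ξ = ∑ i, c i • extContract (u i) ξ := fun c u ξ ↦ by
    simp only [extContract, map_sum, map_smul, LinearMap.sum_apply, LinearMap.smul_apply]
  rw [polyvector_tau_apply, hval z hz, hdec, hlin, ← Finset.sum_neg_distrib]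
  refine Finset.sum_congr rfl fun i _ ↦ ?_
  rw [extContract_algebraMap, mul_zero, sub_zero, hfd, ← Algebra.commutes, ← Algebra.smul_def]
  rfl

end LocalFormula

end

/-! ### The chart brackets satisfy the pointwise conditions. -/

section

attribute [local instance] extNormedAddCommGroup extNormedSpace

open Filter Topology

section LocalStructure

universe u
variable {EB : Type u} [NormedAddCommGroup EB] [NormedSpace ℝ EB] [FiniteDimensional ℝ EB]
  {HB : Type*} [TopologicalSpace HB] {I : ModelWithCorners ℝ EB HB} [I.Boundaryless]
  {C : Type*} [TopologicalSpace C] [T2Space C] [ChartedSpace HB C] [IsManifold I ∞ C]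
  {F : Type*} [NormedAddCommGroup F] [NormedSpace ℝ F] [FiniteDimensional ℝ F]
  {E : C → Type*} [∀ x, AddCommGroup (E x)] [∀ x, Module ℝ (E x)]
  [TopologicalSpace (TotalSpace F E)] [∀ x, TopologicalSpace (E x)]
  [FiberBundle F E] [VectorBundle ℝ F E] [ContMDiffVectorBundle ∞ F E I]
  {P : PoissonBracket ℝ C^∞⟮I.prod 𝓘(ℝ, F), TotalSpace F E; ℝ⟯}
  {x₀ x : C} {H : smoothExt (EB × F) (EB × F)} {O : Set (EB × F)}

theorem IsLocalModel.symm_zeroPt (hm : IsLocalModel P x₀ H O)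
    (hx : x ∈ (extChartAt I x₀).source) (hxO : (extChartAt I x₀ x, 0) ∈ O) :
    (extChartAt (I.prod 𝓘(ℝ, F)) (zeroPt F (E := E) x₀)).symm (extChartAt I x₀ x, 0) =
      zeroPt F x := by
  rw [(extChartAt_zeroPt_symm (hm.subset hxO)).2]
  change (⟨(extChartAt I x₀).symm (extChartAt I x₀ x), _⟩ : TotalSpace F E) = _
  rw [(extChartAt I x₀).left_inv hx, map_zero]
  rfl

theorem pairTwo_extContract (u w : Module.Dual ℝ (EB × F)) (ξ : ExteriorAlgebra ℝ (EB × F)) :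
    pairOne (extContract u ξ) w = pairTwo ξ u w := rfl

theorem IsLocalModel.isSkewDerivation (hm : IsLocalModel P x₀ H O)
    (hx : x ∈ (extChartAt I x₀).source) (hxO : (extChartAt I x₀ x, 0) ∈ O) (n : ℕ) :
    IsSkewDerivation x (localBracket I E x₀ x H (n + 1)) where
  degree d a ha := Submodule.smul_mem _ _ (chartReadback_mem
    (polyvector_iter_mem (prodFrame EB F) hm.degree (n + 1) fun i ↦ chartSection_mem x₀ (ha i)))
  skew d a ha i := by
    rw [localBracket_apply, Darboux.iter_swap H (fun i ↦ P_chartSection x₀ (a i))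
      (fun i ↦ inv_chartSection (ha i)) i, map_neg, smul_neg, localBracket_apply,
      Units.smul_def, Units.smul_def, map_zsmul,
      smul_comm (bracketSign (n + 1))]
    rfl
  leibniz d a ha e b c hb := by
    have hs : ∀ t, (polyvector (prodFrame EB F)).iter H (n + 1) (fun i ↦ chartSection I F E x₀
        (Fin.snoc (α := fun _ ↦ extSections I F E) a t i)) =
        (polyvector (prodFrame EB F)).tau (chartSection I F E x₀ t)
          ((polyvector (prodFrame EB F)).iter H n fun i ↦ chartSection I F E x₀ (a i)) := by
      intro t
      rw [Darboux.iter_succ, Fin.snoc_last]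
      simp only [Fin.snoc_castSucc]
    set K := (polyvector (prodFrame EB F)).iter H n fun i ↦ chartSection I F E x₀ (a i)
    have hK : (polyvector (prodFrame EB F)).inv K = (2 - n + ∑ i, d i).negOnePow • K :=
      inv_of_mem _ (polyvector_iter_mem _ hm.degree n fun i ↦ chartSection_mem x₀ (ha i))
    -- The cutoff in `chartSection` spoils multiplicativity globally, but near the point it equals
    -- one and only the germ matters.
    have h1 : ((polyvector (prodFrame EB F)).tau (chartSection I F E x₀ (b * c)) K).1
        (extChartAt I x₀ x, 0) = ((polyvector (prodFrame EB F)).tau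
          (chartSection I F E x₀ b * chartSection I F E x₀ c) K).1 (extChartAt I x₀ x, 0) :=
      (polyvector_tau_congr _ (hm.chartSection_mul hxO b c) (EventuallyEq.refl _ _)).self_of_nhds
    rw [localBracket_apply, localBracket_apply, localBracket_apply, hs, hs, hs, chartReadback_apply,
      h1, ← chartReadback_apply, Darboux.tau_mul (P_chartSection x₀ b) (P_chartSection x₀ c)
        (inv_chartSection hb) hK, map_add, Units.smul_def, map_zsmul, chartReadback_mul,
      chartReadback_mul, hm.chartReadback_chartSection hx hxO, hm.chartReadback_chartSection hx hxO,
      smul_add, smul_mul_assoc, mul_smul_comm, ← Units.smul_def, smul_comm (bracketSign (n + 1)),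
      show (2 - (n : ℤ) + ∑ i, d i - 1) = 2 - (n + 1) + ∑ i, d i by ring]

theorem IsLocalModel.represents_zeroPt (hm : IsLocalModel P x₀ H O)
    (hx : x ∈ (extChartAt I x₀).source) (hxO : (extChartAt I x₀ x, 0) ∈ O) {m : ℕ}
    (v : Fin m → Cₛ^∞⟮I; F, E⟯) (f g : C^∞⟮I.prod 𝓘(ℝ, F), TotalSpace F E; ℝ⟯) :
    iterLieVert v (fun f g ↦ P.bracket f g) f g (zeroPt F x) = (-1) ^ m *
      pairTwo (((polyvector (prodFrame EB F)).iter H m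
        fun i ↦ chartSection I F E x₀ (vecSection (v i))).1 (extChartAt I x₀ x, 0))
        (fderiv ℝ (f ∘ (extChartAt (I.prod 𝓘(ℝ, F)) (zeroPt F (E := E) x₀)).symm)
          (extChartAt I x₀ x, 0) : EB × F →L[ℝ] ℝ)
        (fderiv ℝ (g ∘ (extChartAt (I.prod 𝓘(ℝ, F)) (zeroPt F (E := E) x₀)).symm)
          (extChartAt I x₀ x, 0) : EB × F →L[ℝ] ℝ) := by
  have h := hm.represents_iterLieVert v (extChartAt I x₀ x, 0) hxO f g
  rw [hm.symm_zeroPt hx hxO] at h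
  rw [h, smoothExt.smul_apply, ← pairTwoL_apply, map_smul, smul_eq_mul, pairTwoL_apply]

variable [∀ x, IsTopologicalAddGroup (E x)] [∀ x, ContinuousSMul ℝ (E x)]

/-- A fibre-linear function vanishes along the zero section and is linear along the fibre, so at a
point of the zero section its differential is the covector itself and has no horizontal part. -/
theorem IsLocalModel.fderiv_fibreLinear (hm : IsLocalModel P x₀ H O)
    (hx : x ∈ (extChartAt I x₀).source) (hxO : (extChartAt I x₀ x, 0) ∈ O)
    (u : Cₛ^∞⟮I; F →L[ℝ] ℝ, fun x ↦ E x →L[ℝ] Trivial C ℝ x⟯) :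
    ((fderiv ℝ (fibreLinear u ∘ (extChartAt (I.prod 𝓘(ℝ, F)) (zeroPt F (E := E) x₀)).symm)
      (extChartAt I x₀ x, 0) : EB × F →L[ℝ] ℝ) : EB × F →ₗ[ℝ] ℝ) =
      ((u x : E x →L[ℝ] ℝ) : E x →ₗ[ℝ] ℝ) ∘ₗ
        ((trivializationAt F E x₀).symmₗ ℝ x ∘ₗ LinearMap.snd ℝ EB F) := by
  have := t2Space_totalSpace (F := F) E
  set g := fibreLinear u ∘ (extChartAt (I.prod 𝓘(ℝ, F)) (zeroPt F (E := E) x₀)).symm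
  have hz := hm.subset hxO
  have hd := (extChartAt_zeroPt_symm hz).1
  have hg : HasFDerivAt g (fderiv ℝ g (extChartAt I x₀ x, 0)) (extChartAt I x₀ x, 0) :=
    (((contDiffOn_comp_symm (zeroPt F x₀) _).contDiffAt
      ((isOpen_extChartAt_target _).mem_nhds hz)).differentiableAt (by simp)).hasFDerivAt
  have hval : ∀ ξ ∈ chartDomain I F E x₀, ∀ y, g (ξ, y) = (u ((extChartAt I x₀).symm ξ) : E _ →L[ℝ] ℝ)
      ((trivializationAt F E x₀).symmₗ ℝ ((extChartAt I x₀).symm ξ) y) := by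
    intro ξ hξ y
    change fibreLinear u _ = _
    rw [(extChartAt_zeroPt_symm (mem_target_zeroPt hξ y)).2]
    rfl
  have h1 : HasFDerivAt (fun ξ ↦ g (ξ, 0)) (fderiv ℝ g (extChartAt I x₀ x, 0) ∘L
      ContinuousLinearMap.inl ℝ EB F) (extChartAt I x₀ x) :=
    HasFDerivAt.comp (f := fun ξ : EB ↦ (ξ, (0 : F))) (extChartAt I x₀ x) hg
      (hasFDerivAt_prodMk_left _ _)
  have h2 : HasFDerivAt (fun y ↦ g (extChartAt I x₀ x, y)) (fderiv ℝ g (extChartAt I x₀ x, 0) ∘L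
      ContinuousLinearMap.inr ℝ EB F) 0 :=
    HasFDerivAt.comp (f := fun y : F ↦ (extChartAt I x₀ x, y)) 0 hg (hasFDerivAt_prodMk_right _ _)
  have h1' : (fun ξ ↦ g (ξ, 0)) =ᶠ[𝓝 (extChartAt I x₀ x)] fun _ ↦ 0 := by
    filter_upwards [(isOpen_chartDomain x₀).mem_nhds hd] with ξ hξ
    rw [hval ξ hξ, map_zero]
    exact map_zero (u ((extChartAt I x₀).symm ξ) : E _ →L[ℝ] ℝ)
  have h2' : (fun y ↦ g (extChartAt I x₀ x, y)) = LinearMap.toContinuousLinearMap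
      (((u x : E x →L[ℝ] ℝ) : E x →ₗ[ℝ] ℝ) ∘ₗ (trivializationAt F E x₀).symmₗ ℝ x) := by
    funext y
    rw [hval _ hd, (extChartAt I x₀).left_inv hx]
    rfl
  have e1 := h1.unique ((hasFDerivAt_const (0 : ℝ) _).congr_of_eventuallyEq h1')
  rw [h2'] at h2
  have e2 := h2.unique (ContinuousLinearMap.hasFDerivAt _)
  refine LinearMap.prod_ext (LinearMap.ext fun ξ ↦ ?_) (LinearMap.ext fun y ↦ ?_)
  · refine (congrArg (fun L : EB →L[ℝ] ℝ ↦ L ξ) e1).trans ?_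
    change (0 : ℝ) = (u x : E x →L[ℝ] ℝ) ((trivializationAt F E x₀).symmₗ ℝ x 0)
    rw [map_zero]
    exact (map_zero (u x : E x →L[ℝ] ℝ)).symm
  · exact congrArg (fun L : F →L[ℝ] ℝ ↦ L y) e2

theorem bracketSign_mul (n : ℕ) (r : ℝ) : bracketSign n * r = pInftySign n * ((-1) ^ n * r) := by
  rw [bracketSign, mul_assoc]

/-- Every argument, whether a section or a function, contributes one factor `-1`: a section through
the Lie derivative, a function through `tau_fn`. The factor `(-1) ^ n` in `bracketSign` removes them
all at once. -/
theorem IsLocalModel.isPInftyAt (hm : IsLocalModel P x₀ H O)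
    (hx : x ∈ (extChartAt I x₀).source) (hxO : (extChartAt I x₀ x, 0) ∈ O) :
    IsPInftyAt P x fun n ↦ localBracket I E x₀ x H n where
  skewDerivation := hm.isSkewDerivation hx hxO
  degree_zero a := Submodule.smul_mem _ _ (chartReadback_mem hm.degree)
  vec n v u w := by
    rw [hm.represents_zeroPt hx hxO, hm.fderiv_fibreLinear hx hxO, hm.fderiv_fibreLinear hx hxO,
      localBracket_apply, ← pairTwoL_apply, map_smul, smul_eq_mul, pairTwoL_apply,
      chartReadback_apply, pairTwo_map, bracketSign_mul]
  fn m v f u := by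
    rw [hm.represents_zeroPt hx hxO, hm.fderiv_fibreLinear hx hxO, localBracket_apply,
      Fin.append_right_eq_snoc, Darboux.iter_succ, Fin.snoc_last]
    simp only [Fin.snoc_castSucc]
    have hs : ∀ (r : ℝ) (ξ : ExteriorAlgebra ℝ (E x)) (u : Module.Dual ℝ (E x)),
        pairOne (r • ξ) u = r * pairOne ξ u := fun r ξ u ↦ by
      simp only [pairOne, map_smul, smul_eq_mul]
    have hn : ∀ (ξ : ExteriorAlgebra ℝ (EB × F)) (u : Module.Dual ℝ (EB × F)),
        pairOne (-ξ) u = -pairOne ξ u := fun ξ u ↦ by simp only [pairOne, map_neg]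
    rw [hs, chartReadback_apply, pairOne_map]
    erw [hm.tau_fn hxO]
    rw [hn, pairTwo_extContract, bracketSign_mul, pow_succ]
    ring
  fn_fn m v f g := by
    have ha : Fin.append (fun i ↦ vecSection (v i)) ![fnSection f, fnSection g] =
        Fin.snoc (α := fun _ ↦ extSections I F E) (Fin.snoc (α := fun _ ↦ extSections I F E)
          (fun i ↦ vecSection (v i)) (fnSection f)) (fnSection g) := by
      have : ![(fnSection f : extSections I F E), fnSection g] =
          Fin.snoc (α := fun _ ↦ extSections I F E) ![fnSection f] (fnSection g) := by
        ext i; fin_cases i <;> rfl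
      rw [this, Fin.append_snoc, Fin.append_right_eq_snoc]
      rfl
    rw [← iterLieVert_pullback, hm.represents_zeroPt hx hxO, localBracket_apply, ha,
      Darboux.iter_succ, Darboux.iter_succ]
    simp only [Fin.snoc_last, Fin.snoc_castSucc]
    rw [chartReadback_apply, hm.tau_fn hxO, hm.tau_fn hxO, map_neg, map_neg, map_neg, neg_neg,
      extContract_extContract_of_mem (iter_chartSection_vec_mem hm.degree _ _), AlgHom.commutes,
      Algebra.smul_def, ← map_mul, bracketSign_mul, pow_add]
    norm_num

end LocalStructure

end

/-! ### Gluing the chart brackets into a global structure. -/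

section

attribute [local instance] extNormedAddCommGroup extNormedSpace

open Filter Topology

/-- Triangular numbers satisfy `T (q + m) = T q + T m + q m`. Thus the sign `(-1) ^ (q m)` of the
Jacobi identity turns the normalizations into an overall sign times `(-1) ^ m`, the sign in
`Darboux.sum_nested_odd`. -/
theorem bracketSign_jacobi (q m : ℕ) : bracketSign (m + 1) * bracketSign q * (-1) ^ (q * m) =
    (-1) ^ ((q + m) * (q + m + 1) / 2 + (q + m)) * (-1) ^ m := by
  obtain ⟨a, ha⟩ := Nat.even_mul_succ_self m
  obtain ⟨b, hb⟩ := Nat.even_mul_succ_self q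
  have h1 : (m + 1) * (m + 1 + 1) / 2 = a + m + 1 :=
    Nat.div_eq_of_eq_mul_left two_pos (by linarith)
  have h2 : q * (q + 1) / 2 = b := Nat.div_eq_of_eq_mul_left two_pos (by linarith)
  have h3 : (q + m) * (q + m + 1) / 2 = a + b + q * m :=
    Nat.div_eq_of_eq_mul_left two_pos (by linarith)
  rw [bracketSign, bracketSign, pInftySign, pInftySign, h1, h2, h3]
  simp only [← pow_add]
  rw [show a + m + 1 + 1 + (m + 1) + (b + 1 + q) + q * m =
    a + b + q * m + (q + m) + m + 4 by ring, pow_add _ _ 4]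
  norm_num

section Global

universe u
variable {EB : Type u} [NormedAddCommGroup EB] [NormedSpace ℝ EB] [FiniteDimensional ℝ EB]
  {HB : Type*} [TopologicalSpace HB] {I : ModelWithCorners ℝ EB HB} [I.Boundaryless]
  {C : Type*} [TopologicalSpace C] [T2Space C] [ChartedSpace HB C] [IsManifold I ∞ C]
  {F : Type*} [NormedAddCommGroup F] [NormedSpace ℝ F] [FiniteDimensional ℝ F]
  {E : C → Type*} [∀ x, AddCommGroup (E x)] [∀ x, Module ℝ (E x)]
  [TopologicalSpace (TotalSpace F E)] [∀ x, TopologicalSpace (E x)]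
  [∀ x, IsTopologicalAddGroup (E x)] [∀ x, ContinuousSMul ℝ (E x)]
  [FiberBundle F E] [VectorBundle ℝ F E] [ContMDiffVectorBundle ∞ F E I]
  (P : PoissonBracket ℝ C^∞⟮I.prod 𝓘(ℝ, F), TotalSpace F E; ℝ⟯)

/-- The values at `x` of the brackets induced by a Poisson bracket. -/
def bracketAt (x : C) (n : ℕ) :
    MultilinearMap ℝ (fun _ : Fin n ↦ extSections I F E) (ExteriorAlgebra ℝ (E x)) :=
  localBracket I E x x (exists_isLocalModel P x).choose n

theorem isPInftyAt_bracketAt (x : C) : IsPInftyAt P x (bracketAt P x) := by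
  have hm := (exists_isLocalModel P x).choose_spec.choose_spec
  exact hm.isPInftyAt (mem_extChartAt_source x) hm.mem

variable {P}

theorem IsLocalModel.eventually {x₀ : C} {H : smoothExt (EB × F) (EB × F)} {O : Set (EB × F)}
    (hm : IsLocalModel P x₀ H O) :
    ∀ᶠ x in 𝓝 x₀, x ∈ (extChartAt I x₀).source ∧ (extChartAt I x₀ x, 0) ∈ O := by
  have h : ContinuousAt (fun x ↦ (extChartAt I x₀ x, (0 : F))) x₀ :=
    (continuousAt_extChartAt x₀).prodMk continuousAt_const
  exact Filter.Eventually.and (extChartAt_source_mem_nhds x₀) (h (hm.isOpen.mem_nhds hm.mem))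

/-- Independence of the chart is a consequence of pointwise uniqueness, so no transformation law has
to be computed. -/
theorem IsLocalModel.bracketAt_eq {x₀ x : C} {H : smoothExt (EB × F) (EB × F)} {O : Set (EB × F)}
    (hm : IsLocalModel P x₀ H O) (hx : x ∈ (extChartAt I x₀).source)
    (hxO : (extChartAt I x₀ x, 0) ∈ O) (n : ℕ) : bracketAt P x n = localBracket I E x₀ x H n :=
  congrFun ((isPInftyAt_bracketAt P x).eq (hm.isPInftyAt hx hxO)) n

variable (P)

/-- Near `x₀` all values can be computed in the one chart at `x₀`, where they depend smoothly on the
point. -/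
theorem bracketAt_mem_extSections (n : ℕ) (a : Fin n → extSections I F E) :
    (fun x ↦ bracketAt P x n a) ∈ extSections I F E := by
  refine mem_extSections_of_locally fun x₀ ↦ ?_
  obtain ⟨H, O, hm⟩ := exists_isLocalModel P x₀
  set G := (polyvector (prodFrame EB F)).iter H n fun i ↦ chartSection I F E x₀ (a i)
  obtain ⟨t, -, ht⟩ := exists_mem_adjoin (I := I) (F := F) (E := E) x₀
    (chart_source_mem_nhds HB x₀)
    (K := fun x ↦ bracketSign n • ExteriorAlgebra.map (LinearMap.snd ℝ EB F)
      (G.1 (extChartAt I x₀ x, 0))) fun ℓ ↦ by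
    have h1 : ContDiff ℝ ∞ fun ξ : EB ↦ LinearMap.toContinuousLinearMap
        (ℓ ∘ₗ (bracketSign n • (ExteriorAlgebra.map (LinearMap.snd ℝ EB F)).toLinearMap))
          (G.1 (ξ, 0)) :=
      (ContinuousLinearMap.contDiff _).comp
        ((smoothExt.contDiff G).comp (contDiff_id.prodMk contDiff_const))
    exact h1.contMDiff.comp_contMDiffOn contMDiffOn_extChartAt
  refine ⟨t, ?_⟩
  filter_upwards [ht, hm.eventually] with x hx hxm
  rw [hx, hm.bracketAt_eq hxm.1 hxm.2, localBracket_apply, map_smul, chartReadback_apply,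
    ← map_map_apply]
  rfl

/-- The brackets on `Γ(C, ∧E)` induced by a Poisson bracket on the total space. -/
def inducedBracket (n : ℕ) :
    MultilinearMap ℝ (fun _ : Fin n ↦ extSections I F E) (extSections I F E) where
  toFun a := ⟨fun x ↦ bracketAt P x n a, bracketAt_mem_extSections P n a⟩
  map_update_add' a i b c := Subtype.ext (funext fun x ↦ (bracketAt P x n).map_update_add a i b c)
  map_update_smul' a i r b :=
    Subtype.ext (funext fun x ↦ (bracketAt P x n).map_update_smul a i r b)

theorem inducedBracket_apply (n : ℕ) (a : Fin n → extSections I F E) (x : C) :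
    (inducedBracket P n a).1 x = bracketAt P x n a := rfl

variable {P}

/-- An equality of germs is needed, not just of values at the centre, because the outer bracket of a
nested expression differentiates its first argument. -/
theorem IsLocalModel.chartSection_inducedBracket {x₀ : C} {H : smoothExt (EB × F) (EB × F)}
    {O : Set (EB × F)} (hm : IsLocalModel P x₀ H O) (n : ℕ) (a : Fin n → extSections I F E) :
    (chartSection I F E x₀ (inducedBracket P n a)).1 =ᶠ[𝓝 (extChartAt I x₀ x₀, 0)]
      (bracketSign n • (polyvector (prodFrame EB F)).P ((polyvector (prodFrame EB F)).iter H n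
        fun i ↦ chartSection I F E x₀ (a i))).1 := by
  have hc : ContinuousAt (fun z : EB × F ↦ (z.1, (0 : F))) (extChartAt I x₀ x₀, 0) := by fun_prop
  filter_upwards [hm.isOpen.mem_nhds hm.mem, hc (hm.isOpen.mem_nhds hm.mem)] with z hz hz0
  obtain ⟨hz1, hz2⟩ := (extChartAt_zeroPt_symm (hm.subset hz)).1
  have hx : (extChartAt I x₀).symm z.1 ∈ (extChartAt I x₀).source :=
    (extChartAt I x₀).map_target hz1
  have hxz := (extChartAt I x₀).right_inv hz1
  have hxO : (extChartAt I x₀ ((extChartAt I x₀).symm z.1), 0) ∈ O := by rw [hxz]; exact hz0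
  rw [hm.chartSection_apply hz, inducedBracket_apply, hm.bracketAt_eq hx hxO, localBracket_apply,
    chartReadback_apply, hxz, ← map_map_apply]
  set ξ := ((polyvector (prodFrame EB F)).iter H n fun i ↦ chartSection I F E x₀ (a i)).1 (z.1, 0)
  rw [map_smul, map_smul]
  erw [extTriv_extTrivSymm hz2 (ExteriorAlgebra.map (LinearMap.snd ℝ EB F) ξ)]
  rw [map_map_apply]
  rfl

theorem IsLocalModel.jacobiTerm_inducedBracket {x₀ : C} {H : smoothExt (EB × F) (EB × F)}
    {O : Set (EB × F)} (hm : IsLocalModel P x₀ H O) (n : ℕ) (a : Fin n → extSections I F E) :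
    (jacobiTerm (inducedBracket P) n a).1 x₀ = (-1 : ℝ) ^ (n * (n + 1) / 2 + n) •
      chartReadback I F E x₀ x₀ (∑ q : Fin (n + 1), ((-1 : ℝ) ^ (n - q : ℕ) /
        ((Nat.factorial q : ℝ) * (Nat.factorial (n - q) : ℝ))) •
        (polyvector (prodFrame EB F)).nested H q (n - q) (n := n) (by omega)
          fun i ↦ chartSection I F E x₀ (a i)) := by
  have hev : (jacobiTerm (inducedBracket P) n a).1 x₀ =
      evalSection I F E x₀ (jacobiTerm (inducedBracket P) n a) := rfl
  rw [hev, jacobiTerm, map_sum, map_sum, Finset.smul_sum]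
  refine Finset.sum_congr rfl fun q _ ↦ ?_
  -- Reading back at a point already restricts to the zero section and forgets the horizontal part,
  -- so the outer projection is redundant.
  have hP : ∀ K : smoothExt (EB × F) (EB × F), chartReadback I F E x₀ x₀
      ((polyvector (prodFrame EB F)).P K) = chartReadback I F E x₀ x₀ K := fun K ↦
    map_map_apply _ _ _
  set b := fun i : Fin q ↦ a ⟨i, by omega⟩
  set c := fun j : Fin (n - q) ↦ a ⟨q + j, by omega⟩
  have key : bracketAt P x₀ (n - q + 1) (Fin.cons (α := fun _ ↦ extSections I F E)
      (inducedBracket P q b) c) = (bracketSign (n - q + 1) * bracketSign q) •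
        chartReadback I F E x₀ x₀ ((polyvector (prodFrame EB F)).nested H q (n - q) (n := n)
          (by omega) fun i ↦ chartSection I F E x₀ (a i)) := by
    rw [Darboux.nested_apply, hP, hm.bracketAt_eq (mem_extChartAt_source x₀) hm.mem,
      localBracket_apply, mul_smul]
    congr 1
    rw [← map_smul, ← MultilinearMap.cons_smul, chartReadback_apply, chartReadback_apply]
    congr 1
    refine (polyvector_iter_congr _ (EventuallyEq.refl _ _) _ fun i ↦ ?_).self_of_nhds
    induction i using Fin.cases with
    | zero => exact hm.chartSection_inducedBracket q b
    | succ i => exact EventuallyEq.refl _ _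
  rw [map_smul, map_smul]
  change _ • bracketAt P x₀ (n - q + 1) (Fin.cons (α := fun _ ↦ extSections I F E)
      (inducedBracket P q b) c) = _
  rw [key, smul_smul, smul_smul]
  congr 1
  have hs := bracketSign_jacobi q (n - q)
  rw [show (q : ℕ) + (n - q) = n by omega] at hs
  rw [div_mul_eq_mul_div, mul_comm _ (_ * _), hs, mul_div_assoc]

variable (P)

/-- The `P_∞`-structure induced by a Poisson bracket on the total space. -/
def inducedPInfty : PInftyStructure (extSectionsDeg I F E) where
  br := inducedBracket P
  degree n d a ha := by
    refine mem_extSectionsDeg.2 fun x ↦ ?_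
    rw [inducedBracket_apply]
    cases n with
    | zero => simpa using (isPInftyAt_bracketAt P x).degree_zero a
    | succ n => exact ((isPInftyAt_bracketAt P x).skewDerivation n).degree d a ha
  skew n d a ha i := by
    ext x
    rw [← evalSection_apply, ← evalSection_apply, map_neg, Units.smul_def, map_zsmul, ← Units.smul_def]
    exact ((isPInftyAt_bracketAt P x).skewDerivation n).skew d a ha i
  leibniz n d a ha e b c hb := by
    ext x
    rw [← evalSection_apply, ← evalSection_apply, map_add, Units.smul_def, map_zsmul, ← Units.smul_def, map_mul, map_mul]
    exact ((isPInftyAt_bracketAt P x).skewDerivation n).leibniz d a ha e b c hb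
  jacobi n d a ha := by
    ext x
    obtain ⟨H, O, hm⟩ := exists_isLocalModel P x
    change evalSection I F E x _ = 0
    -- The point has zero fibre coordinate and is fixed by the projection of the frame, so it
    -- suffices that `{H, H}` vanishes near it.
    have hj := polyvector_jacobi (prodFrame EB F) (d := d) hm.degree (z := (extChartAt I x x, 0))
      (by
        filter_upwards [hm.isOpen.mem_nhds hm.mem] with z hz using hm.jacobi z hz)
      (fun k ↦ chartSection_mem x (ha k)) fun k ↦ P_chartSection x (a k)
    have hj' := congrArg (fun ξ ↦ (-1 : ℝ) ^ (n * (n + 1) / 2 + n) • ExteriorAlgebra.map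
      ((trivializationAt F E x).symmₗ ℝ x ∘ₗ LinearMap.snd ℝ EB F) ξ) hj
    simp only [map_zero, smul_zero] at hj'
    rw [map_sum] at hj' ⊢
    rw [Finset.smul_sum] at hj'
    refine (Finset.sum_congr rfl fun σ _ ↦ ?_).trans hj'
    rw [Units.smul_def, Units.smul_def, map_zsmul, map_zsmul, smul_comm]
    congr 1
    refine (hm.jacobiTerm_inducedBracket n (a ∘ σ)).trans ?_
    rw [chartReadback_apply, smoothExt.sum_apply]
    rfl

/-- Degree, skew symmetry and the Leibniz rule pass to values at a point for any `P_∞`-structure, so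
the three formulas are the only real condition. This reduces the comparison of two structures to one
at each point. -/
theorem isPInftyAt_iff (lam : PInftyStructure (extSectionsDeg I F E)) :
    (∀ x, IsPInftyAt P x fun n ↦ (evalSection I F E x).toLinearMap.compMultilinearMap (lam.br n)) ↔
      (∀ (m : ℕ) (v : Fin m → Cₛ^∞⟮I; F, E⟯) (f g : C^∞⟮I, C; ℝ⟯) (x : C),
        (lam.br (m + 2) (Fin.append (fun i ↦ vecSection (v i)) ![fnSection f, fnSection g])).1 x =
          algebraMap ℝ (ExteriorAlgebra ℝ (E x)) (pInftySign (m + 2) *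
            iterVertDeriv v (P.bracket (pullback f) (pullback g)) (zeroPt F x))) ∧
      (∀ (m : ℕ) (v : Fin m → Cₛ^∞⟮I; F, E⟯) (f : C^∞⟮I, C; ℝ⟯)
        (u : Cₛ^∞⟮I; F →L[ℝ] ℝ, fun x ↦ E x →L[ℝ] Trivial C ℝ x⟯) (x : C),
        pairOne ((lam.br (m + 1) (Fin.append (fun i ↦ vecSection (v i)) ![fnSection f])).1 x)
            (u x : E x →L[ℝ] ℝ) =
          pInftySign (m + 1) *
            iterLieVert v (fun h k ↦ P.bracket h k) (pullback f) (fibreLinear u) (zeroPt F x)) ∧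
      (∀ (n : ℕ) (v : Fin n → Cₛ^∞⟮I; F, E⟯)
        (u w : Cₛ^∞⟮I; F →L[ℝ] ℝ, fun x ↦ E x →L[ℝ] Trivial C ℝ x⟯) (x : C),
        pairTwo ((lam.br n fun i ↦ vecSection (v i)).1 x)
            (u x : E x →L[ℝ] ℝ) (w x : E x →L[ℝ] ℝ) =
          pInftySign n *
            iterLieVert v (fun h k ↦ P.bracket h k) (fibreLinear u) (fibreLinear w)
              (zeroPt F x)) := by
  refine ⟨fun h ↦ ⟨fun m v f g x ↦ (h x).fn_fn m v f g, fun m v f u x ↦ (h x).fn m v f u,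
    fun n v u w x ↦ (h x).vec n v u w⟩, fun h x ↦ ⟨fun n ↦ ⟨fun d a ha ↦ ?_, fun d a ha i ↦ ?_,
    fun d a ha e b c hb ↦ ?_⟩, fun a ↦ ?_, fun m v f g ↦ h.1 m v f g x, fun m v f u ↦ h.2.1 m v f u x,
    fun n v u w ↦ h.2.2 n v u w x⟩⟩
  · exact mem_extSectionsDeg.1 (lam.degree (n + 1) d a ha) x
  · change evalSection I F E x _ = -(_ • evalSection I F E x _)
    rw [lam.skew n d a ha i, map_neg, Units.smul_def, Units.smul_def, map_zsmul]
  · change evalSection I F E x _ = evalSection I F E x _ * evalSection I F E x c +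
      _ • (evalSection I F E x b * evalSection I F E x _)
    rw [lam.leibniz n d a ha e b c hb, map_add, Units.smul_def, Units.smul_def, map_zsmul, map_mul,
      map_mul]
  · have h2 : lam.br 0 a ∈ extSectionsDeg I F E 2 := by
      simpa using lam.degree 0 (fun _ ↦ 0) a fun i ↦ i.elim0
    exact mem_extSectionsDeg.1 h2 x

theorem PInftyStructure.ext_of_br {lam lam' : PInftyStructure (extSectionsDeg I F E)}
    (h : ∀ n a, lam.br n a = lam'.br n a) : lam = lam' := by
  have : lam.br = lam'.br := funext fun n ↦ MultilinearMap.ext (h n)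
  cases lam
  cases lam'
  congr

end Global

end

end

theorem mainTheorem9
    {EB : Type*} [NormedAddCommGroup EB] [NormedSpace ℝ EB] [FiniteDimensional ℝ EB]
    {HB : Type*} [TopologicalSpace HB] (I : ModelWithCorners ℝ EB HB) [I.Boundaryless]
    {C : Type*} [TopologicalSpace C] [T2Space C] [SigmaCompactSpace C]
    [ChartedSpace HB C] [IsManifold I ∞ C]
    (F : Type*) [NormedAddCommGroup F] [NormedSpace ℝ F] [FiniteDimensional ℝ F]
    (E : C → Type*) [∀ x, AddCommGroup (E x)] [∀ x, Module ℝ (E x)]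
    [TopologicalSpace (TotalSpace F E)] [∀ x, TopologicalSpace (E x)]
    [∀ x, IsTopologicalAddGroup (E x)] [∀ x, ContinuousSMul ℝ (E x)]
    [FiberBundle F E] [VectorBundle ℝ F E] [ContMDiffVectorBundle ∞ F E I]
    (P : PoissonBracket ℝ C^∞⟮I.prod 𝓘(ℝ, F), TotalSpace F E; ℝ⟯) :
    ∃! lam : PInftyStructure (extSectionsDeg I F E),
      (∀ (m : ℕ) (v : Fin m → Cₛ^∞⟮I; F, E⟯) (f g : C^∞⟮I, C; ℝ⟯) (x : C),
        (lam.br (m + 2) (Fin.append (fun i ↦ vecSection (v i)) ![fnSection f, fnSection g])).1 x =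
          algebraMap ℝ (ExteriorAlgebra ℝ (E x)) (pInftySign (m + 2) *
            iterVertDeriv v (P.bracket (pullback f) (pullback g)) (zeroPt F x))) ∧
      (∀ (m : ℕ) (v : Fin m → Cₛ^∞⟮I; F, E⟯) (f : C^∞⟮I, C; ℝ⟯)
        (u : Cₛ^∞⟮I; F →L[ℝ] ℝ, fun x ↦ E x →L[ℝ] Trivial C ℝ x⟯) (x : C),
        pairOne ((lam.br (m + 1) (Fin.append (fun i ↦ vecSection (v i)) ![fnSection f])).1 x)
            (u x : E x →L[ℝ] ℝ) =
          pInftySign (m + 1) *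
            iterLieVert v (fun h k ↦ P.bracket h k) (pullback f) (fibreLinear u) (zeroPt F x)) ∧
      (∀ (n : ℕ) (v : Fin n → Cₛ^∞⟮I; F, E⟯)
        (u w : Cₛ^∞⟮I; F →L[ℝ] ℝ, fun x ↦ E x →L[ℝ] Trivial C ℝ x⟯) (x : C),
        pairTwo ((lam.br n fun i ↦ vecSection (v i)).1 x)
            (u x : E x →L[ℝ] ℝ) (w x : E x →L[ℝ] ℝ) =
          pInftySign n *
            iterLieVert v (fun h k ↦ P.bracket h k) (fibreLinear u) (fibreLinear w)
              (zeroPt F x)) := by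
  simp only [← isPInftyAt_iff]
  refine ⟨inducedPInfty P, isPInftyAt_bracketAt P, fun lam h ↦ ?_⟩
  -- Two structures with the same brackets are equal, and the pointwise comparison of the brackets
  -- does not involve the Jacobi identities.
  refine PInftyStructure.ext_of_br fun n a ↦ Subtype.ext (funext fun x ↦ ?_)
  exact congrFun (congrArg DFunLike.coe (congrFun ((h x).eq (isPInftyAt_bracketAt P x)) n)) a
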